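/- \textbf{Setup.} For $n\ge 0$ let $\widetilde S_n$ be the group generated by $z,t_1,\dots,t_{n-1}$ with $z$ central and $$z^2=1,\quad t_i^2=z,\quad t_it_{i+1}t_i=t_{i+1}t_it_{i+1},\quad t_jt_i=z\,t_it_j\ \ (|i-j|>1),$$ and let $\widetilde S_\infty=\bigcup_n\widetilde S_n$. All elements below are taken in the integral spin group algebra $\mathbb Z\widetilde S_\infty/\langle z+1\rangle$. For $1\le i\le n$ put $x_i=t_it_{i+1}\cdots t_{n-1}t_nt_{n-1}\cdots t_{i+1}t_i\in\widetilde S_{n+1}$, and for distinct $i_1,\dots,i_k\in\{1,\dots,n\}$ define the cycle $$[i_1]=z,\qquad [i_1,\dots,i_k]=x_{i_1}x_{i_k}x_{i_{k-1}}\cdots x_{i_2}x_{i_1}\quad(k>1);$$ it lies in $\widetilde S_n$. Let $M_k=\sum_{i=1}^{k-1}[i,k]$ $(1\le k\le n)$ be the odd Jucys--Murphy elements, and let $$e_{r;n}=\sum_{1\le i_1<\cdots<i_r\le n}M_{i_1}^2\cdots M_{i_r}^2 .$$ Let $\mathcal{EP}(m)$ be the set of partitions of $m$ with only even parts. For $\lambda=(\lambda_1\ge\dots\ge\lambda_\ell)\in\mathcal{EP}(m)$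 with $\ell=\ell(\lambda)$, let $d_\lambda(n)$ be the image of the sum of all elements of the $\widetilde S_n$-conjugacy class of $$[1,\dots,\lambda_1+1]\,[\lambda_1+2,\dots,\lambda_1+\lambda_2+2]\cdots[\lambda_1+\dots+\lambda_{\ell-1}+\ell,\dots,\lambda_1+\dots+\lambda_\ell+\ell]$$ if $m+\ell\le n$, and $d_\lambda(n)=0$ otherwise. Finally, if $\lambda$ has $m_i$ parts equal to $i$, put $$P_\lambda(x)=(-1)^{\ell(\lambda)}\,\frac{x(x-1)\cdots(x-\ell(\lambda)+1)}{\prod_i m_i!}.$$ \textbf{Theorem.} Let $r\ge 1$ and $m=2r$. There is a unique family of integers $(A_\lambda)_{\lambda\in\mathcal{EP}(m)}$ such that for every $n\ge 0$ the element $$e_{r;n}-\sum_{\lambda\in\mathcal{EP}(m)}A_\lambda\,d_\lambda(n)$$ is an integral linear combination of class sums $d_\mu(n)$ with $\mu\in\mathcal{EP}(k)$, $k<m$ (that is, $\sum_\lambda A_\lambda d_\lambda$ is the top-degree part $e_r^*$ of the $r$-th elementary symmetric function in the $M_k^2$). These coefficients satisfy $$\sum_{\lambda\in\mathcal{EP}(m)}A_\lambda\,P_\lambda(-m)=2(-1)^r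 .$$ -/

import Mathlib

/-! Spin symmetric groups, class sums, odd Jucys-Murphy elements.
Letters are numbered from `0`: the group with index `n` covers the symmetric group on
`{0, …, n-1}`, and the generator `t i` covers the transposition `(i, i+1)`. -/

/-- Generators of the double covers: the central element and the `t i`. -/
inductive SpinGen : Type
  | z : SpinGen
  | t (i : ℕ) : SpinGen

/-- The defining relators of the double covers of the symmetric groups. -/
inductive SpinRelator : FreeGroup SpinGen → Prop
  | z_central (i : ℕ) :
      SpinRelator (FreeGroup.of .z * FreeGroup.of (.t i) *
        (FreeGroup.of (.t i) * FreeGroup.of .z)⁻¹)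
  | z_sq : SpinRelator (FreeGroup.of .z ^ 2)
  | t_sq (i : ℕ) : SpinRelator (FreeGroup.of (.t i) ^ 2 * (FreeGroup.of .z)⁻¹)
  | braid (i : ℕ) :
      SpinRelator (FreeGroup.of (.t i) * FreeGroup.of (.t (i + 1)) * FreeGroup.of (.t i) *
        (FreeGroup.of (.t (i + 1)) * FreeGroup.of (.t i) * FreeGroup.of (.t (i + 1)))⁻¹)
  | far (i j : ℕ) (h : i + 1 < j) :
      SpinRelator (FreeGroup.of (.t j) * FreeGroup.of (.t i) *
        (FreeGroup.of .z * FreeGroup.of (.t i) * FreeGroup.of (.t j))⁻¹)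

/-- The double cover of the infinite symmetric group, the union of the double covers of the
finite symmetric groups. -/
abbrev SpinCover : Type := PresentedGroup {w | SpinRelator w}

namespace SpinCover

/-- The central element `z`. -/
def z : SpinCover := PresentedGroup.of SpinGen.z

/-- The generator `t i`, a lift of the transposition `(i, i+1)`. -/
def t (i : ℕ) : SpinCover := PresentedGroup.of (SpinGen.t i)

/-- The double cover of the symmetric group on the `n` letters `0, …, n-1`, inside the union:
the subgroup generated by `z` and the `t i` with `i + 1 < n`. -/
def sub (n : ℕ) : Subgroup SpinCover :=
  Subgroup.closure ({z} ∪ {g | ∃ i, i + 1 < n ∧ g = t i})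

/-- `nest i d = t i * t (i+1) * ⋯ * t (i+d) * ⋯ * t (i+1) * t i`. -/
def nest : ℕ → ℕ → SpinCover
  | i, 0 => t i
  | i, d + 1 => t i * nest (i + 1) d * t i

/-- For a letter `i < n`, the element `x_i = t i ⋯ t (n-1) ⋯ t i` of the double cover on
`n + 1` letters, which lifts the transposition `(i, n)`. -/
def x (n i : ℕ) : SpinCover := nest i (n - 1 - i)

/-- The cycle `[i₁, …, iₘ]` on distinct letters below `n`: it is `z` for `m = 1` and
`x_{i₁} x_{iₘ} x_{iₘ₋₁} ⋯ x_{i₂} x_{i₁}` for `m > 1`. -/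
def cycle (n : ℕ) : List ℕ → SpinCover
  | [] => 1
  | [_] => z
  | i :: l => x n i * (l.reverse.map (x n)).prod * x n i

/-- The product of consecutive cycles
`[a, …, a + p₁] [a + p₁ + 1, …, a + p₁ + p₂ + 1] ⋯` for a list `p₁, p₂, …`. -/
def cycles (n : ℕ) : ℕ → List ℕ → SpinCover
  | _, [] => 1
  | a, p :: ps => cycle n (List.range' a (p + 1)) * cycles n (a + p + 1) ps

end SpinCover

/-- Partitions of `m` with only even parts. -/
abbrev EvenPartition (m : ℕ) : Type := {p : Nat.Partition m // ∀ i ∈ p.parts, Even i}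

namespace EvenPartition

/-- The number of parts. -/
def length {m : ℕ} (p : EvenPartition m) : ℕ := p.1.parts.card

/-- The polynomial `(-1)^ℓ X (X-1) ⋯ (X-ℓ+1) / ∏ᵢ mᵢ!`, where `ℓ` is the number of parts
and `mᵢ` is the number of parts equal to `i`. -/
noncomputable def poly {m : ℕ} (p : EvenPartition m) : Polynomial ℚ :=
  Polynomial.C ((-1) ^ p.length / ∏ i ∈ p.1.parts.toFinset, ((p.1.parts.count i).factorial : ℚ)) *
    descPochhammer ℚ p.length

/-- The distinguished element of modified type `p`: the product of consecutive cycles of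
lengths `p₁ + 1, p₂ + 1, …`, where `p₁ ≥ p₂ ≥ ⋯` are the parts. -/
def rep (n : ℕ) {m : ℕ} (p : EvenPartition m) : SpinCover :=
  SpinCover.cycles n 0 (p.1.parts.sort (· ≥ ·))

/-- The even split conjugacy class of modified type `p` in the double cover on `n` letters;
empty if `n` is too small to hold an element of modified type `p`. -/
def splitClass (n : ℕ) {m : ℕ} (p : EvenPartition m) : Set SpinCover :=
  {g | m + p.length ≤ n ∧ ∃ s ∈ SpinCover.sub n, g = s * p.rep n * s⁻¹}

end EvenPartition

/-- The relation `z = -1` on the integral group ring. -/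
inductive SpinAlgebraRel :
    MonoidAlgebra ℤ SpinCover → MonoidAlgebra ℤ SpinCover → Prop
  | z_eq : SpinAlgebraRel (MonoidAlgebra.of ℤ SpinCover SpinCover.z) (-1)

/-- The integral spin group algebra: the group ring modulo the two-sided ideal generated by
`z + 1`. -/
abbrev SpinAlgebra : Type := RingQuot SpinAlgebraRel

namespace SpinAlgebra

/-- The image of a group element. -/
noncomputable def ofCover (g : SpinCover) : SpinAlgebra :=
  RingQuot.mkRingHom SpinAlgebraRel (MonoidAlgebra.of ℤ SpinCover g)

/-- The image of the class sum of the (finite) even split class of modified type `p` on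
`n` letters; it is `0` if the class is empty. -/
noncomputable def classSum (n : ℕ) {m : ℕ} (p : EvenPartition m) : SpinAlgebra :=
  ∑ᶠ g ∈ p.splitClass n, ofCover g

/-- The odd Jucys-Murphy element `M_k = ∑_{i < k} [i, k]`, for a letter `k < n`. -/
noncomputable def jucysMurphy (n k : ℕ) : SpinAlgebra :=
  ∑ i ∈ Finset.range k, ofCover (SpinCover.cycle n [i, k])

/-- The `r`-th elementary symmetric function in the squares of the odd Jucys-Murphy elements
on `n` letters: the sum of `M_{i₁}² ⋯ M_{iᵣ}²` over `i₁ < ⋯ < iᵣ < n`. -/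
noncomputable def elemSymm (n r : ℕ) : SpinAlgebra :=
  ∑ s ∈ (Finset.range n).powersetCard r,
    ((s.sort (· ≤ ·)).map fun k => jucysMurphy n k ^ 2).prod

/-- The integral span of the class sums of modified types of size less than `m`. -/
noncomputable def lowerSpan (n m : ℕ) : Submodule ℤ SpinAlgebra :=
  Submodule.span ℤ {y | ∃ k < m, ∃ p : EvenPartition k, y = classSum n p}

/-- `A` is the family of coefficients of the top-degree part of the `r`-th elementary symmetric
function: for every `n`, the part of degree `2r` of `elemSymm n r` with respect to the
class sums is `∑ A_p d_p(n)`. -/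
def IsTopCoefficients (r : ℕ) (A : EvenPartition (2 * r) → ℤ) : Prop :=
  ∀ n : ℕ, elemSymm n r - ∑ p : EvenPartition (2 * r), A p • classSum n p ∈ lowerSpan n (2 * r)

end SpinAlgebra

/-! The coefficients can be found explicitly: `A_λ` is the product over the parts of `-Cat(λ_i /
2)`, with `Cat` the Catalan numbers (`EvenPartition.coeff`).

They are read off with a trace. The basic spin representation in a Clifford algebra shows `z ≠ 1`,
so the spin algebra carries a trace with `1 ↦ 1`, `z ↦ -1` and `0` on other group elements. The
trace of `g⁻¹ * y` is the coefficient of `g` in `y`. Let `W` be a product of disjoint cycles of odd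
lengths on `n` letters, of rank `n` minus the number of cycles. By `coeffFormula`, the trace of `W *
e_{r;n}` vanishes if the rank exceeds `2r`, and is the product of the signed Catalan numbers if it
equals `2r`. The induction on `n` uses `e_{r+1;n+1} = e_{r+1;n} + e_{r;n} M_n²`. Expanding `M_n²`
multiplies `W` by pairs `τ(n,i) τ(n,j)`, and only pairs whose product with `W` fixes `n` survive. If
`W` sends `n` to `a ≠ n`, then `i = a`. A letter `j` of another cycle joins two cycles and leaves a
rank too large to contribute; a letter `j` of the same cycle splits it. A split into two even cycles
contributes nothing, because central elements do not see even cycles (`trace_cycProd_mul_eq_zero`).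
The splits into two odd cycles add up to the Catalan recursion.

The elementary symmetric functions are central by a Hecke-type relation (`gen_mul_jm`,
`hecke_commute`). Every group element is, up to sign and conjugation, a distinguished element or
invisible to central elements, so a central element is recovered from its traces against the
inverses of distinguished elements (`eq_sum_csum`). This gives the expansion of `e_{r;n}`;
uniqueness follows because distinguished elements of different types are not conjugate even up to
`z`.

For the evaluation, the signs of `A_λ` and `P_λ` cancel, and `∑ A_λ P_λ(x)` is the coefficient of
`X^m` in `w^x`, where `w` is the Catalan series in `X²`, so that `w = 1 + X² w²`. At `x = -m` put `G
= w⁻¹` and `H = X² w`. Then `G + H = 1` and `G H = X²`, so the power sums `G^k + H^k` are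
polynomials given by a two-term recursion, and the coefficient of `X^{2r}` in the one with `k = 2r`
is `2(-1)^r`. Since `H^m` starts in degree `2m > m`, this is the coefficient for `G^m` alone. -/

namespace SpinCover

/-! ### The generators and basic homomorphisms -/

theorem z_mul_t (i : ℕ) : z * t i = t i * z := by
  have h := PresentedGroup.one_of_mem (rels := {w | SpinRelator w}) (SpinRelator.z_central i)
  rw [map_mul, map_inv, mul_inv_eq_one] at h
  simp only [map_mul] at h
  exact h

theorem z_mul_z : z * z = 1 := by
  have h := PresentedGroup.one_of_mem (rels := {w | SpinRelator w}) SpinRelator.z_sq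
  rw [pow_two, map_mul] at h
  exact h

theorem t_mul_t (i : ℕ) : t i * t i = z := by
  have h := PresentedGroup.one_of_mem (rels := {w | SpinRelator w}) (SpinRelator.t_sq i)
  rw [map_mul, map_inv, mul_inv_eq_one, pow_two, map_mul] at h
  exact h

theorem t_braid (i : ℕ) : t i * t (i + 1) * t i = t (i + 1) * t i * t (i + 1) := by
  have h := PresentedGroup.one_of_mem (rels := {w | SpinRelator w}) (SpinRelator.braid i)
  rw [map_mul, map_inv, mul_inv_eq_one] at h
  simp only [map_mul] at h
  exact h

theorem t_far {i j : ℕ} (hij : i + 1 < j) : t j * t i = z * t i * t j := by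
  have h := PresentedGroup.one_of_mem (rels := {w | SpinRelator w}) (SpinRelator.far i j hij)
  rw [map_mul, map_inv, mul_inv_eq_one] at h
  simp only [map_mul] at h
  exact h

theorem generators_induction {p : SpinCover → Prop} (g : SpinCover) (one : p 1) (hz : p z)
    (ht : ∀ i, p (t i)) (mul : ∀ a b, p a → p b → p (a * b)) (inv : ∀ a, p a → p a⁻¹) : p g := by
  have hg : g ∈ Subgroup.closure (Set.range (PresentedGroup.of (rels := {w | SpinRelator w}))) := by
    rw [PresentedGroup.closure_range_of]; trivial
  induction hg using Subgroup.closure_induction with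
  | mem x hx =>
    obtain ⟨y, rfl⟩ := hx
    cases y with
    | z => exact hz
    | t i => exact ht i
  | one => exact one
  | mul a b _ _ ha hb => exact mul a b ha hb
  | inv a _ ha => exact inv a ha

theorem z_mul_comm (g : SpinCover) : z * g = g * z := by
  induction g using generators_induction with
  | one => simp
  | hz => rfl
  | ht i => exact z_mul_t i
  | mul a b ha hb => rw [← mul_assoc, ha, mul_assoc, hb, mul_assoc]
  | inv a ha => exact Commute.inv_right (show Commute z a from ha)

theorem z_inv : z⁻¹ = z := inv_eq_of_mul_eq_one_right z_mul_z

theorem t_inv (i : ℕ) : (t i)⁻¹ = z * t i := by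
  apply inv_eq_of_mul_eq_one_right
  rw [z_mul_comm, ← mul_assoc, t_mul_t, z_mul_z]

/-- The homomorphism to a group given by images of the generators. -/
def lift {G : Type*} [Group G] (f : SpinGen → G)
    (h : ∀ r, SpinRelator r → FreeGroup.lift f r = 1) : SpinCover →* G :=
  PresentedGroup.toGroup (rels := {w | SpinRelator w}) (f := f) h

theorem lift_z {G : Type*} [Group G] (f : SpinGen → G)
    (h : ∀ r, SpinRelator r → FreeGroup.lift f r = 1) : lift f h z = f .z :=
  PresentedGroup.toGroup.of (rels := {w | SpinRelator w}) (f := f) h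

theorem lift_t {G : Type*} [Group G] (f : SpinGen → G)
    (h : ∀ r, SpinRelator r → FreeGroup.lift f r = 1) (i : ℕ) : lift f h (t i) = f (.t i) :=
  PresentedGroup.toGroup.of (rels := {w | SpinRelator w}) (f := f) h

theorem swap_braid {a b c : ℕ} (hab : a ≠ b) (hbc : b ≠ c) (hac : a ≠ c) :
    Equiv.swap a b * Equiv.swap b c * Equiv.swap a b =
      Equiv.swap b c * Equiv.swap a b * Equiv.swap b c := by
  ext x
  simp only [Equiv.Perm.mul_apply, Equiv.swap_apply_def]
  grind

theorem swap_far {a b c d : ℕ} (hac : a ≠ c) (had : a ≠ d) (hbc : b ≠ c) (hbd : b ≠ d) :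
    Equiv.swap a b * Equiv.swap c d = Equiv.swap c d * Equiv.swap a b := by
  ext x
  simp only [Equiv.Perm.mul_apply, Equiv.swap_apply_def]
  grind

/-- The underlying permutation. -/
def perm : SpinCover →* Equiv.Perm ℕ :=
  lift (fun | .z => 1 | .t i => Equiv.swap i (i + 1)) (by
    rintro _ (i | _ | i | i | ⟨i, j, h⟩)
    · simp
    · simp
    · simp [pow_two]
    · simp only [map_mul, map_inv, FreeGroup.lift_apply_of, mul_inv_eq_one]
      exact swap_braid (by omega) (by omega) (by omega)
    · simp only [map_mul, map_inv, FreeGroup.lift_apply_of, mul_inv_eq_one, one_mul]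
      exact swap_far (by omega) (by omega) (by omega) (by omega))

@[simp] theorem perm_z : perm z = 1 := lift_z _ _

@[simp] theorem perm_t (i : ℕ) : perm (t i) = Equiv.swap i (i + 1) := lift_t _ _ i

/-- The sign of the underlying permutation. -/
def sgn : SpinCover →* ℤˣ :=
  lift (fun | .z => 1 | .t _ => -1) (by
    rintro _ (i | _ | i | i | ⟨i, j, h⟩) <;> simp [pow_two])

@[simp] theorem sgn_z : sgn z = 1 := lift_z _ _

@[simp] theorem sgn_t (i : ℕ) : sgn (t i) = -1 := lift_t _ _ i

/-! ### The central element is not trivial -/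

/-- Half of the negative sum of squares. -/
noncomputable def cliffordForm : QuadraticForm ℚ (ℕ →₀ ℚ) :=
  LinearMap.BilinMap.toQuadraticMap
    (Finsupp.lsum ℚ fun i => (LinearMap.toSpanSingleton ℚ _ ((-1 / 2 : ℚ) • Finsupp.lapply i)))

theorem cliffordForm_polar (v w : ℕ →₀ ℚ) :
    QuadraticMap.polar cliffordForm v w = - v.sum fun i a => a * w i := by
  have key : ∀ v w : ℕ →₀ ℚ, (Finsupp.lsum ℚ fun i => (LinearMap.toSpanSingleton ℚ
      ((ℕ →₀ ℚ) →ₗ[ℚ] ℚ) ((-1 / 2 : ℚ) • Finsupp.lapply i))) v w =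
      (-1 / 2 : ℚ) * v.sum fun i a => a * w i := by
    intro v w
    simp [Finsupp.sum, Finset.mul_sum, LinearMap.sum_apply, mul_left_comm]
  have symm : ∀ v w : ℕ →₀ ℚ, (v.sum fun i a => a * w i) = w.sum fun i a => a * v i := by
    intro v w
    rw [Finsupp.sum_of_support_subset v (Finset.subset_union_left (s₂ := w.support)) _ (by simp),
      Finsupp.sum_of_support_subset w (Finset.subset_union_right (s₁ := v.support)) _ (by simp)]
    simp [mul_comm]
  rw [cliffordForm, LinearMap.BilinMap.polar_toQuadraticMap, key, key, symm w v]
  ring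

theorem cliffordForm_apply (v : ℕ →₀ ℚ) :
    cliffordForm v = (-1 / 2 : ℚ) * v.sum fun i a => a * v i := by
  have h := cliffordForm_polar v v
  rw [QuadraticMap.polar_self] at h
  rw [two_nsmul] at h
  linarith

/-- The difference of adjacent basis vectors. -/
noncomputable def root (i : ℕ) : ℕ →₀ ℚ := Finsupp.single i 1 - Finsupp.single (i + 1) 1

theorem root_sum (i : ℕ) (w : ℕ →₀ ℚ) : ((root i).sum fun j a => a * w j) = w i - w (i + 1) := by
  rw [root, Finsupp.sum_sub_index (by intros; ring)]
  simp

theorem cliffordForm_root (i : ℕ) : cliffordForm (root i) = -1 := by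
  rw [cliffordForm_apply, root_sum]
  simp [root]
  norm_num

theorem clifford_root_mul_self (i : ℕ) :
    CliffordAlgebra.ι cliffordForm (root i) * CliffordAlgebra.ι cliffordForm (root i) = -1 := by
  rw [CliffordAlgebra.ι_sq_scalar, cliffordForm_root, map_neg, map_one]

theorem clifford_root_adjacent (i : ℕ) :
    CliffordAlgebra.ι cliffordForm (root i) * CliffordAlgebra.ι cliffordForm (root (i + 1)) +
    CliffordAlgebra.ι cliffordForm (root (i + 1)) * CliffordAlgebra.ι cliffordForm (root i) = 1 := by
  rw [CliffordAlgebra.ι_mul_ι_add_swap, cliffordForm_polar, root_sum]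
  have h1 : i + 1 + 1 ≠ i := by omega
  simp [root, h1]

theorem clifford_root_far {i j : ℕ} (h : i + 1 < j) :
    CliffordAlgebra.ι cliffordForm (root i) * CliffordAlgebra.ι cliffordForm (root j) +
    CliffordAlgebra.ι cliffordForm (root j) * CliffordAlgebra.ι cliffordForm (root i) = 0 := by
  rw [CliffordAlgebra.ι_mul_ι_add_swap, cliffordForm_polar, root_sum]
  have h1 : j ≠ i := by omega
  have h2 : j ≠ i + 1 := by omega
  have h3 : j + 1 ≠ i := by omega
  simp [root, h1, h2, h3]

/-- The basic spin representation. -/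
noncomputable def cliffordUnit : SpinGen → (CliffordAlgebra cliffordForm)ˣ
  | .z => -1
  | .t i => ⟨CliffordAlgebra.ι cliffordForm (root i), -CliffordAlgebra.ι cliffordForm (root i),
      by rw [mul_neg, clifford_root_mul_self, neg_neg],
      by rw [neg_mul, clifford_root_mul_self, neg_neg]⟩

/-- The vectors `root i`, normalised to square to `-1`, satisfy the defining relations in the
Clifford algebra with `z` acting as `-1`, and `-1 ≠ 1` there because the scalars embed. Without this
fact the trace below would not exist. -/
theorem z_ne_one : z ≠ 1 := by
  -- Both sides equal `a + b`.
  have braid : ∀ {R : Type} [Ring R] (a b : R), a * a = -1 → b * b = -1 → a * b + b * a = 1 →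
      a * b * a = b * a * b := by
    intro R _ a b ha hb hab
    have h1 : a * b = 1 - b * a := eq_sub_of_add_eq hab
    have h2 : b * a = 1 - a * b := eq_sub_of_add_eq' hab
    calc a * b * a = a - b * (a * a) := by rw [h1]; noncomm_ring
      _ = b - a * (b * b) := by rw [ha, hb]; noncomm_ring
      _ = b * a * b := by rw [h2]; noncomm_ring
  have hrel : ∀ r, SpinRelator r → FreeGroup.lift cliffordUnit r = 1 := by
    rintro _ (i | _ | i | i | ⟨i, j, h⟩)
    · simp only [map_mul, map_inv, FreeGroup.lift_apply_of, mul_inv_eq_one]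
      simp [cliffordUnit]
    · simp [cliffordUnit]
    · simp only [map_mul, map_inv, FreeGroup.lift_apply_of, mul_inv_eq_one, pow_two]
      ext
      exact clifford_root_mul_self i
    · simp only [map_mul, map_inv, FreeGroup.lift_apply_of, mul_inv_eq_one]
      ext
      exact braid _ _ (clifford_root_mul_self i) (clifford_root_mul_self (i + 1))
        (clifford_root_adjacent i)
    · simp only [map_mul, map_inv, FreeGroup.lift_apply_of, mul_inv_eq_one]
      ext
      simp only [cliffordUnit, Units.val_mul, Units.val_neg, neg_mul, one_mul]
      exact eq_neg_of_add_eq_zero_right (clifford_root_far h)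
  intro h
  have h1 := congrArg (lift cliffordUnit hrel) h
  rw [lift_z, map_one] at h1
  have h2 : (-1 : CliffordAlgebra cliffordForm) = 1 := congrArg Units.val h1
  have h3 : algebraMap ℚ (CliffordAlgebra cliffordForm) (-1) =
      algebraMap ℚ (CliffordAlgebra cliffordForm) 1 := by simpa using h2
  have h4 := (algebraMap ℚ (CliffordAlgebra cliffordForm)).injective h3
  norm_num at h4

end SpinCover

/-! ### Finite double covers and lifts of transpositions -/

namespace SpinCover

theorem z_mem_sub (n : ℕ) : z ∈ sub n := Subgroup.subset_closure (Or.inl rfl)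

theorem t_mem_sub {n i : ℕ} (h : i + 1 < n) : t i ∈ sub n :=
  Subgroup.subset_closure (Or.inr ⟨i, h, rfl⟩)

theorem sub_mono {m n : ℕ} (h : m ≤ n) : sub m ≤ sub n := by
  apply Subgroup.closure_mono
  rintro g (hg | ⟨i, hi, rfl⟩)
  · exact Or.inl hg
  · exact Or.inr ⟨i, by omega, rfl⟩

theorem nest_mem_sub {n : ℕ} (d : ℕ) : ∀ i, i + d + 1 < n → nest i d ∈ sub n := by
  induction d with
  | zero => intro i h; exact t_mem_sub h
  | succ d ih =>
    intro i h
    exact mul_mem (mul_mem (t_mem_sub (by omega)) (ih _ (by omega))) (t_mem_sub (by omega))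

/-- The lift of the transposition `(i, j)`, antisymmetric up to `z` in `i` and `j`. -/
def transp (i j : ℕ) : SpinCover := if i < j then nest i (j - 1 - i) else z * nest j (i - 1 - j)

theorem transp_mem_sub {n i j : ℕ} (hi : i < n) (hj : j < n) (hij : i ≠ j) :
    transp i j ∈ sub n := by
  unfold transp
  split_ifs with h
  · exact nest_mem_sub _ _ (by omega)
  · exact mul_mem (z_mem_sub n) (nest_mem_sub _ _ (by omega))

theorem transp_self_succ (i : ℕ) : transp i (i + 1) = t i := by
  simp [transp, nest]

theorem x_eq_transp {n i : ℕ} (h : i < n) : x n i = transp i n := by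
  simp [transp, h, x]

theorem perm_nest (d : ℕ) : ∀ i, perm (nest i d) = Equiv.swap i (i + d + 1) := by
  induction d with
  | zero => intro i; simp [nest]
  | succ d ih =>
    intro i
    rw [nest, map_mul, map_mul, ih, perm_t]
    ext y
    simp only [Equiv.Perm.mul_apply, Equiv.swap_apply_def]
    grind

theorem perm_transp {i j : ℕ} (hij : i ≠ j) : perm (transp i j) = Equiv.swap i j := by
  unfold transp
  split_ifs with h
  · rw [perm_nest, show i + (j - 1 - i) + 1 = j by omega]
  · rw [map_mul, perm_nest, perm_z, one_mul, show j + (i - 1 - j) + 1 = i by omega,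
      Equiv.swap_comm]

theorem sgn_nest (d : ℕ) : ∀ i, sgn (nest i d) = -1 := by
  induction d with
  | zero => intro i; simp [nest]
  | succ d ih => intro i; rw [nest, map_mul, map_mul, ih, sgn_t]; simp

theorem sgn_transp (i j : ℕ) : sgn (transp i j) = -1 := by
  unfold transp
  split_ifs with h <;> simp [sgn_nest]

theorem perm_apply_of_mem_sub {n : ℕ} {g : SpinCover} (hg : g ∈ sub n) :
    ∀ {i : ℕ}, n ≤ i → perm g i = i := by
  induction hg using Subgroup.closure_induction with
  | mem x hx =>
    intro i hi
    rcases hx with rfl | ⟨k, hk, rfl⟩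
    · simp
    · rw [perm_t]; exact Equiv.swap_apply_of_ne_of_ne (by omega) (by omega)
  | one => simp
  | mul a b _ _ ha hb => intro i hi; rw [map_mul, Equiv.Perm.mul_apply, hb hi, ha hi]
  | inv a _ ha => intro i hi; rw [map_inv, Equiv.Perm.inv_eq_iff_eq, ha hi]

theorem perm_lt_of_mem_sub {n : ℕ} {g : SpinCover} (hg : g ∈ sub n) {i : ℕ} (hi : i < n) :
    perm g i < n := by
  by_contra! h
  have h1 := perm_apply_of_mem_sub hg h
  have h2 := (perm g).injective h1
  omega

end SpinCover

/-! ### The spin algebra and the conjugation of lifted transpositions -/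

/-- The integral spin group algebra, as a type with a fixed ring structure. -/
def SpinRing : Type := SpinAlgebra

noncomputable instance : Ring SpinRing := inferInstanceAs (Ring SpinAlgebra)

namespace SpinRing
open SpinCover

/-- The image of a group element. -/
noncomputable def of : SpinCover →* SpinRing where
  toFun := SpinAlgebra.ofCover
  map_one' := by
    rw [SpinAlgebra.ofCover, map_one, map_one]; rfl
  map_mul' g h := by
    rw [SpinAlgebra.ofCover, map_mul, map_mul]; rfl

theorem of_z : of z = -1 := by
  refine (RingQuot.mkRingHom_rel SpinAlgebraRel.z_eq).trans ?_
  rw [map_neg, map_one]; rfl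

theorem of_z_mul (g : SpinCover) : of (z * g) = -of g := by
  rw [map_mul, of_z, neg_one_mul]

theorem of_mul_inv (g : SpinCover) : of g * of g⁻¹ = 1 := by
  rw [← map_mul, mul_inv_cancel, map_one]

theorem of_inv_mul (g : SpinCover) : of g⁻¹ * of g = 1 := by
  rw [← map_mul, inv_mul_cancel, map_one]

/-- The image of the generator `t i`. -/
noncomputable def gen (i : ℕ) : SpinRing := of (t i)

theorem gen_mul_gen (i : ℕ) : gen i * gen i = -1 := by
  rw [gen, ← map_mul, t_mul_t, of_z]

theorem gen_mul_cancel (i : ℕ) (y : SpinRing) : gen i * (gen i * y) = -y := by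
  rw [← mul_assoc, gen_mul_gen, neg_one_mul]

theorem gen_braid (i : ℕ) : gen i * gen (i + 1) * gen i = gen (i + 1) * gen i * gen (i + 1) := by
  simp only [gen, ← map_mul, t_braid]

theorem gen_far {i j : ℕ} (h : i + 1 < j) : gen j * gen i = -(gen i * gen j) := by
  simp only [gen, ← map_mul, t_far h]
  rw [mul_assoc, of_z_mul]

/-- The image of the lift of the transposition `(i, j)`. -/
noncomputable def tau (i j : ℕ) : SpinRing := of (transp i j)

theorem tau_swap {i j : ℕ} (h : i ≠ j) : tau j i = -tau i j := by
  unfold tau transp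
  rcases lt_or_gt_of_ne h with h | h
  · rw [if_neg (by omega), if_pos h, of_z_mul]
  · rw [if_pos h, if_neg (by omega), of_z_mul, neg_neg]

theorem tau_self_succ (i : ℕ) : tau i (i + 1) = gen i := by
  rw [tau, transp_self_succ, gen]

theorem tau_left_step {i j : ℕ} (h : i + 1 < j) : tau i j = gen i * tau (i + 1) j * gen i := by
  unfold tau transp
  rw [if_pos (by omega), if_pos h, show j - 1 - i = (j - 1 - (i + 1)) + 1 by omega, nest,
    map_mul, map_mul, gen]

theorem tau_step_induction {p : ℕ → ℕ → Prop} (base : ∀ i, p i (i + 1))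
    (step : ∀ i j, i + 1 < j → p (i + 1) j → p i j) {i j : ℕ} (h : i < j) : p i j := by
  obtain ⟨d, rfl⟩ : ∃ d, j = i + 1 + d := ⟨j - i - 1, by omega⟩
  clear h
  induction d generalizing i with
  | zero => exact base i
  | succ d ih =>
    apply step i _ (by omega)
    have := ih (i := i + 1)
    rwa [show i + 1 + 1 + d = i + 1 + (d + 1) by omega] at this

/-- `tau i j` is a word of odd length in generators, each of which anticommutes with `gen k`. -/
theorem gen_tau_far {k i j : ℕ} (hij : i < j) (h : k + 1 < i ∨ j < k) :
    gen k * tau i j = -(tau i j * gen k) := by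
  revert h
  refine tau_step_induction (p := fun i j => (k + 1 < i ∨ j < k) →
    gen k * tau i j = -(tau i j * gen k)) ?_ ?_ hij
  · intro i h
    rw [tau_self_succ]
    rcases h with h | h
    · rw [gen_far h, neg_neg]
    · exact gen_far h
  · intro i j hij ih h
    have h1 : gen k * gen i = -(gen i * gen k) := by
      rcases h with h | h
      · rw [gen_far h, neg_neg]
      · exact gen_far (by omega)
    have h2 := ih (by omega)
    rw [tau_left_step hij]
    calc gen k * (gen i * tau (i + 1) j * gen i) = (gen k * gen i) * tau (i + 1) j * gen i := by
          noncomm_ring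
      _ = -(gen i * (gen k * tau (i + 1) j) * gen i) := by rw [h1]; noncomm_ring
      _ = gen i * tau (i + 1) j * (gen k * gen i) := by rw [h2]; noncomm_ring
      _ = _ := by rw [h1]; noncomm_ring

/-- The palindromic word can be built from either end. Adjacent letters are the braid relation;
afterwards the outer `gen i` passes `gen j` on both sides and the two signs cancel. -/
theorem tau_right_step {i j : ℕ} (h : i < j) : tau i (j + 1) = gen j * tau i j * gen j := by
  refine tau_step_induction (p := fun i j => tau i (j + 1) = gen j * tau i j * gen j) ?_ ?_ h
  · intro i
    rw [tau_left_step (by omega), tau_self_succ, tau_self_succ, gen_braid]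
  · intro i j hij ih
    have h1 : gen j * gen i = -(gen i * gen j) := gen_far hij
    rw [tau_left_step (by omega), ih, tau_left_step hij]
    calc gen i * (gen j * tau (i + 1) j * gen j) * gen i
        = (gen i * gen j) * tau (i + 1) j * (gen j * gen i) := by noncomm_ring
      _ = (gen j * gen i) * tau (i + 1) j * (gen i * gen j) := by rw [h1]; noncomm_ring
      _ = _ := by noncomm_ring

/-- The one case where `gen k` occurs inside the word. For `k = i + 1` the braid relation turns `gen
k` into `gen i`, which anticommutes with the core of the word, and a second braid relation turns it
back. Larger `k` are reduced to this by passing the outer `gen i` twice. -/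
theorem gen_tau_inner {k i j : ℕ} (h1 : i < k) (h2 : k + 1 < j) :
    gen k * tau i j = -(tau i j * gen k) := by
  obtain ⟨d, rfl⟩ : ∃ d, k = i + 1 + d := ⟨k - i - 1, by omega⟩
  clear h1
  induction d generalizing i with
  | zero =>
    have h3 := gen_tau_far (k := i) (i := i + 2) (j := j) (by omega) (by omega)
    have h4 := gen_braid i
    rw [tau_left_step (i := i) (by omega), tau_left_step (i := i + 1) (by omega)]
    simp only [add_zero, add_assoc, Nat.reduceAdd] at *
    generalize tau (i + 2) j = y at *
    generalize gen (i + 1) = b at *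
    generalize gen i = a at *
    calc b * (a * (b * y * b) * a) = (b * a * b) * y * b * a := by noncomm_ring
      _ = a * b * (a * y) * b * a := by rw [← h4]; noncomm_ring
      _ = -(a * b * y * (a * b * a)) := by rw [h3]; noncomm_ring
      _ = _ := by rw [h4]; noncomm_ring
  | succ d ih =>
    have h3 := ih (i := i + 1) (by omega)
    have h4 : gen (i + 1 + (d + 1)) * gen i = -(gen i * gen (i + 1 + (d + 1))) :=
      gen_far (by omega)
    rw [tau_left_step (i := i) (by omega)]
    rw [show i + 1 + 1 + d = i + 1 + (d + 1) by omega] at h3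
    generalize gen (i + 1 + (d + 1)) = b at *
    generalize gen i = a at *
    generalize tau (i + 1) j = y at *
    calc b * (a * y * a) = (b * a) * y * a := by noncomm_ring
      _ = -(a * (b * y) * a) := by rw [h4]; noncomm_ring
      _ = a * y * (b * a) := by rw [h3]; noncomm_ring
      _ = _ := by rw [h4]; noncomm_ring

theorem gen_tau_of_lt (k : ℕ) {i j : ℕ} (hij : i < j) :
    gen k * tau i j = -(tau (Equiv.swap k (k + 1) i) (Equiv.swap k (k + 1) j) * gen k) := by
  rcases lt_trichotomy (k + 1) i with h | h | h
  · rw [Equiv.swap_apply_of_ne_of_ne (by omega) (by omega),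
      Equiv.swap_apply_of_ne_of_ne (by omega) (by omega), gen_tau_far hij (.inl h)]
  · subst h
    rw [Equiv.swap_apply_right, Equiv.swap_apply_of_ne_of_ne (by omega) (by omega),
      tau_left_step (i := k) (by omega), mul_assoc, gen_mul_gen]
    noncomm_ring
  rcases lt_trichotomy k i with h' | rfl | h'
  · omega
  · rw [Equiv.swap_apply_left]
    rcases lt_or_eq_of_le (show k + 1 ≤ j from hij) with h'' | rfl
    · rw [Equiv.swap_apply_of_ne_of_ne (by omega) (by omega), tau_left_step h'', mul_assoc,
        gen_mul_cancel]
    · rw [Equiv.swap_apply_right, tau_swap (Nat.succ_ne_self k).symm, tau_self_succ]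
      noncomm_ring
  rw [Equiv.swap_apply_of_ne_of_ne (by omega : i ≠ k) (by omega : i ≠ k + 1)]
  rcases lt_trichotomy (k + 1) j with h'' | rfl | h''
  · rw [Equiv.swap_apply_of_ne_of_ne (by omega) (by omega), gen_tau_inner h' h'']
  · rw [Equiv.swap_apply_right, tau_right_step h', mul_assoc, gen_mul_cancel]
  rcases lt_or_eq_of_le (show j ≤ k by omega) with h3 | rfl
  · rw [Equiv.swap_apply_of_ne_of_ne (by omega) (by omega), gen_tau_far hij (.inr h3)]
  · rw [Equiv.swap_apply_left, tau_right_step hij, mul_assoc, gen_mul_gen]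
    noncomm_ring

theorem gen_tau (k : ℕ) {i j : ℕ} (hij : i ≠ j) :
    gen k * tau i j = -(tau (Equiv.swap k (k + 1) i) (Equiv.swap k (k + 1) j) * gen k) := by
  rcases lt_or_gt_of_ne hij with h | h
  · exact gen_tau_of_lt k h
  · rw [tau_swap hij.symm, tau_swap ((Equiv.swap k (k + 1)).injective.ne hij.symm), mul_neg,
      gen_tau_of_lt k h, neg_mul]

/-- Conjugation of the lift of a transposition. -/
theorem of_mul_tau (g : SpinCover) : ∀ {i j : ℕ}, i ≠ j →
    of g * tau i j = (sgn g : ℤ) • (tau (perm g i) (perm g j) * of g) := by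
  induction g using generators_induction with
  | one => intro i j _; simp [map_one]
  | hz => intro i j _; simp [of_z]
  | ht k =>
    intro i j hij
    rw [← gen, gen_tau k hij, perm_t, sgn_t]
    simp
  | mul a b ha hb =>
    intro i j hij
    rw [map_mul, mul_assoc, hb hij, mul_smul_comm, ← mul_assoc,
      ha ((perm b).injective.ne hij), smul_mul_assoc, smul_smul, mul_assoc, map_mul, map_mul,
      Units.val_mul, mul_comm (sgn b : ℤ)]
    rfl
  | inv a ha =>
    intro i j hij
    have h := ha (i := perm a⁻¹ i) (j := perm a⁻¹ j) ((perm a⁻¹).injective.ne hij)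
    simp only [map_inv, Equiv.Perm.inv_def, Equiv.apply_symm_apply] at h
    have h2 := congrArg (fun y => of a⁻¹ * y * of a⁻¹) h
    simp only [mul_smul_comm, smul_mul_assoc] at h2
    rw [← mul_assoc, of_inv_mul, one_mul] at h2
    rw [map_inv sgn, map_inv perm, Equiv.Perm.inv_def, h2, smul_smul]
    simp only [mul_assoc, of_mul_inv, mul_one]
    simp [← Units.val_mul]

theorem tau_mul_tau_apply {a b i j : ℕ} (hab : a ≠ b) (hij : i ≠ j) :
    tau a b * tau i j = -(tau (Equiv.swap a b i) (Equiv.swap a b j) * tau a b) := by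
  have h := of_mul_tau (transp a b) hij
  rw [perm_transp hab, sgn_transp] at h
  simpa [tau] using h

theorem tau_mul_self {a b : ℕ} (hab : a ≠ b) : tau a b * tau a b = -1 := by
  have key : ∀ {i j : ℕ}, i < j → tau i j * tau i j = -1 := by
    intro i j h
    refine tau_step_induction (p := fun i j => tau i j * tau i j = -1) ?_ ?_ h
    · intro i; rw [tau_self_succ, gen_mul_gen]
    · intro i j hij ih
      rw [tau_left_step hij]
      calc gen i * tau (i + 1) j * gen i * (gen i * tau (i + 1) j * gen i)
          = gen i * tau (i + 1) j * (gen i * gen i) * tau (i + 1) j * gen i := by noncomm_ring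
        _ = -(gen i * (tau (i + 1) j * tau (i + 1) j) * gen i) := by
            rw [gen_mul_gen]; noncomm_ring
        _ = -1 := by rw [ih, mul_neg, mul_one, neg_mul, gen_mul_gen, neg_neg]
  rcases lt_or_gt_of_ne hab with h | h
  · exact key h
  · rw [tau_swap hab.symm, neg_mul_neg, key h]

theorem tau_mul_tau {a b c : ℕ} (hab : a ≠ b) (hac : a ≠ c) (hbc : b ≠ c) :
    tau a b * tau a c = -(tau b c * tau a b) := by
  rw [tau_mul_tau_apply hab hac, Equiv.swap_apply_left, Equiv.swap_apply_of_ne_of_ne hac.symm hbc.symm]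

theorem tau_anticomm {a b c d : ℕ} (hab : a ≠ b) (hcd : c ≠ d) (hac : a ≠ c) (had : a ≠ d)
    (hbc : b ≠ c) (hbd : b ≠ d) : tau a b * tau c d = -(tau c d * tau a b) := by
  rw [tau_mul_tau_apply hab hcd, Equiv.swap_apply_of_ne_of_ne hac.symm hbc.symm,
    Equiv.swap_apply_of_ne_of_ne had.symm hbd.symm]

end SpinRing

namespace SpinRing
open SpinCover

/-! ### The trace -/

/-- The integral functions on the group that change sign under multiplication by `z`. -/
def oddFunctions : Submodule ℤ (SpinCover → ℤ) where
  carrier := {f | ∀ g, f (z * g) = -f g}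
  zero_mem' := by simp
  add_mem' := by
    intro f f' hf hf' g
    simp only [Pi.add_apply, hf g, hf' g]; ring
  smul_mem' := by
    intro c f hf g
    simp only [Pi.smul_apply, hf g, smul_neg]

/-- Left translation of odd functions. -/
def translate : SpinCover →* Module.End ℤ oddFunctions where
  toFun g :=
    { toFun := fun f => ⟨fun h => f.1 (g⁻¹ * h), fun h => by
        have h1 := f.2 (g⁻¹ * h)
        rwa [← mul_assoc, z_mul_comm, mul_assoc] at h1⟩
      map_add' := fun _ _ => rfl
      map_smul' := fun _ _ => rfl }
  map_one' := by ext; simp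
  map_mul' g h := by ext; simp [mul_assoc]

open Classical in
/-- The value at `g` of the trace. -/
noncomputable def delta (g : SpinCover) : ℤ := if g = 1 then 1 else if g = z then -1 else 0

theorem delta_one : delta 1 = 1 := by simp [delta]

theorem delta_z_mul (g : SpinCover) : delta (z * g) = -delta g := by
  have h1 : z * g = 1 ↔ g = z := by
    rw [← inv_eq_iff_mul_eq_one, z_inv, eq_comm]
  have h2 : z * g = z ↔ g = 1 := by simp
  unfold delta
  rw [h1, h2]
  by_cases h : g = z
  · subst h; simp [z_ne_one]
  · by_cases h' : g = 1 <;> simp [h, h', z_ne_one.symm]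

theorem delta_inv (g : SpinCover) : delta g⁻¹ = delta g := by
  have h : g⁻¹ = z ↔ g = z := by rw [inv_eq_iff_eq_inv, z_inv]
  unfold delta
  rw [inv_eq_one, h]

theorem delta_mul_comm (g h : SpinCover) : delta (g * h) = delta (h * g) := by
  have h1 : g * h = 1 ↔ h * g = 1 := mul_eq_one_comm
  have h2 : g * h = z ↔ h * g = z := by
    rw [← eq_mul_inv_iff_mul_eq, ← eq_inv_mul_iff_mul_eq, z_mul_comm]
  unfold delta
  rw [h1, h2]

/-- `delta` as an odd function. -/
noncomputable def oddDelta : oddFunctions := ⟨delta, delta_z_mul⟩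

/-- The action of the spin group algebra on odd functions. -/
noncomputable def action : SpinRing →+* Module.End ℤ oddFunctions :=
  show SpinAlgebra →+* Module.End ℤ oddFunctions from
  RingQuot.lift ⟨(MonoidAlgebra.lift ℤ (Module.End ℤ oddFunctions) SpinCover translate).toRingHom, by
    rintro _ _ ⟨⟩
    ext f g
    have := f.2 g
    simpa [translate, z_inv] using this⟩

theorem action_of (g : SpinCover) : action (of g) = translate g := by
  refine (RingQuot.lift_mkRingHom_apply _ _ _).trans ?_
  simp

/-- The linear form that sends a group element `g` to `1` if `g = 1`, to `-1` if `g = z`, and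
to `0` otherwise. -/
noncomputable def trace : SpinRing →+ ℤ where
  toFun a := (action a oddDelta).1 1
  map_zero' := by simp
  map_add' a b := by simp

/-- On odd functions `z` acts as `-1`, so the quotient algebra acts. The translate of `delta` by `g`
takes the value `delta g⁻¹` at `1`. -/
theorem trace_of (g : SpinCover) : trace (of g) = delta g := by
  change (action (of g) oddDelta).1 1 = _
  rw [action_of, ← delta_inv]
  simp [translate, oddDelta]

theorem span_of : Submodule.span ℤ (Set.range of) = ⊤ := by
  rw [eq_top_iff]
  rintro a -
  obtain ⟨b, rfl⟩ : ∃ b, (RingQuot.mkRingHom SpinAlgebraRel b : SpinRing) = a :=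
    RingQuot.mkRingHom_surjective _ a
  induction b using MonoidAlgebra.induction_on with
  | of g => exact Submodule.subset_span ⟨g, rfl⟩
  | add f g hf hg =>
    rw [map_add]
    exact Submodule.add_mem _ hf hg
  | smul r f hf =>
    have : RingQuot.mkRingHom SpinAlgebraRel (r • f) =
      r • RingQuot.mkRingHom SpinAlgebraRel f := map_zsmul _ _ _
    rw [this]
    exact Submodule.smul_mem _ r hf

theorem of_induction {p : SpinRing → Prop} (a : SpinRing) (hof : ∀ g, p (of g)) (zero : p 0)
    (add : ∀ a b, p a → p b → p (a + b)) (smul : ∀ (n : ℤ) a, p a → p (n • a)) : p a := by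
  have ha : a ∈ Submodule.span ℤ (Set.range of) := by rw [span_of]; trivial
  induction ha using Submodule.span_induction with
  | mem x hx => obtain ⟨g, rfl⟩ := hx; exact hof g
  | zero => exact zero
  | add a b _ _ ha hb => exact add a b ha hb
  | smul n a _ ha => exact smul n a ha

theorem trace_mul_comm (a b : SpinRing) : trace (a * b) = trace (b * a) := by
  induction a using of_induction with
  | hof g =>
    induction b using of_induction with
    | hof h => rw [← map_mul, ← map_mul, trace_of, trace_of, delta_mul_comm]
    | zero => simp
    | add a b ha hb => rw [mul_add, add_mul, map_add, map_add, ha, hb]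
    | smul n a ha => rw [mul_smul_comm, smul_mul_assoc, map_zsmul, map_zsmul, ha]
  | zero => simp
  | add a b ha hb => rw [mul_add, add_mul, map_add, map_add, ha, hb]
  | smul n a ha => rw [mul_smul_comm, smul_mul_assoc, map_zsmul, map_zsmul, ha]

/-- The trace recognises the identity. This lets identities in the group be checked in the ring,
where `z` is just a sign. -/
theorem of_injective : Function.Injective of := by
  intro g h hgh
  have h1 : delta (g⁻¹ * h) = 1 := by
    rw [← trace_of, map_mul, ← hgh, of_inv_mul, ← map_one of, trace_of, delta_one]
  have h2 : g⁻¹ * h = 1 := by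
    by_contra h3
    rw [delta, if_neg h3] at h1
    split_ifs at h1
    all_goals omega
  rw [inv_mul_eq_one] at h2
  exact h2

/-- The quotient modulo the central element. -/
def zSetoid : Setoid SpinCover where
  r g h := h = g ∨ h = z * g
  iseqv := by
    refine ⟨fun g => Or.inl rfl, ?_, ?_⟩
    · rintro g h (rfl | rfl)
      · exact Or.inl rfl
      · right; rw [← mul_assoc, z_mul_z, one_mul]
    · rintro g h k (rfl | rfl) (rfl | rfl)
      · exact Or.inl rfl
      · exact Or.inr rfl
      · exact Or.inr rfl
      · left; rw [← mul_assoc, z_mul_z, one_mul]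

/-- A choice of one of `g` and `z * g`. -/
noncomputable def choice (g : SpinCover) : SpinCover := (Quotient.mk zSetoid g).out

theorem choice_eq (g : SpinCover) : choice g = g ∨ choice g = z * g :=
  zSetoid.symm (Quotient.mk_out (s := zSetoid) g)

theorem choice_z_mul (g : SpinCover) : choice (z * g) = choice g := by
  unfold choice
  congr 1
  refine Quotient.sound (s := zSetoid) ?_
  exact zSetoid.symm (Or.inr rfl)

/-- Elements are determined by the traces of their translates. -/
theorem eq_zero_of_trace {a : SpinRing} (h : ∀ g, trace (of g⁻¹ * a) = 0) : a = 0 := by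
  -- Every element is a combination of the chosen members of the pairs `{g, z * g}`. Distinct chosen
  -- members have trace pairing `0`, so each coefficient is a trace.
  have key : ∀ a : SpinRing, ∃ c : SpinCover →₀ ℤ, (∀ g ∈ c.support, choice g = g) ∧
      a = c.sum fun g n => n • of g := by
    intro a
    induction a using of_induction with
    | hof g =>
      rcases choice_eq g with h | h
      · refine ⟨Finsupp.single g 1, fun g' hg' => ?_, by simp⟩
        rw [Finset.mem_singleton.1 (Finsupp.support_single_subset hg'), h]
      · refine ⟨Finsupp.single (z * g) (-1), fun g' hg' => ?_, ?_⟩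
        swap
        · rw [Finsupp.sum_single_index (by exact zero_smul _ _), of_z_mul, neg_smul_neg, one_smul]
        rw [Finset.mem_singleton.1 (Finsupp.support_single_subset hg'), choice_z_mul, h]
    | zero => exact ⟨0, by simp⟩
    | add a b ha hb =>
      obtain ⟨c, hc, rfl⟩ := ha
      obtain ⟨d, hd, rfl⟩ := hb
      classical
      refine ⟨c + d, fun g hg => ?_, ?_⟩
      · rcases Finset.mem_union.1 (Finsupp.support_add hg) with h | h
        · exact hc g h
        · exact hd g h
      · rw [Finsupp.sum_add_index' (by simp) (by intros; rw [add_smul])]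
    | smul n a ha =>
      obtain ⟨c, hc, rfl⟩ := ha
      refine ⟨n • c, fun g hg => hc g (Finsupp.support_smul hg), ?_⟩
      rw [Finsupp.sum_smul_index (by simp), Finsupp.smul_sum]
      simp [mul_smul]
  obtain ⟨c, hc, rfl⟩ := key a
  have hzero : c = 0 := by
    ext g
    by_contra hg
    rw [Finsupp.zero_apply] at hg
    have h1 := h g
    rw [Finsupp.sum, Finset.mul_sum, map_sum, Finset.sum_eq_single g] at h1
    · rw [mul_smul_comm, of_inv_mul, map_zsmul, ← map_one of, trace_of, delta_one] at h1
      simp at h1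
      exact hg h1
    · intro k hk hkg
      rw [mul_smul_comm, map_zsmul, ← map_mul, trace_of, delta, if_neg, if_neg, smul_zero]
      · intro h2
        have h3 : k = z * g := by rw [z_mul_comm, ← h2, mul_inv_cancel_left]
        apply hkg
        rw [← hc k hk, h3, choice_z_mul, hc g (by simpa using hg)]
      · intro h2
        exact hkg (inv_mul_eq_one.1 h2).symm
    · intro h2
      simp at h2
      exact absurd h2 hg
  rw [hzero, Finsupp.sum_zero_index]

/-! ### Elements that lift a permutation -/

/-- `a` is up to sign the image of a group element over the permutation `σ`. -/
def Lifts (a : SpinRing) (σ : Equiv.Perm ℕ) : Prop := ∃ g, perm g = σ ∧ (a = of g ∨ a = -of g)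

theorem Lifts.mul {a b : SpinRing} {σ τ : Equiv.Perm ℕ} (ha : Lifts a σ) (hb : Lifts b τ) :
    Lifts (a * b) (σ * τ) := by
  obtain ⟨g, rfl, hg⟩ := ha
  obtain ⟨h, rfl, hh⟩ := hb
  refine ⟨g * h, map_mul _ _ _, ?_⟩
  rcases hg with rfl | rfl <;> rcases hh with rfl | rfl <;> simp

theorem Lifts.neg {a : SpinRing} {σ : Equiv.Perm ℕ} (ha : Lifts a σ) : Lifts (-a) σ := by
  obtain ⟨g, rfl, rfl | rfl⟩ := ha
  · exact ⟨g, rfl, Or.inr rfl⟩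
  · exact ⟨g, rfl, Or.inl (neg_neg _)⟩

theorem lifts_one : Lifts 1 1 := ⟨1, map_one _, Or.inl (map_one _).symm⟩

theorem lifts_tau {i j : ℕ} (h : i ≠ j) : Lifts (tau i j) (Equiv.swap i j) :=
  ⟨transp i j, perm_transp h, Or.inl rfl⟩

/-- The span of the group elements on `n` letters. -/
noncomputable def subSpan (n : ℕ) : Submodule ℤ SpinRing := Submodule.span ℤ (of '' (sub n : Set SpinCover))

theorem of_mem_subSpan {n : ℕ} {g : SpinCover} (hg : g ∈ sub n) : of g ∈ subSpan n :=
  Submodule.subset_span ⟨g, hg, rfl⟩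

theorem mul_mem_subSpan {n : ℕ} {a b : SpinRing} (ha : a ∈ subSpan n) (hb : b ∈ subSpan n) :
    a * b ∈ subSpan n := by
  induction ha using Submodule.span_induction with
  | mem x hx =>
    obtain ⟨g, hg, rfl⟩ := hx
    induction hb using Submodule.span_induction with
    | mem x hx =>
      obtain ⟨h, hh, rfl⟩ := hx
      rw [← map_mul]
      exact of_mem_subSpan (mul_mem hg hh)
    | zero => rw [mul_zero]; exact zero_mem _
    | add a b _ _ ha hb => rw [mul_add]; exact add_mem ha hb
    | smul n a _ ha => rw [mul_smul_comm]; exact Submodule.smul_mem _ _ ha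
  | zero => rw [zero_mul]; exact zero_mem _
  | add a b _ _ ha hb => rw [add_mul]; exact add_mem ha hb
  | smul n a _ ha => rw [smul_mul_assoc]; exact Submodule.smul_mem _ _ ha

theorem subSpan_mono {m n : ℕ} (h : m ≤ n) : subSpan m ≤ subSpan n :=
  Submodule.span_mono (Set.image_mono (sub_mono h))

theorem tau_mem_subSpan {n i j : ℕ} (hi : i < n) (hj : j < n) (hij : i ≠ j) :
    tau i j ∈ subSpan n := of_mem_subSpan (transp_mem_sub hi hj hij)

/-- The trace sees only `1` and `z`, and both lie in `sub n`. -/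
theorem trace_of_mul_eq_zero_of_not_mem {n : ℕ} {a : SpinRing} (ha : a ∈ subSpan n)
    {g : SpinCover} (hg : g ∉ sub n) : trace (of g * a) = 0 := by
  induction ha using Submodule.span_induction with
  | mem x hx =>
    obtain ⟨h, hh, rfl⟩ := hx
    rw [← map_mul, trace_of, delta, if_neg, if_neg]
    · intro h2
      exact hg ((mul_mem_cancel_right hh).1 (h2 ▸ z_mem_sub n))
    · intro h2
      exact hg ((mul_mem_cancel_right hh).1 (h2 ▸ one_mem _))
  | zero => simp
  | add a b _ _ ha hb => rw [mul_add, map_add, ha, hb, add_zero]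
  | smul n a _ ha => rw [mul_smul_comm, map_zsmul, ha, smul_zero]

/-- The vanishing test of the main induction: an element that moves the letter `n` lies outside `sub
n`. -/
theorem Lifts.trace_mul_eq_zero {n : ℕ} {a b : SpinRing} {σ : Equiv.Perm ℕ} (ha : Lifts a σ)
    (hb : b ∈ subSpan n) (hσ : σ n ≠ n) : trace (a * b) = 0 := by
  obtain ⟨g, rfl, hg⟩ := ha
  have h : trace (of g * b) = 0 := by
    apply trace_of_mul_eq_zero_of_not_mem hb
    intro h
    exact hσ (perm_apply_of_mem_sub h le_rfl)
  rcases hg with rfl | rfl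
  · exact h
  · rw [neg_mul, map_neg, h, neg_zero]

end SpinRing

namespace SpinRing
open SpinCover

/-! ### Odd Jucys-Murphy elements and elementary symmetric functions -/

/-- The odd Jucys-Murphy element. -/
noncomputable def jm (k : ℕ) : SpinRing := ∑ i ∈ Finset.range k, tau k i

/-- The elementary symmetric functions in the squares of the odd Jucys-Murphy elements. -/
noncomputable def esymm : ℕ → ℕ → SpinRing
  | _, 0 => 1
  | 0, _ + 1 => 0
  | n + 1, r + 1 => esymm n (r + 1) + esymm n r * jm n ^ 2

theorem esymm_zero_right (n : ℕ) : esymm n 0 = 1 := by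
  cases n <;> rfl

theorem jm_mem_subSpan {k n : ℕ} (h : k < n) : jm k ∈ subSpan n := by
  refine Submodule.sum_mem _ fun i hi => ?_
  have := Finset.mem_range.1 hi
  exact tau_mem_subSpan h (by omega) (by omega)

theorem one_mem_subSpan (n : ℕ) : (1 : SpinRing) ∈ subSpan n := by
  rw [← map_one of]
  exact of_mem_subSpan (one_mem _)

theorem esymm_mem_subSpan (n : ℕ) : ∀ r, esymm n r ∈ subSpan n := by
  induction n with
  | zero =>
    intro r
    cases r with
    | zero => exact one_mem_subSpan _
    | succ r => exact zero_mem _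
  | succ n ih =>
    intro r
    cases r with
    | zero => exact one_mem_subSpan _
    | succ r =>
      have h := jm_mem_subSpan (Nat.lt_succ_self n)
      have h2 := subSpan_mono (Nat.le_succ n)
      rw [esymm, pow_two]
      exact add_mem (h2 (ih _)) (mul_mem_subSpan (h2 (ih _)) (mul_mem_subSpan h h))

/-- Conjugation by `g` fixes the letter `j` and permutes the summands of `jm j`, each with the same
sign. -/
theorem of_mul_jm {n j : ℕ} (hnj : n ≤ j) {g : SpinCover} (hg : g ∈ sub n) :
    of g * jm j = (sgn g : ℤ) • (jm j * of g) := by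
  have hg' : g ∈ sub j := sub_mono hnj hg
  rw [jm, Finset.mul_sum, Finset.sum_mul, Finset.smul_sum]
  refine Finset.sum_bij (fun i _ => perm g i) (fun i hi => ?_) (fun a _ b _ h => ?_)
    (fun b hb => ?_) (fun i hi => ?_)
  · exact Finset.mem_range.2 (perm_lt_of_mem_sub hg' (Finset.mem_range.1 hi))
  · exact (perm g).injective h
  · refine ⟨perm g⁻¹ b, Finset.mem_range.2 (perm_lt_of_mem_sub (inv_mem hg') (Finset.mem_range.1 hb)),
      ?_⟩
    rw [map_inv, Equiv.Perm.inv_def, Equiv.apply_symm_apply]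
  · have := Finset.mem_range.1 hi
    rw [of_mul_tau g (by omega), perm_apply_of_mem_sub hg' le_rfl]

theorem tau_mul_jm {a b j : ℕ} (ha : a < j) (hb : b < j) (hab : a ≠ b) :
    tau a b * jm j = -(jm j * tau a b) := by
  have h := of_mul_jm le_rfl (transp_mem_sub ha hb hab)
  rw [sgn_transp] at h
  simpa [tau] using h

theorem jm_anticomm {i j : ℕ} (hij : i < j) : jm i * jm j = -(jm j * jm i) := by
  have h : ∀ k ∈ Finset.range i, tau i k * jm j = -(jm j * tau i k) := by
    intro k hk
    have := Finset.mem_range.1 hk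
    exact tau_mul_jm hij (by omega) (by omega)
  have h2 : jm i = ∑ k ∈ Finset.range i, tau i k := rfl
  rw [h2, Finset.sum_mul, Finset.sum_congr rfl h, Finset.sum_neg_distrib, Finset.mul_sum]

theorem commute_sq_of_anticomm {R : Type*} [Ring R] {a b : R} (h : a * b = -(b * a)) :
    Commute a (b ^ 2) := by
  rw [Commute, SemiconjBy, pow_two, ← mul_assoc, h, neg_mul, mul_assoc, h]
  noncomm_ring

theorem tau_commute_jm_sq_of_le {a b j : ℕ} (hab : a ≠ b) (ha : j < a) (hb : j < b) :
    Commute (tau a b) (jm j ^ 2) := by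
  apply commute_sq_of_anticomm
  rw [jm, Finset.mul_sum, Finset.sum_mul, ← Finset.sum_neg_distrib]
  refine Finset.sum_congr rfl fun i hi => ?_
  have := Finset.mem_range.1 hi
  exact tau_anticomm hab (by omega) (by omega) (by omega) (by omega) (by omega)

theorem tau_commute_esymm_of_le {a b n : ℕ} (hab : a ≠ b) (ha : n ≤ a) (hb : n ≤ b) (r : ℕ) :
    Commute (tau a b) (esymm n r) := by
  induction n generalizing r with
  | zero =>
    cases r with
    | zero => exact Commute.one_right _
    | succ r => exact Commute.zero_right _
  | succ n ih =>
    cases r with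
    | zero => exact Commute.one_right _
    | succ r =>
      exact (ih (by omega) (by omega) _).add_right ((ih (by omega) (by omega) _).mul_right
        (tau_commute_jm_sq_of_le hab (by omega) (by omega)))

/-- Conjugation by `gen k` carries `jm k` to `jm (k + 1)` up to sign, except for the extra summand
`tau (k + 1) k = -gen k`, which produces the `1`. This is the analogue of the degenerate affine
Hecke relation. -/
theorem gen_mul_jm (k : ℕ) : gen k * jm k + jm (k + 1) * gen k = 1 := by
  have h1 : jm (k + 1) = (∑ i ∈ Finset.range k, tau (k + 1) i) - gen k := by
    rw [jm, Finset.sum_range_succ, tau_swap (Nat.succ_ne_self k).symm, tau_self_succ,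
      sub_eq_add_neg]
  have h2 : gen k * jm k = -((∑ i ∈ Finset.range k, tau (k + 1) i) * gen k) := by
    rw [jm, Finset.mul_sum, Finset.sum_mul, ← Finset.sum_neg_distrib]
    refine Finset.sum_congr rfl fun i hi => ?_
    have := Finset.mem_range.1 hi
    rw [gen_tau k (by omega), Equiv.swap_apply_left,
      Equiv.swap_apply_of_ne_of_ne (by omega) (by omega)]
  rw [h1, h2, sub_mul, gen_mul_gen]
  noncomm_ring

/-- The relation gives `t a² = b² t + (a - b)` and `t b² = a² t + (b - a)`, so the correction terms
cancel in `a² + b²`. In the product they cancel because anticommutation makes `a` commute with `b²`.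
-/
theorem hecke_commute {R : Type*} [Ring R] {t a b : R} (ht : t * t = -1)
    (h : t * a + b * t = 1) (hab : a * b = -(b * a)) :
    Commute t (a ^ 2 + b ^ 2) ∧ Commute t (a ^ 2 * b ^ 2) := by
  have h1 : t * a = 1 - b * t := eq_sub_of_add_eq h
  have h2 : t * b = 1 - a * t := by
    -- Multiplying the relation by `t` on both sides gives its mirror `a t + t b = 1`.
    have h3 : t * (t * a + b * t) * t = t * t := by rw [h, mul_one]
    have h4 : t * (t * a + b * t) * t = (t * t) * (a * t) + t * b * (t * t) := by noncomm_ring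
    rw [h4, ht, neg_one_mul, mul_neg_one] at h3
    have h5 : a * t + t * b = 1 := by
      have := congrArg Neg.neg h3
      simpa [add_comm] using this
    exact eq_sub_of_add_eq' h5
  have h3 : t * a ^ 2 = a - b + b ^ 2 * t := by
    have h' := h1
    rw [pow_two, ← mul_assoc, h', sub_mul, one_mul, mul_assoc, h']
    noncomm_ring
  have h4 : t * b ^ 2 = b - a + a ^ 2 * t := by
    have h' := h2
    rw [pow_two, ← mul_assoc, h', sub_mul, one_mul, mul_assoc, h']
    noncomm_ring
  have h5 : a * b ^ 2 = b ^ 2 * a := (commute_sq_of_anticomm hab).eq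
  have h6 : a ^ 2 * b ^ 2 = b ^ 2 * a ^ 2 := ((commute_sq_of_anticomm hab).pow_left 2).eq
  constructor
  · rw [Commute, SemiconjBy, mul_add, h3, h4]
    noncomm_ring
  · rw [Commute, SemiconjBy]
    calc t * (a ^ 2 * b ^ 2) = (t * a ^ 2) * b ^ 2 := by noncomm_ring
      _ = a * b ^ 2 - b ^ 3 + b ^ 2 * (t * b ^ 2) := by rw [h3]; noncomm_ring
      _ = a * b ^ 2 - b ^ 3 + b ^ 3 - b ^ 2 * a + b ^ 2 * a ^ 2 * t := by rw [h4]; noncomm_ring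
      _ = _ := by rw [h5, h6]; noncomm_ring

/-- On `k + 2` letters the function depends on the last two elements only through the sum and the
product of their squares. Each later `jm` anticommutes with `gen k`, so its square commutes. -/
theorem gen_commute_esymm {k n : ℕ} (h : k + 1 < n) (r : ℕ) : Commute (gen k) (esymm n r) := by
  obtain ⟨d, rfl⟩ : ∃ d, n = k + 2 + d := ⟨n - (k + 2), by omega⟩
  clear h
  induction d generalizing r with
  | zero =>
    have h0 : ∀ r, Commute (gen k) (esymm k r) := by
      intro r
      rw [← tau_self_succ]
      exact tau_commute_esymm_of_le (by omega) (by omega) (by omega) r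
    obtain ⟨h1, h2⟩ := hecke_commute (gen_mul_gen k) (gen_mul_jm k)
      (jm_anticomm (Nat.lt_succ_self k))
    match r with
    | 0 => rw [esymm_zero_right]; exact Commute.one_right _
    | 1 =>
      have : esymm (k + 2 + 0) 1 = esymm k 1 + (jm k ^ 2 + jm (k + 1) ^ 2) := by
        change esymm k 1 + esymm k 0 * jm k ^ 2 + esymm (k + 1) 0 * jm (k + 1) ^ 2 = _
        rw [esymm_zero_right, esymm_zero_right]
        noncomm_ring
      rw [this]
      exact (h0 1).add_right h1
    | r + 2 =>
      have : esymm (k + 2 + 0) (r + 2) = esymm k (r + 2) +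
          esymm k (r + 1) * (jm k ^ 2 + jm (k + 1) ^ 2) +
          esymm k r * (jm k ^ 2 * jm (k + 1) ^ 2) := by
        change esymm k (r + 2) + esymm k (r + 1) * jm k ^ 2 +
          (esymm k (r + 1) + esymm k r * jm k ^ 2) * jm (k + 1) ^ 2 = _
        noncomm_ring
      rw [this]
      exact ((h0 _).add_right ((h0 _).mul_right h1)).add_right ((h0 _).mul_right h2)
  | succ d ih =>
    cases r with
    | zero => rw [esymm_zero_right]; exact Commute.one_right _
    | succ r =>
      have h1 : Commute (gen k) (jm (k + 2 + d) ^ 2) := by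
        apply commute_sq_of_anticomm
        rw [← tau_self_succ]
        exact tau_mul_jm (by omega) (by omega) (by omega)
      change Commute _ (esymm (k + 2 + d) (r + 1) + esymm (k + 2 + d) r * jm (k + 2 + d) ^ 2)
      exact (ih _).add_right ((ih _).mul_right h1)

/-- The elements that commute with the group on `n` letters and with the lifts of the
transpositions of the other letters. -/
def Central (n : ℕ) (a : SpinRing) : Prop :=
  (∀ g ∈ sub n, Commute (of g) a) ∧
    ∀ i j, n ≤ i → n ≤ j → i ≠ j → Commute (tau i j) a

/-- Commuting with transpositions of outside letters expresses evenness: such a transposition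
anticommutes with an odd element of `sub n`. This half of `Central` is needed for the vanishing at
odd products of cycles. -/
theorem central_esymm (n r : ℕ) : Central n (esymm n r) := by
  refine ⟨fun g hg => ?_, fun i j hi hj hij => tau_commute_esymm_of_le hij hi hj r⟩
  induction hg using Subgroup.closure_induction with
  | mem x hx =>
    rcases hx with rfl | ⟨k, hk, rfl⟩
    · rw [of_z]; exact (Commute.one_left _).neg_left
    · exact gen_commute_esymm hk r
  | one => rw [map_one]; exact Commute.one_left _
  | mul a b _ _ ha hb => rw [map_mul]; exact ha.mul_left hb
  | inv a _ ha =>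
    have h := congrArg (fun y => of a⁻¹ * y * of a⁻¹) ha.eq
    simp only [mul_assoc, of_mul_inv, mul_one] at h
    rw [← mul_assoc (of a⁻¹) (of a), of_inv_mul, one_mul] at h
    exact h.symm

theorem Central.tau {n : ℕ} {a : SpinRing} (h : Central n a) {i j : ℕ} (hi : i < n) (hj : j < n)
    (hij : i ≠ j) : Commute (tau i j) a := h.1 _ (transp_mem_sub hi hj hij)

theorem sort_insert_max {n : ℕ} {s : Finset ℕ} (hs : ∀ i ∈ s, i < n) :
    (insert n s).sort (· ≤ ·) = s.sort (· ≤ ·) ++ [n] := by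
  have hn : n ∉ s := fun h => lt_irrefl _ (hs n h)
  refine List.Perm.eq_of_pairwise' (r := (· ≤ ·)) (Finset.pairwise_sort _ _) ?_ ?_
  · rw [List.pairwise_append]
    refine ⟨Finset.pairwise_sort _ _, List.pairwise_singleton _ _, ?_⟩
    intro a ha b hb
    rw [List.mem_singleton.1 hb]
    exact (hs a ((Finset.mem_sort _).1 ha)).le
  · rw [← Multiset.coe_eq_coe, Finset.sort_eq, Finset.insert_val_of_notMem hn,
      ← Multiset.coe_add, Finset.sort_eq, add_comm]
    rfl

/-- The word is a conjugate by `tau i n`, which exchanges `i` and the auxiliary letter `n`; the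
result no longer depends on `n`. -/
theorem cycle_pair {n i k : ℕ} (hi : i < n) (hk : k < n) (hik : i ≠ k) :
    of (cycle n [i, k]) = tau k i := by
  change of (x n i * ([k].map (x n)).prod * x n i) = _
  rw [List.map_singleton, List.prod_singleton, x_eq_transp hi, x_eq_transp hk, map_mul, map_mul]
  change SpinRing.tau i n * SpinRing.tau k n * SpinRing.tau i n = _
  rw [tau_mul_tau_apply (by omega) (by omega), Equiv.swap_apply_right,
    Equiv.swap_apply_of_ne_of_ne hik.symm (by omega), neg_mul, mul_assoc, tau_mul_self (by omega)]
  noncomm_ring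

theorem jucysMurphy_eq {n k : ℕ} (h : k < n) : SpinAlgebra.jucysMurphy n k = jm k := by
  change ∑ i ∈ Finset.range k, of (cycle n [i, k]) = _
  refine Finset.sum_congr rfl fun i hi => ?_
  have := Finset.mem_range.1 hi
  exact cycle_pair (by omega) h (by omega)

theorem sum_powersetCard_jm (n r : ℕ) : ∑ s ∈ (Finset.range n).powersetCard r,
    ((s.sort (· ≤ ·)).map fun k => jm k ^ 2).prod = esymm n r := by
  induction n generalizing r with
  | zero =>
    cases r with
    | zero => simp [esymm]
    | succ r => rw [Finset.range_zero, Finset.powersetCard_eq_empty.2 (by simp)]; rfl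
  | succ n ih =>
    cases r with
    | zero => simp [esymm]
    | succ r =>
      rw [Finset.range_add_one, Finset.powersetCard_succ_insert Finset.notMem_range_self,
        Finset.sum_union, ih, Finset.sum_image, esymm, ← ih r, Finset.sum_mul]
      · congr 1
        refine Finset.sum_congr rfl fun s hs => ?_
        rw [sort_insert_max, List.map_append, List.prod_append, List.map_singleton,
          List.prod_singleton]
        intro i hi
        exact Finset.mem_range.1 ((Finset.mem_powersetCard.1 hs).1 hi)
      · intro s hs t ht hst
        have h1 : n ∉ s := fun h =>
          Finset.notMem_range_self ((Finset.mem_powersetCard.1 hs).1 h)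
        have h2 : n ∉ t := fun h =>
          Finset.notMem_range_self ((Finset.mem_powersetCard.1 ht).1 h)
        rw [← Finset.erase_insert h1, hst, Finset.erase_insert h2]
      · rw [Finset.disjoint_left]
        intro s hs hs'
        obtain ⟨u, _, rfl⟩ := Finset.mem_image.1 hs'
        exact Finset.notMem_range_self
          ((Finset.mem_powersetCard.1 hs).1 (Finset.mem_insert_self n u))

theorem elemSymm_eq (n r : ℕ) : SpinAlgebra.elemSymm n r = esymm n r := by
  refine Eq.trans ?_ (sum_powersetCard_jm n r)
  change ∑ s ∈ (Finset.range n).powersetCard r,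
    ((s.sort (· ≤ ·)).map fun k => (show SpinRing from SpinAlgebra.jucysMurphy n k) ^ 2).prod = _
  refine Finset.sum_congr rfl fun s hs => ?_
  congr 1
  refine List.map_congr_left fun k hk => ?_
  have : k < n :=
    Finset.mem_range.1 ((Finset.mem_powersetCard.1 hs).1 ((Finset.mem_sort _).1 hk))
  rw [jucysMurphy_eq this]

end SpinRing

namespace SpinRing
open SpinCover

/-! ### Products of cycles -/

/-- The product of the lifts of the transpositions of `a` with the letters of a list. -/
noncomputable def arm (a : ℕ) (l : List ℕ) : SpinRing := (l.map (tau a)).prod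

/-- The cycle on a list of letters, up to sign. -/
noncomputable def cyc : List ℕ → SpinRing
  | [] => 1
  | a :: l => arm a l

/-- The product of the cycles on the members of a list of lists. -/
noncomputable def cycProd (C : List (List ℕ)) : SpinRing := (C.map fun c => -cyc c).prod

@[simp] theorem arm_nil (a : ℕ) : arm a [] = 1 := rfl

theorem arm_cons (a b : ℕ) (l : List ℕ) : arm a (b :: l) = tau a b * arm a l := by
  simp [arm]

theorem arm_append (a : ℕ) (l m : List ℕ) : arm a (l ++ m) = arm a l * arm a m := by
  simp [arm]

@[simp] theorem arm_singleton (a b : ℕ) : arm a [b] = tau a b := by simp [arm]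

theorem cycProd_cons (c : List ℕ) (C : List (List ℕ)) :
    cycProd (c :: C) = -cyc c * cycProd C := by
  simp [cycProd]

@[simp] theorem cycProd_nil : cycProd [] = 1 := rfl

/-- The sign `(-1) ^ n` as a unit. -/
abbrev sg (n : ℕ) : ℤˣ := (-1) ^ n

theorem sg_succ_smul (n : ℕ) (a : SpinRing) : sg (n + 1) • a = -(sg n • a) := by
  rw [sg, pow_succ, mul_neg_one, Units.neg_smul]

theorem tau_mul_arm {a b : ℕ} (hab : a ≠ b) {l : List ℕ} (ha : a ∉ l) (hb : b ∉ l) :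
    tau a b * arm a l = sg l.length • (arm b l * tau a b) := by
  induction l with
  | nil => simp
  | cons c l ih =>
    simp only [List.mem_cons, not_or] at ha hb
    rw [arm_cons, ← mul_assoc, tau_mul_tau hab ha.1 hb.1, neg_mul, mul_assoc, ih ha.2 hb.2,
      mul_smul_comm, ← mul_assoc, ← arm_cons, List.length_cons, sg_succ_smul]

theorem tau_mul_arm_disjoint {a b c : ℕ} (hab : a ≠ b) {l : List ℕ} (hc : c ∉ l) (hac : a ≠ c)
    (hbc : b ≠ c) (ha : a ∉ l) (hb : b ∉ l) :
    tau a b * arm c l = sg l.length • (arm c l * tau a b) := by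
  induction l with
  | nil => simp
  | cons d l ih =>
    simp only [List.mem_cons, not_or] at ha hb hc
    rw [arm_cons, ← mul_assoc, tau_anticomm hab hc.1 hac ha.1 hbc hb.1, neg_mul, mul_assoc,
      ih hc.2 ha.2 hb.2, mul_smul_comm, ← mul_assoc, List.length_cons, sg_succ_smul]

/-- Each transposition of one arm anticommutes with each transposition of the other. -/
theorem arm_mul_arm_disjoint {a c : ℕ} {l m : List ℕ} (hl : (a :: l).Nodup) (hm : (c :: m).Nodup)
    (h : (a :: l).Disjoint (c :: m)) :
    arm a l * arm c m = sg (l.length * m.length) • (arm c m * arm a l) := by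
  induction l with
  | nil => simp
  | cons b l ih =>
    have h' : (a :: l).Disjoint (c :: m) := by
      intro x hx; apply h; simp only [List.mem_cons] at hx ⊢; tauto
    have h1 := ih (by simp_all) h'
    have ha : a ∉ c :: m := fun h2 => h (by simp) h2
    have hb : b ∉ c :: m := fun h2 => h (by simp) h2
    simp only [List.mem_cons, not_or, List.nodup_cons] at ha hb hl hm
    rw [arm_cons, mul_assoc, h1, mul_smul_comm, ← mul_assoc,
      tau_mul_arm_disjoint hl.1.1 hm.1 ha.1 hb.1 ha.2 hb.2, smul_mul_assoc, smul_smul, mul_assoc,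
      List.length_cons, add_mul, one_mul, sg, sg, sg, pow_add]

theorem cyc_mul_cyc {c d : List ℕ} (hc : c.Nodup) (hd : d.Nodup) (h : c.Disjoint d) :
    cyc c * cyc d = sg ((c.length - 1) * (d.length - 1)) • (cyc d * cyc c) := by
  cases c with
  | nil => simp [cyc]
  | cons a l =>
    cases d with
    | nil => simp [cyc]
    | cons b m => exact arm_mul_arm_disjoint hc hd h

theorem cyc_rotate_one {a : ℕ} {l : List ℕ} (h : (a :: l).Nodup) :
    cyc (a :: l) = sg l.length • cyc (l ++ [a]) := by
  cases l with
  | nil => simp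
  | cons b l =>
    simp only [List.mem_cons, not_or, List.nodup_cons] at h
    change arm a (b :: l) = sg (b :: l).length • arm b (l ++ [a])
    rw [arm_cons, tau_mul_arm h.1.1 h.1.2 h.2.1, arm_append, arm_singleton, List.length_cons,
      tau_swap h.1.1, sg_succ_smul, mul_neg, smul_neg, neg_neg]

/-- Every rotation by one letter of a cycle of length `L` costs the sign `(-1) ^ (L - 1)`. Hence odd
cycles rotate freely. -/
theorem cyc_rotate {p q : List ℕ} (h : (p ++ q).Nodup) :
    cyc (p ++ q) = sg (p.length * (p.length + q.length - 1)) • cyc (q ++ p) := by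
  induction p generalizing q with
  | nil => simp
  | cons b p ih =>
    have h1 : (p ++ (q ++ [b])).Nodup := by
      rw [← List.append_assoc]
      exact (List.perm_append_singleton b (p ++ q)).nodup_iff.2 h
    change cyc (b :: (p ++ q)) = _
    rw [cyc_rotate_one (l := p ++ q) h, List.append_assoc, ih h1, smul_smul, sg, sg, sg,
      ← pow_add]
    congr 2
    · simp only [List.length_append, List.length_cons, List.length_nil]
      rw [show p.length + (q.length + (0 + 1)) - 1 = p.length + q.length by omega,
        show p.length + 1 + q.length - 1 = p.length + q.length by omega]
      ring
    · simp

theorem cyc_rotate_of_odd {p q : List ℕ} (h : (p ++ q).Nodup) (hodd : Odd (p ++ q).length) :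
    cyc (p ++ q) = cyc (q ++ p) := by
  rw [cyc_rotate h, sg, Even.neg_one_pow, one_smul]
  rw [List.length_append] at hodd
  exact Even.mul_left (Nat.Odd.sub_odd hodd odd_one) _

/-- A cycle may be started at any of its letters. -/
theorem exists_cyc_eq {c : List ℕ} (hc : c.Nodup) {x : ℕ} (hx : x ∈ c) :
    ∃ l, (x :: l).Perm c ∧ (∃ ε : ℤˣ, cyc c = ε • cyc (x :: l)) ∧
      (Odd c.length → cyc c = cyc (x :: l)) := by
  obtain ⟨p, q, rfl⟩ := List.append_of_mem hx
  refine ⟨q ++ p, ?_, ⟨_, cyc_rotate hc⟩, fun h => cyc_rotate_of_odd hc h⟩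
  exact List.perm_append_comm (l₁ := x :: q)

theorem cycProd_perm_of_odd {C D : List (List ℕ)} (h : C.Perm D) (hC : C.flatten.Nodup)
    (hodd : ∀ c ∈ C, Odd c.length) : cycProd C = cycProd D := by
  refine List.Perm.prod_eq' (h.map _) ?_
  rw [List.nodup_flatten] at hC
  rw [List.pairwise_map]
  refine List.Pairwise.imp_of_mem ?_ hC.2
  intro c d hc hd hcd
  refine Commute.neg_left (Commute.neg_right ?_)
  rw [Commute, SemiconjBy, cyc_mul_cyc (hC.1 c hc) (hC.1 d hd) hcd, sg, Even.neg_one_pow, one_smul]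
  exact Even.mul_left (Nat.Odd.sub_odd (hodd d hd) odd_one) _

theorem cycProd_perm {C D : List (List ℕ)} (h : C.Perm D) (hC : C.flatten.Nodup) :
    ∃ ε : ℤˣ, cycProd C = ε • cycProd D := by
  induction h with
  | nil => exact ⟨1, by simp⟩
  | cons c h ih =>
    rw [List.flatten_cons] at hC
    obtain ⟨ε, h1⟩ := ih (List.Nodup.of_append_right hC)
    exact ⟨ε, by rw [cycProd_cons, cycProd_cons, h1, mul_smul_comm]⟩
  | swap c d l =>
    rw [List.nodup_flatten] at hC
    have h1 := cyc_mul_cyc (hC.1 d (by simp)) (hC.1 c (by simp))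
      ((List.pairwise_cons.1 hC.2).1 c (by simp))
    refine ⟨sg ((d.length - 1) * (c.length - 1)), ?_⟩
    · rw [cycProd_cons, cycProd_cons, cycProd_cons, cycProd_cons, ← mul_assoc, neg_mul_neg, h1,
        smul_mul_assoc]
      congr 1
      noncomm_ring
  | trans h1 _ ih1 ih2 =>
    obtain ⟨ε, h3⟩ := ih1 hC
    obtain ⟨ε', h4⟩ := ih2 (h1.flatten.nodup_iff.1 hC)
    exact ⟨ε * ε', by rw [h3, h4, smul_smul]⟩

theorem units_smul_eq (ε : ℤˣ) (a : SpinRing) : ε • a = a ∨ ε • a = -a := by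
  rcases Int.units_eq_one_or ε with rfl | rfl
  · left; simp
  · right; simp

theorem lifts_arm {a : ℕ} {l : List ℕ} (h : a ∉ l) :
    ∃ σ, Lifts (arm a l) σ ∧ ∀ y ∉ a :: l, σ y = y := by
  induction l with
  | nil => exact ⟨1, lifts_one, fun y _ => rfl⟩
  | cons b l ih =>
    simp only [List.mem_cons, not_or] at h
    obtain ⟨σ, h1, h2⟩ := ih h.2
    refine ⟨_, arm_cons a b l ▸ (lifts_tau h.1).mul h1, fun y hy => ?_⟩
    simp only [List.mem_cons, not_or] at hy
    rw [Equiv.Perm.mul_apply, h2 y (by simp [hy]), Equiv.swap_apply_of_ne_of_ne hy.1 hy.2.1]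

theorem lifts_cyc {c : List ℕ} (h : c.Nodup) : ∃ σ, Lifts (cyc c) σ ∧ ∀ y ∉ c, σ y = y := by
  cases c with
  | nil => exact ⟨1, lifts_one, fun y _ => rfl⟩
  | cons a l => exact lifts_arm (List.nodup_cons.1 h).1

theorem lifts_cycProd {C : List (List ℕ)} (h : C.flatten.Nodup) :
    ∃ σ, Lifts (cycProd C) σ ∧ ∀ y ∉ C.flatten, σ y = y := by
  induction C with
  | nil => exact ⟨1, lifts_one, fun y _ => rfl⟩
  | cons c C ih =>
    rw [List.flatten_cons] at h
    obtain ⟨σ, h1, h2⟩ := ih (List.Nodup.of_append_right h)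
    obtain ⟨τ, h3, h4⟩ := lifts_cyc (List.Nodup.of_append_left h)
    refine ⟨_, cycProd_cons c C ▸ h3.neg.mul h1, fun y hy => ?_⟩
    simp only [List.flatten_cons, List.mem_append, not_or] at hy
    rw [Equiv.Perm.mul_apply, h2 y hy.2, h4 y hy.1]

/-- A pair of transpositions splits a cycle that contains all their letters. -/
theorem tau_tau_arm_split {n a j : ℕ} {l m : List ℕ} (h : (n :: (l ++ j :: m ++ [a])).Nodup) :
    tau n a * tau n j * arm n (l ++ j :: m ++ [a]) = sg m.length • (arm j l * arm a m) := by
  simp only [List.nodup_cons, List.nodup_append, List.mem_append, List.mem_cons, not_or] at h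
  have hna : n ≠ a := by tauto
  have hnj : n ≠ j := by tauto
  have hal : a ∉ l := fun h' => h.2.2.2 a (Or.inl h') a (by simp) rfl
  have ham : a ∉ m := fun h' => h.2.2.2 a (Or.inr (Or.inr h')) a (by simp) rfl
  have haj : j ≠ a := fun h' => h.2.2.2 j (Or.inr (Or.inl rfl)) a (by simp) h'
  have hjl : j ∉ l := fun h' => h.2.1.2.2 j h' j (Or.inl rfl) rfl
  have hnl : n ∉ l := by tauto
  have hnm : n ∉ m := by tauto
  rw [List.append_assoc, List.cons_append, arm_append, arm_cons, arm_append, arm_singleton]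
  calc tau n a * tau n j * (arm n l * (tau n j * (arm n m * tau n a)))
      = tau n a * (tau n j * arm n l) * tau n j * arm n m * tau n a := by noncomm_ring
    _ = sg l.length • (tau n a * arm j l * (tau n j * tau n j) * arm n m * tau n a) := by
        rw [tau_mul_arm hnj hnl hjl]; simp only [mul_smul_comm, smul_mul_assoc, mul_assoc]
    _ = -(sg l.length • ((tau n a * arm j l) * arm n m * tau n a)) := by
        rw [tau_mul_self hnj]; simp [mul_assoc]
    _ = -(arm j l * (tau n a * arm n m) * tau n a) := by
        rw [tau_mul_arm_disjoint hna hjl hnj haj.symm hnl hal]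
        simp only [smul_mul_assoc, smul_smul, mul_assoc]
        rw [← pow_add, ← two_mul, pow_mul]; simp
    _ = -(sg m.length • (arm j l * arm a m * (tau n a * tau n a))) := by
        rw [tau_mul_arm hna hnm ham]; simp only [mul_smul_comm, smul_mul_assoc, mul_assoc]
    _ = _ := by rw [tau_mul_self hna]; simp

/-- A pair of transpositions joins two cycles. -/
theorem tau_tau_arm_join {n a j : ℕ} {l m : List ℕ} (h : (n :: j :: (l ++ [a])).Nodup)
    (hl : Odd l.length) :
    tau n a * tau n j * (arm n (l ++ [a]) * arm j m) = -arm j (l ++ a :: m) := by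
  simp only [List.nodup_cons, List.nodup_append, List.mem_append, List.mem_cons, not_or] at h
  have hna : n ≠ a := by tauto
  have hnj : n ≠ j := by tauto
  have hal : a ∉ l := fun h' => h.2.2.2.2 a h' a (by simp) rfl
  have haj : j ≠ a := by tauto
  have hjl : j ∉ l := by tauto
  have hnl : n ∉ l := by tauto
  have h1 : tau n j * arm n l = -(arm j l * tau n j) := by
    rw [tau_mul_arm hnj hnl hjl, sg, hl.neg_one_pow, Units.neg_smul, one_smul]
  have h2 : tau n a * arm j l = -(arm j l * tau n a) := by
    rw [tau_mul_arm_disjoint hna hjl hnj haj.symm hnl hal, sg, hl.neg_one_pow, Units.neg_smul,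
      one_smul]
  have h3 : tau n j * tau n a = -(tau n a * tau a j) := by
    have h4 := tau_mul_tau (a := a) (b := n) (c := j) hna.symm haj.symm hnj
    rw [tau_swap hna, neg_mul, mul_neg, neg_neg] at h4
    exact h4.symm
  rw [arm_append, arm_singleton, arm_append, arm_cons]
  calc tau n a * tau n j * (arm n l * tau n a * arm j m)
      = tau n a * (tau n j * arm n l) * tau n a * arm j m := by noncomm_ring
    _ = -((tau n a * arm j l) * (tau n j * tau n a) * arm j m) := by rw [h1]; noncomm_ring
    _ = -(arm j l * (tau n a * tau n a) * tau a j * arm j m) := by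
        rw [h2, h3]; noncomm_ring
    _ = -(arm j l * (tau j a * arm j m)) := by
        rw [tau_mul_self hna, tau_swap haj]; noncomm_ring

/-- A cycle of even length makes the coefficients of central elements vanish. -/
theorem trace_cycProd_mul_eq_zero {n : ℕ} {C : List (List ℕ)} (hC : C.flatten.Nodup)
    (hn : ∀ x ∈ C.flatten, x < n) {c : List ℕ} (hcC : c ∈ C) (hc0 : c ≠ [])
    (hc : Even c.length) {y : SpinRing} (hy : Central n y) : trace (cycProd C * y) = 0 := by
  obtain ⟨R, hR⟩ : ∃ R, C.Perm (c :: R) := ⟨_, List.perm_cons_erase hcC⟩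
  have hnd : (c :: R).flatten.Nodup := hR.flatten.nodup_iff.1 hC
  have hlt : ∀ x ∈ (c :: R).flatten, x < n := fun x hx => hn x (hR.flatten.mem_iff.2 hx)
  have hcodd : Odd (c.length - 1) := by
    have : 0 < c.length := List.length_pos_of_ne_nil hc0
    exact Nat.Even.sub_odd this hc odd_one
  have hcn : c.Nodup := (List.nodup_flatten.1 hnd).1 c (by simp)
  have hcR := (List.pairwise_cons.1 (List.nodup_flatten.1 hnd).2).1
  have hRn : ∀ d ∈ R, d.Nodup := fun d hd => (List.nodup_flatten.1 hnd).1 d (by simp [hd])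
  set u := SpinRing.tau n (n + 1) with hu
  have hu1 : u * u = -1 := tau_mul_self (Nat.succ_ne_self n).symm
  have hud : ∀ d : List ℕ, d.Nodup → (∀ x ∈ d, x < n) →
      u * cyc d = sg (d.length - 1) • (cyc d * u) := by
    intro d hd hdn
    cases d with
    | nil => simp [cyc]
    | cons a l =>
      simp only [List.mem_cons, forall_eq_or_imp, List.nodup_cons] at hdn hd
      refine tau_mul_arm_disjoint (by omega) hd.1 (by omega) (by omega) ?_ ?_
      · intro h; exact lt_irrefl _ (hdn.2 _ h)
      · intro h; have := hdn.2 _ h; omega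
  have huy : Commute u y := hy.2 _ _ le_rfl (Nat.le_succ n) (Nat.succ_ne_self n).symm
  have hcl : ∀ x ∈ c, x < n := fun x hx => hlt x (by simp [hx])
  have hcy : Commute (cyc c) y := by
    cases c with
    | nil => exact Commute.one_left _
    | cons a l =>
      simp only [List.mem_cons, forall_eq_or_imp, List.nodup_cons] at hcl hcn
      apply Commute.list_prod_left
      intro x hx
      obtain ⟨b, hb, rfl⟩ := List.mem_map.1 hx
      exact hy.tau hcl.1 (hcl.2 b hb) (fun h => hcn.1 (h ▸ hb))
  -- Both the even cycle `c` and the outside transposition `u` are odd elements, so they pass the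
  -- remaining cycles with a common sign.
  obtain ⟨ε, h1, h2⟩ : ∃ ε : ℤˣ, cyc c * cycProd R = ε • (cycProd R * cyc c) ∧
      u * cycProd R = ε • (cycProd R * u) := by
    have hlR : ∀ d ∈ R, ∀ x ∈ d, x < n := fun d hd x hx => hlt x (by
      simp only [List.flatten_cons, List.mem_append, List.mem_flatten]
      exact Or.inr ⟨d, hd, hx⟩)
    clear hR hnd hlt
    induction R with
    | nil => exact ⟨1, by simp⟩
    | cons d R ih =>
      obtain ⟨ε, h1, h2⟩ := ih (fun d hd => hcR d (by simp [hd])) (fun d hd => hRn d (by simp [hd]))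
        (fun d hd => hlR d (by simp [hd]))
      have h3 := cyc_mul_cyc hcn (hRn d (by simp)) (hcR d (by simp))
      have h4 := hud d (hRn d (by simp)) (hlR d (by simp))
      rw [sg, pow_mul, hcodd.neg_one_pow] at h3
      refine ⟨(-1) ^ (d.length - 1) * ε, ?_, ?_⟩
      · rw [cycProd_cons, ← mul_assoc, mul_neg, h3]
        simp only [smul_mul_assoc, neg_mul, mul_assoc, h1, mul_smul_comm, smul_neg, smul_smul]
      · rw [cycProd_cons, ← mul_assoc, mul_neg, h4]
        simp only [smul_mul_assoc, neg_mul, mul_assoc, h2, mul_smul_comm, smul_neg, smul_smul]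
  suffices h : trace (cyc c * cycProd R * y) = 0 by
    obtain ⟨δ, hδ⟩ := cycProd_perm hR hC
    rw [hδ, cycProd_cons, neg_mul, smul_mul_assoc, neg_mul]
    rcases units_smul_eq δ (-(cyc c * cycProd R * y)) with h' | h' <;> rw [h'] <;> simp [h]
  have hself : ∀ k : ℤ, k = -k → k = 0 := fun k hk => by omega
  apply hself
  rcases Int.units_eq_one_or ε with rfl | rfl
  -- The whole product is odd and anticommutes with `u`, whereas `y` commutes with `u`; since `u² =
  -- -1`, conjugation by `u` changes the sign of the trace.
  · rw [one_smul] at h1 h2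
    have h3 : u * (cyc c * cycProd R) = -(cyc c * cycProd R * u) := by
      rw [← mul_assoc, hud c hcn hcl, sg, hcodd.neg_one_pow, Units.neg_smul, one_smul, neg_mul,
        mul_assoc, h2, mul_assoc]
    have h4 : cyc c * cycProd R = u * (cyc c * cycProd R) * u := by
      rw [h3, neg_mul, mul_assoc, hu1]; simp
    calc trace (cyc c * cycProd R * y) = trace (u * (cyc c * cycProd R) * u * y) := by rw [← h4]
      _ = trace (u * (cyc c * cycProd R * (u * y))) := by congr 1; noncomm_ring
      _ = trace (cyc c * cycProd R * (u * y) * u) := trace_mul_comm _ _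
      _ = trace (cyc c * cycProd R * y * (u * u)) := by
          rw [huy.eq]; congr 1; noncomm_ring
      _ = _ := by rw [hu1]; simp
  -- The remaining factor is odd: moving the cycle `c` around the trace once gives a sign, and `c`
  -- commutes with `y`.
  · rw [Units.neg_smul, one_smul] at h1
    calc trace (cyc c * cycProd R * y) = -trace (cycProd R * (cyc c * y)) := by
          rw [h1, neg_mul, map_neg, mul_assoc]
      _ = -trace (cycProd R * y * cyc c) := by rw [hcy.eq, mul_assoc]
      _ = -trace (cyc c * (cycProd R * y)) := by rw [trace_mul_comm]
      _ = _ := by rw [mul_assoc]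

end SpinRing

namespace SpinRing
open SpinCover

/-! ### The coefficients of the elementary symmetric functions -/

/-- Cyclicity of the trace moves `jm n ^ 2` to the front, next to the product of cycles on which it
is to act. -/
theorem trace_mul_esymm_succ (x : SpinRing) (n r : ℕ) :
    trace (x * esymm (n + 1) (r + 1)) = trace (x * esymm n (r + 1)) +
      ∑ i ∈ Finset.range n, ∑ j ∈ Finset.range n, trace (tau n i * tau n j * x * esymm n r) := by
  rw [esymm, mul_add, map_add, ← mul_assoc, trace_mul_comm (x * esymm n r), pow_two, jm,
    Finset.sum_mul_sum, Finset.sum_mul, map_sum]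
  congr 1
  refine Finset.sum_congr rfl fun i _ => ?_
  rw [Finset.sum_mul, map_sum]
  simp only [mul_assoc]

/-- Turns a sum over the letters of a cycle into a sum over positions. The contribution of a split
depends only on where the letter stands. -/
theorem sum_map_of_append (l : List ℕ) (g : ℕ → ℤ) (h : ℕ → ℤ)
    (hg : ∀ p j q, l = p ++ j :: q → g j = h p.length) :
    (l.map g).sum = ∑ k ∈ Finset.range l.length, h k := by
  induction l generalizing h with
  | nil => simp
  | cons b l ih =>
    rw [List.map_cons, List.sum_cons, List.length_cons, Finset.sum_range_succ',
      hg [] b l rfl, ih (fun k => h (k + 1)), add_comm]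
    · rfl
    · intro p j q hl
      exact hg (b :: p) j q (by rw [hl]; rfl)

theorem sum_range_odd (H : ℕ → ℤ) (q : ℕ) :
    ∑ k ∈ Finset.range (2 * q + 1), (if Even k then H (k / 2) else 0) =
      ∑ s ∈ Finset.range (q + 1), H s := by
  induction q with
  | zero => simp
  | succ q ih =>
    rw [show 2 * (q + 1) + 1 = 2 * q + 1 + 1 + 1 by ring, Finset.sum_range_succ,
      Finset.sum_range_succ, ih, Finset.sum_range_succ _ (q + 1), if_neg, if_pos,
      show (2 * q + 1 + 1) / 2 = q + 1 by omega, add_zero]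
    · exact ⟨q + 1, by ring⟩
    · rw [Nat.not_even_iff_odd]; exact ⟨q, rfl⟩

theorem sum_catalan (q : ℕ) :
    ∑ s ∈ Finset.range (q + 1), (catalan s : ℤ) * catalan (q - s) = catalan (q + 1) := by
  rw [catalan_succ', Finset.Nat.sum_antidiagonal_eq_sum_range_succ (fun a b => catalan a * catalan b)]
  push_cast
  rfl

/-- The factor of a cycle in the coefficient of a product of cycles of odd lengths. -/
def cycleCoeff (c : List ℕ) : ℤ := -(catalan ((c.length - 1) / 2))

theorem flatten_nodup_of_perm {n : ℕ} {C : List (List ℕ)} (h : C.flatten.Perm (List.range n)) :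
    C.flatten.Nodup := h.nodup_iff.2 List.nodup_range

theorem flatten_lt_of_perm {n : ℕ} {C : List (List ℕ)} (h : C.flatten.Perm (List.range n)) :
    ∀ x ∈ C.flatten, x < n := fun _ hx => List.mem_range.1 (h.mem_iff.1 hx)

/-- The coefficients, with respect to the products of cycles of odd lengths on `n` letters, of
the elementary symmetric function of degree `r`: Catalan numbers if the rank of the product
is `2 * r`, and zero if it is larger. -/
def CoeffFormula (n r : ℕ) : Prop :=
  ∀ C : List (List ℕ), C.flatten.Perm (List.range n) → (∀ c ∈ C, Odd c.length) →
    (n = C.length + 2 * r → trace (cycProd C * esymm n r) = (C.map cycleCoeff).prod) ∧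
    (C.length + 2 * r < n → trace (cycProd C * esymm n r) = 0)

theorem sum_range_eq_of_perm {n : ℕ} {l : List ℕ} (h : l.Perm (List.range n)) (f : ℕ → ℤ) :
    ∑ j ∈ Finset.range n, f j = (l.map f).sum := by
  rw [(h.map f).sum_eq]
  rfl

section step

variable {n : ℕ} {R : List (List ℕ)}

theorem trace_fixed (hR : R.flatten.Perm (List.range n)) {i j : ℕ} (hi : i < n) (hj : j < n) (r : ℕ) :
    trace (tau n i * tau n j * cycProd ([n] :: R) * esymm n r) =
      if i = j then trace (cycProd R * esymm n r) else 0 := by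
  have h1 : cycProd ([n] :: R) = -cycProd R := by
    rw [cycProd_cons]; simp [cyc]
  rw [h1]
  split_ifs with hij
  · subst hij
    rw [tau_mul_self (by omega)]; simp
  · obtain ⟨σ, h2, h3⟩ := lifts_cycProd (flatten_nodup_of_perm hR)
    have h4 : σ n = n := h3 n (fun h => lt_irrefl _ (flatten_lt_of_perm hR _ h))
    refine Lifts.trace_mul_eq_zero
      (((lifts_tau (by omega)).mul (lifts_tau (by omega))).mul h2.neg) (esymm_mem_subSpan n r) ?_
    rw [Equiv.Perm.mul_apply, Equiv.Perm.mul_apply, h4, Equiv.swap_apply_left,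
      Equiv.swap_apply_of_ne_of_ne (by omega) (by omega)]
    omega

/-- The terms `i = j` of `jm n ^ 2` leave a rank that is too large for degree `r - 1`, so only
`esymm n r` on the other letters contributes. The sign `-1` is the coefficient of a cycle of length
one. -/
theorem coeffFormula_fixed (hR : R.flatten.Perm (List.range n)) (hodd : ∀ c ∈ R, Odd c.length)
    (ih : ∀ r, CoeffFormula n r) (r : ℕ) :
    (n + 1 = ([n] :: R).length + 2 * r →
      trace (cycProd ([n] :: R) * esymm (n + 1) r) = (([n] :: R).map cycleCoeff).prod) ∧
    (([n] :: R).length + 2 * r < n + 1 →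
      trace (cycProd ([n] :: R) * esymm (n + 1) r) = 0) := by
  have h1 : cycProd ([n] :: R) = -cycProd R := by
    rw [cycProd_cons]; simp [cyc]
  have h0 : ([n] :: R).length + 2 * r ≤ n + 1 →
      trace (cycProd ([n] :: R) * esymm (n + 1) r) = -trace (cycProd R * esymm n r) := by
    intro hlen
    simp only [List.length_cons] at hlen
    cases r with
    | zero => rw [esymm_zero_right, esymm_zero_right, h1]; simp
    | succ r =>
      rw [trace_mul_esymm_succ, Finset.sum_eq_zero, add_zero, h1, neg_mul, map_neg]
      intro i hi
      refine Finset.sum_eq_zero fun j hj => ?_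
      rw [trace_fixed hR (Finset.mem_range.1 hi) (Finset.mem_range.1 hj)]
      split_ifs
      · exact (ih r R hR hodd).2 (by omega)
      · rfl
  constructor
  · intro h
    rw [h0 h.ge, (ih r R hR hodd).1 (by simp at h; omega)]
    simp [cycleCoeff]
  · intro h
    rw [h0 h.le, (ih r R hR hodd).2 (by simp at h; omega), neg_zero]

variable {a : ℕ} {l : List ℕ}

/-- With this ordering of the factors a cycle sends its first letter to its last one. -/
theorem moved_apply (h : ((n :: (l ++ [a])) :: R).flatten.Nodup) :
    ∃ σ, Lifts (cycProd ((n :: (l ++ [a])) :: R)) σ ∧ σ n = a := by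
  rw [List.flatten_cons] at h
  have h0 := List.nodup_append.1 h
  have h1 : n ∉ R.flatten := fun hn => h0.2.2 n (by simp) n hn rfl
  have h2 := List.nodup_cons.1 h0.1
  obtain ⟨σ, h3, h4⟩ := lifts_cycProd h0.2.1
  have h5 : n ∉ l := fun hn => h2.1 (by simp [hn])
  have h6 : n ≠ a := fun hn => h2.1 (by simp [hn])
  have h7 : a ∉ l := fun hn => (List.nodup_append.1 h2.2).2.2 a hn a (by simp) rfl
  obtain ⟨τ, h8, h9⟩ := lifts_arm h5
  refine ⟨τ * Equiv.swap n a * σ, ?_, ?_⟩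
  · rw [cycProd_cons, cyc, arm_append, arm_singleton]
    exact (h8.mul (lifts_tau h6)).neg.mul h3
  · rw [Equiv.Perm.mul_apply, Equiv.Perm.mul_apply, h4 n h1, Equiv.swap_apply_left,
      h9 a (by simp [h6.symm, h7])]

/-- The product of cycles sends `n` to `a`, so the two transpositions must bring `a` back to `n`.
This requires `j ≠ a` and `i = a`. -/
theorem trace_moved_eq_zero (h : ((n :: (l ++ [a])) :: R).flatten.Nodup) {i j : ℕ} (hi : i < n)
    (hj : j < n) (hij : i ≠ a ∨ j = a) (r : ℕ) :
    trace (tau n i * tau n j * cycProd ((n :: (l ++ [a])) :: R) * esymm n r) = 0 := by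
  obtain ⟨σ, h1, h2⟩ := moved_apply h
  have hna : n ≠ a := fun hn => by simp [hn] at h
  refine Lifts.trace_mul_eq_zero
    (((lifts_tau (by omega)).mul (lifts_tau (by omega))).mul h1) (esymm_mem_subSpan n r) ?_
  rw [Equiv.Perm.mul_apply, Equiv.Perm.mul_apply, h2]
  by_cases hja : j = a
  · subst hja
    rw [Equiv.swap_apply_right, Equiv.swap_apply_left]
    omega
  · have hia : i ≠ a := by tauto
    rw [Equiv.swap_apply_of_ne_of_ne hna.symm (Ne.symm hja),
      Equiv.swap_apply_of_ne_of_ne hna.symm hia.symm]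
    exact hna.symm

theorem trace_moved_first (h : ((n :: (l ++ [a])) :: R).flatten.Nodup) (r : ℕ) :
    trace (cycProd ((n :: (l ++ [a])) :: R) * esymm n r) = 0 := by
  obtain ⟨σ, h1, h2⟩ := moved_apply h
  refine Lifts.trace_mul_eq_zero h1 (esymm_mem_subSpan n r) ?_
  have hna : n ≠ a := fun hn => by simp [hn] at h
  rw [h2]
  exact hna.symm

/-- Joining absorbs the cycle of `n` into another one, so `R.length` odd cycles remain on `n`
letters, and their rank exceeds `2 * r`. -/
theorem trace_join (h : ((l ++ [a]) ++ R.flatten).Perm (List.range n)) (hl : Odd l.length)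
    (hodd : ∀ c ∈ R, Odd c.length) {r : ℕ} (ih : CoeffFormula n r) (hr : R.length + 2 * r < n)
    {j : ℕ} (hj : j ∈ R.flatten) :
    trace (tau n a * tau n j * cycProd ((n :: (l ++ [a])) :: R) * esymm n r) = 0 := by
  obtain ⟨c, hc, hjc⟩ := List.mem_flatten.1 hj
  have hnd : ((l ++ [a]) ++ R.flatten).Nodup := h.nodup_iff.2 List.nodup_range
  have hlt : ∀ x ∈ (l ++ [a]) ++ R.flatten, x < n := fun x hx => List.mem_range.1 (h.mem_iff.1 hx)
  have hRnd : R.flatten.Nodup := List.Nodup.of_append_right hnd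
  obtain ⟨S, hS⟩ : ∃ S, R.Perm (c :: S) := ⟨_, List.perm_cons_erase hc⟩
  obtain ⟨m, hm, -, hcm⟩ := exists_cyc_eq ((List.nodup_flatten.1 hRnd).1 c hc) hjc
  have hcyc := hcm (hodd c hc)
  have hlen : m.length + 1 = c.length := hm.length_eq
  have hflat : R.flatten.Perm (j :: m ++ S.flatten) :=
    hS.flatten.trans (by rw [List.flatten_cons]; exact hm.symm.append_right _)
  have hjn : (n :: j :: (l ++ [a])).Nodup := by
    refine List.nodup_cons.2 ⟨?_, List.nodup_cons.2 ⟨?_, List.Nodup.of_append_left hnd⟩⟩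
    · intro hn
      rcases List.mem_cons.1 hn with rfl | hn
      · exact lt_irrefl _ (hlt n (List.mem_append_right _ hj))
      · exact lt_irrefl _ (hlt n (List.mem_append_left _ hn))
    · intro hj2
      exact (List.nodup_append.1 hnd).2.2 j hj2 j hj rfl
  have hW : tau n a * tau n j * cycProd ((n :: (l ++ [a])) :: R) =
      cycProd ((j :: (l ++ a :: m)) :: S) := by
    rw [cycProd_cons, cycProd_perm_of_odd hS hRnd hodd, cycProd_cons, cycProd_cons, hcyc]
    change tau n a * tau n j * (-arm n (l ++ [a]) * (-arm j m * cycProd S)) =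
      -arm j (l ++ a :: m) * cycProd S
    rw [← tau_tau_arm_join hjn hl]
    noncomm_ring
  rw [hW]
  refine (ih _ ?_ ?_).2 ?_
  · refine List.Perm.trans ?_ h
    refine List.Perm.trans ?_ (hflat.symm.append_left _)
    have h1 : ((j :: (l ++ a :: m)) :: S).flatten = j :: ((l ++ [a]) ++ (m ++ S.flatten)) := by
      simp
    rw [h1]
    exact List.perm_middle.symm
  · intro d hd
    rcases List.mem_cons.1 hd with rfl | hd
    · have h1 := hodd c hc
      rw [← hlen] at h1
      have h2 : (j :: (l ++ a :: m)).length = l.length + 1 + (m.length + 1) := by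
        simp only [List.length_cons, List.length_append]; ring
      rw [h2]
      exact (hl.add_odd odd_one).add_odd h1
    · exact hodd d (hS.mem_iff.2 (List.mem_cons_of_mem _ hd))
  · have h3 := hS.length_eq
    simp only [List.length_cons] at h3 ⊢
    omega

/-- The two pieces have lengths `p.length + 1` and `q.length + 1`, where `p.length` and `q.length`
have the same parity because `l.length` is odd. Even pieces are invisible to central elements; odd
pieces give two Catalan factors by induction. -/
theorem trace_split (h : ((l ++ [a]) ++ R.flatten).Perm (List.range n)) (hl : Odd l.length)
    (hodd : ∀ c ∈ R, Odd c.length) {r : ℕ} (ih : CoeffFormula n r)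
    {p : List ℕ} {j : ℕ} {q : List ℕ} (hlpq : l = p ++ j :: q) :
    (n = R.length + 2 * r + 2 →
      trace (tau n a * tau n j * cycProd ((n :: (l ++ [a])) :: R) * esymm n r) =
        if Even p.length then -(catalan (p.length / 2) *
          catalan ((l.length - 1) / 2 - p.length / 2) * (R.map cycleCoeff).prod : ℤ) else 0) ∧
    (R.length + 2 * r + 2 < n →
      trace (tau n a * tau n j * cycProd ((n :: (l ++ [a])) :: R) * esymm n r) = 0) := by
  have hnd : ((l ++ [a]) ++ R.flatten).Nodup := h.nodup_iff.2 List.nodup_range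
  have hlt : ∀ x ∈ (l ++ [a]) ++ R.flatten, x < n := fun x hx => List.mem_range.1 (h.mem_iff.1 hx)
  have hn : (n :: (p ++ j :: q ++ [a])).Nodup := by
    rw [← hlpq]
    refine List.nodup_cons.2 ⟨fun hn => ?_, List.Nodup.of_append_left hnd⟩
    exact lt_irrefl _ (hlt n (List.mem_append_left _ hn))
  have hperm : (((j :: p) :: (a :: q) :: R).flatten).Perm (List.range n) := by
    refine List.Perm.trans ?_ h
    rw [hlpq]
    simp only [List.flatten_cons]
    rw [← List.append_assoc]
    refine List.Perm.append_right _ ?_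
    rw [List.append_assoc]
    refine (List.perm_middle (l₁ := p)).symm.trans (List.Perm.append_left _ ?_)
    exact List.Perm.cons _ (List.perm_append_singleton a q).symm
  have hlen : l.length = p.length + q.length + 1 := by
    rw [hlpq]; simp only [List.length_cons, List.length_append]; ring
  have hW : tau n a * tau n j * cycProd ((n :: (l ++ [a])) :: R) =
      sg q.length • -(cycProd ((j :: p) :: (a :: q) :: R)) := by
    rw [cycProd_cons, cycProd_cons, cycProd_cons]
    change tau n a * tau n j * (-arm n (l ++ [a]) * cycProd R) =
      sg q.length • -(-arm j p * (-arm a q * cycProd R))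
    rw [hlpq, ← mul_assoc, mul_neg, tau_tau_arm_split hn, ← smul_neg, smul_mul_assoc]
    congr 1
    noncomm_ring
  rw [hW]
  rcases Nat.even_or_odd p.length with hp | hp
  · have hq : Even q.length := by
      rw [hlen] at hl
      by_contra h1
      rw [Nat.not_even_iff_odd] at h1
      exact (Nat.not_even_iff_odd.2 hl) ((hp.add_odd h1).add_odd odd_one)
    have hodd' : ∀ c ∈ (j :: p) :: (a :: q) :: R, Odd c.length := by
      intro c hc
      rcases List.mem_cons.1 hc with rfl | hc
      · exact hp.add_odd odd_one
      rcases List.mem_cons.1 hc with rfl | hc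
      · exact hq.add_odd odd_one
      · exact hodd c hc
    have ih' := ih _ hperm hodd'
    rw [sg, hq.neg_one_pow, one_smul, if_pos hp, neg_mul, map_neg]
    constructor
    · intro hn
      rw [ih'.1 (by simp only [List.length_cons]; omega)]
      simp only [List.map_cons, List.prod_cons, cycleCoeff, List.length_cons, Nat.add_sub_cancel]
      have : (l.length - 1) / 2 - p.length / 2 = q.length / 2 := by
        obtain ⟨s, hs⟩ := hp
        obtain ⟨t, ht⟩ := hq
        omega
      rw [this]
      ring
    · intro hn
      rw [ih'.2 (by simp only [List.length_cons]; omega), neg_zero]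
  · have hz : trace (cycProd ((j :: p) :: (a :: q) :: R) * esymm n r) = 0 :=
      trace_cycProd_mul_eq_zero (flatten_nodup_of_perm hperm) (flatten_lt_of_perm hperm)
        (c := j :: p) (by simp) (by simp) (hp.add_odd odd_one) (central_esymm n r)
    have hz' : trace (sg q.length • -(cycProd ((j :: p) :: (a :: q) :: R)) * esymm n r) = 0 := by
      rw [smul_mul_assoc, neg_mul]
      rcases units_smul_eq (sg q.length)
        (-(cycProd ((j :: p) :: (a :: q) :: R) * esymm n r)) with h' | h' <;>
        rw [h'] <;> simp [hz]
    rw [if_neg (Nat.not_even_iff_odd.2 hp)]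
    exact ⟨fun _ => hz', fun _ => hz'⟩

/-- Only `i = a` with `j` in `l` survives, and the sum over the even positions of `l` is the Catalan
recursion. In degree zero the equality case is impossible, since a cycle of length at least three
has positive rank. -/
theorem coeffFormula_moved (h : ((l ++ [a]) ++ R.flatten).Perm (List.range n)) (hl : Odd l.length)
    (hodd : ∀ c ∈ R, Odd c.length) (ih : ∀ r, CoeffFormula n r) (r : ℕ) :
    (n + 1 = ((n :: (l ++ [a])) :: R).length + 2 * r →
      trace (cycProd ((n :: (l ++ [a])) :: R) * esymm (n + 1) r) =
        (((n :: (l ++ [a])) :: R).map cycleCoeff).prod) ∧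
    (((n :: (l ++ [a])) :: R).length + 2 * r < n + 1 →
      trace (cycProd ((n :: (l ++ [a])) :: R) * esymm (n + 1) r) = 0) := by
  have hnd : ((l ++ [a]) ++ R.flatten).Nodup := h.nodup_iff.2 List.nodup_range
  have hlt : ∀ x ∈ (l ++ [a]) ++ R.flatten, x < n := fun x hx => List.mem_range.1 (h.mem_iff.1 hx)
  have hnd' : ((n :: (l ++ [a])) :: R).flatten.Nodup := by
    rw [List.flatten_cons]
    exact List.nodup_cons.2 ⟨fun hn => lt_irrefl _ (hlt n hn), hnd⟩
  have han : a < n := hlt a (by simp)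
  have hlenR : R.length + 2 ≤ n := by
    have h1 := h.length_eq
    have h2 : R.length ≤ R.flatten.length := by
      clear h hnd hlt hnd' h1
      induction R with
      | nil => simp
      | cons c R ihR =>
        have := ihR (fun d hd => hodd d (by simp [hd]))
        have := (hodd c (by simp)).pos
        simp only [List.flatten_cons, List.length_append, List.length_cons]
        omega
    have := hl.pos
    simp only [List.length_append, List.length_range, List.length_singleton] at h1
    omega
  cases r with
  | zero =>
    refine ⟨fun h1 => ?_, fun _ => ?_⟩
    · simp only [List.length_cons] at h1
      omega
    · have := trace_moved_first (n := n) hnd' 0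
      rwa [esymm_zero_right] at this ⊢
  | succ r =>
    have hsum : R.length + 2 * r + 2 ≤ n →
        trace (cycProd ((n :: (l ++ [a])) :: R) * esymm (n + 1) (r + 1)) =
        (l.map fun j =>
          trace (tau n a * tau n j * cycProd ((n :: (l ++ [a])) :: R) * esymm n r)).sum := by
      intro hlen
      rw [trace_mul_esymm_succ, trace_moved_first hnd', zero_add,
        Finset.sum_eq_single a, sum_range_eq_of_perm h]
      · simp only [List.map_append, List.sum_append, List.map_cons, List.map_nil, List.sum_cons,
          List.sum_nil]
        rw [trace_moved_eq_zero hnd' han han (Or.inr rfl), List.sum_eq_zero (l := R.flatten.map _)]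
        · simp
        · intro x hx
          obtain ⟨j, hj, rfl⟩ := List.mem_map.1 hx
          exact trace_join h hl hodd (ih r) (by omega) hj
      · intro i hi hia
        refine Finset.sum_eq_zero fun j hj => ?_
        exact trace_moved_eq_zero hnd' (Finset.mem_range.1 hi) (Finset.mem_range.1 hj)
          (Or.inl hia) r
      · intro ha
        exact absurd (Finset.mem_range.2 han) ha
    constructor
    · intro hlen
      simp only [List.length_cons] at hlen
      rw [hsum (by omega), sum_map_of_append l _ (fun k => if Even k then
          -(catalan (k / 2) * catalan ((l.length - 1) / 2 - k / 2) *
            (R.map cycleCoeff).prod : ℤ) else 0)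
        (fun p j q hpq => (trace_split h hl hodd (ih r) hpq).1 (by omega))]
      obtain ⟨s, hs⟩ := hl
      rw [hs, sum_range_odd (fun k => -(catalan k * catalan ((2 * s + 1 - 1) / 2 - k) *
        (R.map cycleCoeff).prod : ℤ)), show (2 * s + 1 - 1) / 2 = s by omega,
        Finset.sum_neg_distrib, ← Finset.sum_mul, sum_catalan]
      simp only [List.map_cons, List.prod_cons, cycleCoeff, List.length_cons, List.length_append,
        hs, List.length_nil]
      rw [show (2 * s + 1 + (0 + 1) + 1 - 1) / 2 = s + 1 by omega]
      ring
    · intro hlen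
      simp only [List.length_cons] at hlen
      rw [hsum (by omega)]
      refine List.sum_eq_zero fun x hx => ?_
      obtain ⟨j, hj, rfl⟩ := List.mem_map.1 hx
      obtain ⟨p, q, hpq⟩ := List.append_of_mem hj
      exact (trace_split h hl hodd (ih r) hpq).2 (by omega)

end step

theorem coeffFormula (n : ℕ) : ∀ r, CoeffFormula n r := by
  induction n with
  | zero =>
    intro r C hC hodd
    have hC' : C = [] := by
      rw [List.eq_nil_iff_forall_not_mem]
      intro c hc
      obtain ⟨x, hx⟩ := List.exists_mem_of_length_pos (hodd c hc).pos
      have := flatten_lt_of_perm hC x (List.mem_flatten.2 ⟨c, hc, hx⟩)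
      omega
    subst hC'
    refine ⟨fun h => ?_, fun h => by omega⟩
    have hr : r = 0 := by simp at h; omega
    subst hr
    rw [esymm_zero_right, cycProd_nil, mul_one, ← map_one of, trace_of, delta_one]
    rfl
  | succ n ih =>
    intro r C hC hodd
    have hnd := flatten_nodup_of_perm hC
    have hmem : n ∈ C.flatten := hC.mem_iff.2 (List.mem_range.2 (Nat.lt_succ_self n))
    obtain ⟨c, hc, hnc⟩ := List.mem_flatten.1 hmem
    obtain ⟨R, hR⟩ : ∃ R, C.Perm (c :: R) := ⟨_, List.perm_cons_erase hc⟩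
    obtain ⟨m, hm, -, hcm⟩ := exists_cyc_eq ((List.nodup_flatten.1 hnd).1 c hc) hnc
    have hcyc := hcm (hodd c hc)
    have hlen : m.length + 1 = c.length := hm.length_eq
    have hW : cycProd C = cycProd ((n :: m) :: R) := by
      rw [cycProd_perm_of_odd hR hnd hodd, cycProd_cons, cycProd_cons, hcyc]
    have hoddR : ∀ d ∈ R, Odd d.length := fun d hd => hodd d (hR.mem_iff.2 (by simp [hd]))
    have hcoeff : (C.map cycleCoeff).prod = (((n :: m) :: R).map cycleCoeff).prod := by
      rw [(hR.map cycleCoeff).prod_eq]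
      simp [cycleCoeff, ← hlen]
    have hflat : (m ++ R.flatten).Perm (List.range n) := by
      have h1 : (n :: (m ++ R.flatten)).Perm (List.range (n + 1)) := by
        refine List.Perm.trans ?_ (hR.flatten.symm.trans hC)
        rw [List.flatten_cons]
        exact hm.append_right _
      rw [List.range_succ] at h1
      exact List.Perm.cons_inv (h1.trans (List.perm_append_singleton n _))
    have hClen : C.length = ((n :: m) :: R).length := by simp [hR.length_eq]
    rw [hW, hcoeff, hClen]
    rcases List.eq_nil_or_concat' m with rfl | ⟨l, a, rfl⟩
    · exact coeffFormula_fixed hflat hoddR ih r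
    · refine coeffFormula_moved hflat ?_ hoddR ih r
      have h1 := hodd c hc
      rw [← hlen] at h1
      simp only [List.length_append, List.length_singleton] at h1
      by_contra h2
      rw [Nat.not_odd_iff_even] at h2
      exact (Nat.not_even_iff_odd.2 h1) ((h2.add_odd odd_one).add_odd odd_one)

end SpinRing

namespace SpinRing
open SpinCover

/-! ### Normal forms -/

theorem mem_sub_zero {g : SpinCover} (hg : g ∈ sub 0) : g = 1 ∨ g = z := by
  induction hg using Subgroup.closure_induction with
  | mem x hx =>
    rcases hx with rfl | ⟨k, hk, rfl⟩
    · exact Or.inr rfl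
    · omega
  | one => exact Or.inl rfl
  | mul a b _ _ ha hb =>
    rcases ha with rfl | rfl <;> rcases hb with rfl | rfl <;> simp [z_mul_z]
  | inv a _ ha => rcases ha with rfl | rfl <;> simp [z_inv]

/-- The coset decomposition of `sub (n + 1)` by the image of the last letter. The union of the
cosets is stable under left multiplication by the generators, and `z` and `z * t k` cover the
inverses. -/
theorem mem_sub_succ {n : ℕ} {g : SpinCover} (hg : g ∈ sub (n + 1)) :
    g ∈ sub n ∨ ∃ j < n, ∃ s ∈ sub n, g = transp j n * s := by
  have hz : ∀ y : SpinCover, (y ∈ sub n ∨ ∃ j < n, ∃ s ∈ sub n, y = transp j n * s) →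
      (z * y ∈ sub n ∨ ∃ j < n, ∃ s ∈ sub n, z * y = transp j n * s) := by
    rintro y (hy | ⟨j, hj, s, hs, rfl⟩)
    · exact Or.inl (mul_mem (z_mem_sub n) hy)
    · exact Or.inr ⟨j, hj, z * s, mul_mem (z_mem_sub n) hs, by
        rw [← mul_assoc, z_mul_comm, mul_assoc]⟩
  have ht : ∀ (k : ℕ) (y : SpinCover), k + 1 < n + 1 →
      (y ∈ sub n ∨ ∃ j < n, ∃ s ∈ sub n, y = transp j n * s) →
      (t k * y ∈ sub n ∨ ∃ j < n, ∃ s ∈ sub n, t k * y = transp j n * s) := by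
    intro k y hk hy
    rcases Nat.lt_or_eq_of_le (Nat.le_of_lt_succ hk) with hk' | rfl
    · rcases hy with hy | ⟨j, hj, s, hs, rfl⟩
      · exact Or.inl (mul_mem (t_mem_sub hk') hy)
      · refine Or.inr ⟨Equiv.swap k (k + 1) j, ?_, z * (t k * s),
          mul_mem (z_mem_sub n) (mul_mem (t_mem_sub hk') hs), of_injective ?_⟩
        · rw [← perm_t]; exact perm_lt_of_mem_sub (t_mem_sub hk') hj
        · have h := gen_tau k (i := j) (j := n) (by omega)
          rw [Equiv.swap_apply_of_ne_of_ne (by omega : n ≠ k) (by omega : n ≠ k + 1)] at h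
          simp only [map_mul, of_z]
          rw [← mul_assoc]
          change gen k * tau j n * of s = tau _ n * (-1 * (gen k * of s))
          rw [h]
          noncomm_ring
    · rcases hy with hy | ⟨j, hj, s, hs, rfl⟩
      · exact Or.inr ⟨k, by omega, y, hy, by rw [transp_self_succ]⟩
      · rcases Nat.lt_or_eq_of_le (Nat.le_of_lt_succ hj) with hj' | rfl
        · refine Or.inr ⟨j, by omega, z * (transp k j * s),
            mul_mem (z_mem_sub _) (mul_mem (transp_mem_sub (by omega) (by omega) (by omega)) hs),
            of_injective ?_⟩
          have h := tau_mul_tau_apply (a := j) (b := k + 1) (i := k) (j := j) (by omega) (by omega)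
          rw [Equiv.swap_apply_left, Equiv.swap_apply_of_ne_of_ne (by omega) (by omega),
            tau_self_succ] at h
          simp only [map_mul, of_z]
          change gen k * (tau j (k + 1) * of s) = tau j (k + 1) * (-1 * (tau k j * of s))
          calc gen k * (tau j (k + 1) * of s) = -(tau j (k + 1) * tau k j) * of s := by
                rw [h]; noncomm_ring
            _ = _ := by noncomm_ring
        · left
          have h : t j * (transp j (j + 1) * s) = z * s := by
            rw [transp_self_succ, ← mul_assoc, t_mul_t]
          rw [h]
          exact mul_mem (z_mem_sub _) hs
  induction hg using Subgroup.closure_induction_left with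
  | one => exact Or.inl (one_mem _)
  | mul_left x hx y _ ih =>
    rcases hx with rfl | ⟨k, hk, rfl⟩
    · exact hz y ih
    · exact ht k y hk ih
  | inv_mul_cancel x hx y _ ih =>
    rcases hx with rfl | ⟨k, hk, rfl⟩
    · rw [z_inv]; exact hz y ih
    · rw [t_inv, mul_assoc]; exact hz _ (ht k y hk ih)

theorem finite_sub (n : ℕ) : (sub n : Set SpinCover).Finite := by
  induction n with
  | zero =>
    refine Set.Finite.subset (Set.toFinite {1, z}) fun g hg => ?_
    exact mem_sub_zero hg
  | succ n ih =>
    refine Set.Finite.subset (ih.union ((Set.finite_Iio n).biUnion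
      (t := fun j => (fun s => transp j n * s) '' (sub n : Set SpinCover)) fun j _ => ih.image _)) ?_
    intro g hg
    rcases mem_sub_succ hg with h | ⟨j, hj, s, hs, rfl⟩
    · exact Or.inl h
    · exact Or.inr (Set.mem_biUnion (Set.mem_Iio.2 hj) ⟨s, hs, rfl⟩)

/-- Every element is up to sign a product of cycles. -/
theorem exists_cycProd {n : ℕ} {g : SpinCover} (hg : g ∈ sub n) :
    ∃ C : List (List ℕ), C.flatten.Perm (List.range n) ∧ (∀ c ∈ C, c ≠ []) ∧
      ∃ ε : ℤˣ, of g = ε • cycProd C := by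
  induction n generalizing g with
  | zero =>
    refine ⟨[], by simp, by simp, ?_⟩
    rcases mem_sub_zero hg with rfl | rfl
    · exact ⟨1, by simp⟩
    · exact ⟨-1, by simp [of_z]⟩
  | succ n ih =>
    rcases mem_sub_succ hg with h | ⟨j, hj, s, hs, rfl⟩
    · obtain ⟨C, h1, h2, ε, h3⟩ := ih h
      refine ⟨[n] :: C, ?_, ?_, -ε, ?_⟩
      · rw [List.flatten_cons, List.range_succ]
        exact (List.perm_append_singleton n _).symm.trans (h1.append_right _)
      · simpa using h2
      · rw [h3, cycProd_cons]; simp [cyc]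
    · obtain ⟨C, h1, h2, ε, h3⟩ := ih hs
      have hnd := flatten_nodup_of_perm h1
      obtain ⟨c, hc, hjc⟩ := List.mem_flatten.1 (h1.mem_iff.2 (List.mem_range.2 hj))
      obtain ⟨R, hR⟩ : ∃ R, C.Perm (c :: R) := ⟨_, List.perm_cons_erase hc⟩
      obtain ⟨m, hm, ⟨δ, hδ⟩, -⟩ := exists_cyc_eq ((List.nodup_flatten.1 hnd).1 c hc) hjc
      obtain ⟨η, hη⟩ := cycProd_perm hR hnd
      -- Left multiplication by the lift of `(j, n)` inserts `n` directly after `j` in the cycle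
      -- started at `j`.
      refine ⟨(j :: n :: m) :: R, ?_, ?_, ε * η * δ, ?_⟩
      · rw [List.flatten_cons, List.range_succ]
        have h4 : (j :: m ++ R.flatten).Perm (List.range n) := by
          refine List.Perm.trans ?_ (hR.flatten.symm.trans h1)
          rw [List.flatten_cons]
          exact hm.append_right _
        refine List.Perm.trans ?_ (h4.append_right [n])
        refine List.Perm.trans ?_ (List.perm_append_singleton n _).symm
        exact List.Perm.swap _ _ _
      · intro d hd
        rcases List.mem_cons.1 hd with rfl | hd
        · simp
        · exact h2 d (hR.mem_iff.2 (List.mem_cons_of_mem _ hd))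
      · rw [map_mul, h3, hη, cycProd_cons, cycProd_cons, hδ]
        change tau j n * (ε • η • (-(δ • arm j m) * cycProd R)) =
          (ε * η * δ) • (-arm j (n :: m) * cycProd R)
        rw [arm_cons]
        simp only [mul_smul, mul_smul_comm, smul_mul_assoc, neg_mul, mul_neg, smul_neg, mul_assoc]

theorem of_mul_tau' (g : SpinCover) {i j : ℕ} (h : i ≠ j) :
    of g * tau i j = sgn g • (tau (perm g i) (perm g j) * of g) := by
  rw [of_mul_tau g h, Units.smul_def]

theorem of_mul_cyc (g : SpinCover) {c : List ℕ} (hc : c.Nodup) :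
    of g * cyc c = sgn g ^ (c.length - 1) • (cyc (c.map (perm g)) * of g) := by
  cases c with
  | nil => simp [cyc]
  | cons a l =>
    have ha := (List.nodup_cons.1 hc).1
    clear hc
    change of g * arm a l = sgn g ^ l.length • (arm (perm g a) (l.map (perm g)) * of g)
    induction l with
    | nil => simp
    | cons b l ih =>
      simp only [List.mem_cons, not_or] at ha
      rw [arm_cons, ← mul_assoc, of_mul_tau' g ha.1, smul_mul_assoc, mul_assoc, ih ha.2,
        mul_smul_comm, smul_smul, ← mul_assoc, List.map_cons, arm_cons, List.length_cons, pow_succ']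

/-- A cycle of odd length is a product of an even number of transpositions, so the conjugation signs
cancel. -/
theorem of_mul_cycProd (g : SpinCover) {C : List (List ℕ)} (hC : ∀ c ∈ C, c.Nodup)
    (hodd : ∀ c ∈ C, Odd c.length) :
    of g * cycProd C = cycProd (C.map (List.map (perm g))) * of g := by
  induction C with
  | nil => simp
  | cons c C ih =>
    have h1 : Even (c.length - 1) := Nat.Odd.sub_odd (hodd c (by simp)) odd_one
    have h2 : sgn g ^ (c.length - 1) = 1 := by
      rcases Int.units_eq_one_or (sgn g) with h | h <;> rw [h]
      · simp
      · exact h1.neg_one_pow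
    rw [cycProd_cons, ← mul_assoc, mul_neg, of_mul_cyc g (hC c (by simp)), h2, one_smul, ← neg_mul,
      mul_assoc, ih (fun d hd => hC d (by simp [hd])) (fun d hd => hodd d (by simp [hd])),
      ← mul_assoc, List.map_cons, cycProd_cons]

/-- The letters are put in place one after another. The correcting transposition exchanges
`l.length` with the current image of `a`, both outside the part already arranged. -/
theorem exists_map_eq_range {n : ℕ} (l : List ℕ) (hl : l.Nodup) (hn : ∀ x ∈ l, x < n) :
    ∃ w ∈ sub n, l.map (perm w) = List.range l.length := by
  induction l using List.reverseRecOn with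
  | nil => exact ⟨1, one_mem _, rfl⟩
  | append_singleton l a ih =>
    have hl' := List.nodup_append.1 hl
    obtain ⟨w, hw, h1⟩ := ih hl'.1 (fun x hx => hn x (by simp [hx]))
    have ha : a < n := hn a (by simp)
    have hlen : l.length < n := by
      have h2 : (l ++ [a]).Subperm (List.range n) :=
        List.subperm_of_subset hl fun x hx => List.mem_range.2 (hn x hx)
      have := h2.length_le
      simp at this
      omega
    have hb : l.length ≤ perm w a := by
      by_contra! hb
      have h2 : perm w a ∈ l.map (perm w) := by rw [h1]; exact List.mem_range.2 hb
      obtain ⟨x, hx, hxa⟩ := List.mem_map.1 h2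
      exact hl'.2.2 x hx a (by simp) ((perm w).injective hxa)
    have hbn := perm_lt_of_mem_sub hw ha
    by_cases hk : perm w a = l.length
    · refine ⟨w, hw, ?_⟩
      rw [List.map_append, h1, List.map_singleton, hk, List.length_append, List.length_singleton,
        List.range_succ]
    · refine ⟨transp l.length (perm w a) * w,
        mul_mem (transp_mem_sub hlen hbn (Ne.symm hk)) hw, ?_⟩
      have h2 : perm (transp l.length (perm w a) * w) =
          Equiv.swap l.length (perm w a) * perm w := by
        rw [map_mul, perm_transp (Ne.symm hk)]
      rw [h2, List.map_append, List.map_singleton, Equiv.Perm.mul_apply, Equiv.swap_apply_right,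
        List.length_append, List.length_singleton, List.range_succ]
      congr 1
      rw [Equiv.Perm.coe_mul, ← List.map_map, h1]
      conv_rhs => rw [← List.map_id (List.range l.length)]
      refine List.map_congr_left fun x hx => ?_
      have := List.mem_range.1 hx
      exact Equiv.swap_apply_of_ne_of_ne (by omega) (by omega)

/-! ### The distinguished elements -/

/-- Consecutive blocks of letters of lengths `p₁ + 1, p₂ + 1, …`, starting from `a`. -/
def blocks : ℕ → List ℕ → List (List ℕ)
  | _, [] => []
  | a, p :: ps => List.range' a (p + 1) :: blocks (a + p + 1) ps

theorem flatten_blocks (a : ℕ) (ps : List ℕ) :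
    (blocks a ps).flatten = List.range' a (ps.sum + ps.length) := by
  induction ps generalizing a with
  | nil => rfl
  | cons p ps ih =>
    rw [blocks, List.flatten_cons, ih, add_assoc a p 1, List.range'_append_1, List.sum_cons,
      List.length_cons]
    congr 1
    ring

theorem length_blocks (a : ℕ) (ps : List ℕ) : (blocks a ps).length = ps.length := by
  induction ps generalizing a with
  | nil => rfl
  | cons p ps ih => rw [blocks, List.length_cons, ih, List.length_cons]

theorem map_length_blocks (a : ℕ) (ps : List ℕ) :
    (blocks a ps).map List.length = ps.map (· + 1) := by
  induction ps generalizing a with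
  | nil => rfl
  | cons p ps ih => rw [blocks, List.map_cons, ih, List.map_cons, List.length_range']

theorem length_of_mem_blocks {a : ℕ} {ps : List ℕ} {c : List ℕ} (hc : c ∈ blocks a ps) :
    ∃ p ∈ ps, c.length = p + 1 := by
  have h : c.length ∈ (blocks a ps).map List.length := List.mem_map.2 ⟨c, hc, rfl⟩
  rw [map_length_blocks] at h
  obtain ⟨p, hp, h⟩ := List.mem_map.1 h
  exact ⟨p, hp, h.symm⟩

/-- Consecutive letters cut into non-empty pieces are determined by the lengths of the pieces. -/
theorem eq_blocks {D : List (List ℕ)} (hD : ∀ c ∈ D, c ≠ []) {a : ℕ}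
    (h : D.flatten = List.range' a D.flatten.length) :
    D = blocks a (D.map fun c => c.length - 1) := by
  induction D generalizing a with
  | nil => rfl
  | cons c D ih =>
    have hc : c.length - 1 + 1 = c.length :=
      Nat.sub_add_cancel (List.length_pos_of_ne_nil (hD c (by simp)))
    rw [List.flatten_cons, List.length_append, ← List.range'_append_1] at h
    obtain ⟨h1, h2⟩ := List.append_inj h (by simp)
    rw [List.map_cons, blocks, add_assoc, hc, ← h1]
    congr 1
    exact ih (fun d hd => hD d (by simp [hd])) h2

/-- Pushing the leading `tau a n` through the word turns each `tau b n` into `tau a b`; the two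
copies of `tau a n` then meet and give `-1`. This is the origin of the minus sign in `cycProd`, and
the order of the letters is reversed. -/
theorem of_cycle {n a : ℕ} {l : List ℕ} (ha : a < n) (hal : a ∉ l) (hl : ∀ x ∈ l, x < n) :
    of (cycle n (a :: l)) = -arm a l.reverse := by
  have key : ∀ l : List ℕ, (∀ x ∈ l, x < n) → a ∉ l →
      tau a n * of (l.map (x n)).prod = arm a l * tau a n := by
    intro l
    induction l with
    | nil => simp
    | cons b l ih =>
      intro hl hal
      simp only [List.mem_cons, forall_eq_or_imp, not_or] at hl hal
      have h := tau_mul_tau_apply (a := a) (b := n) (i := b) (j := n) (by omega) (by omega)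
      rw [Equiv.swap_apply_right, Equiv.swap_apply_of_ne_of_ne (Ne.symm hal.1) (by omega),
        tau_swap hal.1, neg_mul, neg_neg] at h
      rw [List.map_cons, List.prod_cons, map_mul, x_eq_transp hl.1]
      change tau a n * (tau b n * _) = _
      rw [← mul_assoc, h, mul_assoc, ih hl.2 hal.2, arm_cons, mul_assoc]
  cases l with
  | nil => simp [cycle, of_z]
  | cons b l =>
    have h1 := key (b :: l).reverse (fun x hx => hl x (List.mem_reverse.1 hx))
      (fun h => hal (List.mem_reverse.1 h))
    change of (x n a * ((b :: l).reverse.map (x n)).prod * x n a) = _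
    rw [map_mul, map_mul, x_eq_transp ha]
    change tau a n * _ * tau a n = _
    rw [h1, mul_assoc, tau_mul_self (by omega), mul_neg, mul_one]

theorem arm_reverse_mul_arm {a : ℕ} {l : List ℕ} (h : a ∉ l) :
    arm a l.reverse * arm a l = sg l.length • 1 := by
  induction l with
  | nil => simp
  | cons b l ih =>
    simp only [List.mem_cons, not_or] at h
    rw [List.reverse_cons, arm_append, arm_singleton, arm_cons, mul_assoc, ← mul_assoc (tau a b),
      tau_mul_self h.1, neg_one_mul, mul_neg, ih h.2, List.length_cons, sg_succ_smul]

theorem blocks_nodup (a : ℕ) (ps : List ℕ) : (blocks a ps).flatten.Nodup := by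
  rw [flatten_blocks]; exact List.nodup_range'

/-- The defining cycles and `cycProd` use opposite orders of letters, so they are mutually inverse;
even parts make the reversal sign trivial. Moving the first block to the end lets the product
collapse from the inside. -/
theorem of_cycles_mul {n a : ℕ} {ps : List ℕ} (hps : ∀ p ∈ ps, Even p)
    (hn : a + ps.sum + ps.length ≤ n) :
    of (cycles n a ps) * cycProd (blocks a ps) = 1 := by
  induction ps generalizing a with
  | nil => simp [cycles, blocks]
  | cons p ps ih =>
    have hnd := blocks_nodup a (p :: ps)
    have hodd : ∀ c ∈ blocks a (p :: ps), Odd c.length := by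
      intro c hc
      obtain ⟨q, hq, h⟩ := length_of_mem_blocks hc
      rw [h]; exact (hps q hq).add_odd odd_one
    simp only [List.sum_cons, List.length_cons] at hn
    have h1 := cycProd_perm_of_odd
      (List.perm_append_singleton (List.range' a (p + 1)) (blocks (a + p + 1) ps)).symm hnd hodd
    change of (cycle n (List.range' a (p + 1)) * cycles n (a + p + 1) ps) *
      cycProd (List.range' a (p + 1) :: blocks (a + p + 1) ps) = 1
    rw [h1, cycProd, List.map_append, List.prod_append, map_mul, mul_assoc,
      ← mul_assoc (of (cycles _ _ _))]
    change _ * (_ * cycProd _ * _) = _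
    rw [ih (fun q hq => hps q (by simp [hq])) (by omega), one_mul, List.map_singleton,
      List.prod_singleton, List.range'_succ, of_cycle]
    · change -arm a _ * -arm a _ = 1
      rw [neg_mul_neg, arm_reverse_mul_arm, List.length_range', sg,
        (hps p (by simp)).neg_one_pow, one_smul]
      simp [List.mem_range'_1]
    · omega
    · simp [List.mem_range'_1]
    · intro x hx
      rw [List.mem_range'_1] at hx
      omega

end SpinRing

/-! ### Even partitions -/

namespace EvenPartition
open SpinCover SpinRing

variable {m : ℕ}

/-- The parts in decreasing order. -/
def partList (p : EvenPartition m) : List ℕ := p.1.parts.sort (· ≥ ·)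

theorem coe_partList (p : EvenPartition m) : (p.partList : Multiset ℕ) = p.1.parts :=
  Multiset.sort_eq _ _

theorem mem_partList (p : EvenPartition m) {i : ℕ} : i ∈ p.partList ↔ i ∈ p.1.parts :=
  Multiset.mem_sort _

theorem even_of_mem_partList (p : EvenPartition m) {i : ℕ} (hi : i ∈ p.partList) : Even i :=
  p.2 i (p.mem_partList.1 hi)

theorem sum_partList (p : EvenPartition m) : p.partList.sum = m := by
  rw [← Multiset.sum_coe, coe_partList, p.1.parts_sum]

theorem length_partList (p : EvenPartition m) : p.partList.length = p.length := by
  rw [← Multiset.coe_card, coe_partList, length]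

theorem rep_eq (n : ℕ) (p : EvenPartition m) : p.rep n = cycles n 0 p.partList := rfl

theorem of_rep_inv {n : ℕ} {p : EvenPartition m} (h : m + p.length ≤ n) :
    of (p.rep n)⁻¹ = cycProd (blocks 0 p.partList) := by
  have h1 := of_cycles_mul (n := n) (a := 0) (ps := p.partList)
    (fun i hi => p.even_of_mem_partList hi) (by
      rw [sum_partList, length_partList]; omega)
  rw [← rep_eq] at h1
  calc of (p.rep n)⁻¹ = of (p.rep n)⁻¹ * (of (p.rep n) * cycProd (blocks 0 p.partList)) := by
        rw [h1, mul_one]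
    _ = _ := by rw [← mul_assoc, of_inv_mul, one_mul]

/-- The coefficient of a class sum in the top-degree part of an elementary symmetric function. -/
def coeff (p : EvenPartition m) : ℤ := (p.1.parts.map fun i => -(catalan (i / 2) : ℤ)).prod

/-- Non-vanishing of the coefficient is what later shows that an even class does not meet its
`z`-multiple. -/
theorem coeff_ne_zero (p : EvenPartition m) : p.coeff ≠ 0 := by
  refine Multiset.prod_ne_zero fun h => ?_
  obtain ⟨i, -, hi⟩ := Multiset.mem_map.1 h
  have h1 := succ_mul_catalan_eq_centralBinom (i / 2)
  have h2 := Nat.centralBinom_pos (i / 2)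
  have h3 : catalan (i / 2) = 0 := by simpa using hi
  rw [h3, mul_zero] at h1
  omega

theorem map_cycleCoeff_blocks (p : EvenPartition m) :
    ((blocks 0 p.partList).map cycleCoeff).prod = p.coeff := by
  have h : (blocks 0 p.partList).map cycleCoeff =
      ((blocks 0 p.partList).map List.length).map fun i => -(catalan ((i - 1) / 2) : ℤ) := by
    rw [List.map_map]; rfl
  rw [h, map_length_blocks, List.map_map, coeff, ← coe_partList, Multiset.map_coe,
    Multiset.prod_coe]
  rfl

theorem odd_of_mem_blocks (p : EvenPartition m) {c : List ℕ} (hc : c ∈ blocks 0 p.partList) :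
    Odd c.length := by
  obtain ⟨i, hi, h⟩ := length_of_mem_blocks hc
  rw [h]
  exact (p.even_of_mem_partList hi).add_odd odd_one

/-- The blocks of a partition, together with the remaining letters below `n`. -/
def fullBlocks (n : ℕ) (p : EvenPartition m) : List (List ℕ) :=
  blocks 0 p.partList ++ (List.range' (m + p.length) (n - (m + p.length))).map fun i => [i]

theorem flatten_map_singleton (l : List ℕ) : (l.map fun i => [i]).flatten = l := by
  induction l with
  | nil => rfl
  | cons a l ih => rw [List.map_cons, List.flatten_cons, ih]; rfl

theorem flatten_fullBlocks {n : ℕ} {p : EvenPartition m} (h : m + p.length ≤ n) :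
    (p.fullBlocks n).flatten = List.range n := by
  rw [fullBlocks, List.flatten_append, flatten_blocks, flatten_map_singleton, sum_partList,
    length_partList, List.range_eq_range']
  rw [← Nat.add_sub_cancel' h]
  conv_rhs => rw [← List.range'_append_1]
  simp

theorem odd_of_mem_fullBlocks {n : ℕ} (p : EvenPartition m) {c : List ℕ}
    (hc : c ∈ p.fullBlocks n) : Odd c.length := by
  rcases List.mem_append.1 hc with hc | hc
  · exact p.odd_of_mem_blocks hc
  · obtain ⟨i, -, rfl⟩ := List.mem_map.1 hc
    exact odd_one

theorem cycProd_singletons (l : List ℕ) : cycProd (l.map fun i => [i]) = sg l.length • 1 := by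
  induction l with
  | nil => simp
  | cons a l ih =>
    rw [List.map_cons, cycProd_cons, ih, List.length_cons, sg_succ_smul]
    simp [cyc]

theorem cycProd_append (C D : List (List ℕ)) : cycProd (C ++ D) = cycProd C * cycProd D := by
  simp [cycProd]

theorem trace_units_smul (ε : ℤˣ) (a : SpinRing) : trace (ε • a) = ε * trace a := by
  rcases Int.units_eq_one_or ε with rfl | rfl <;> simp

/-- The letters not used by the distinguished element are added as cycles of length one. They
contribute the same sign to both sides of the coefficient formula. -/
theorem trace_rep_inv_mul_esymm {n : ℕ} {p : EvenPartition m} (h : m + p.length ≤ n) (r : ℕ) :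
    (m = 2 * r → trace (of (p.rep n)⁻¹ * esymm n r) = p.coeff) ∧
    (2 * r < m → trace (of (p.rep n)⁻¹ * esymm n r) = 0) := by
  obtain ⟨s, hs⟩ : ∃ s, s = n - (m + p.length) := ⟨_, rfl⟩
  have hlen : (p.fullBlocks n).length = p.length + s := by
    rw [fullBlocks, List.length_append, length_blocks, length_partList, List.length_map,
      List.length_range', hs]
  have h1 := coeffFormula n r (p.fullBlocks n) (by rw [flatten_fullBlocks h])
    (fun c hc => p.odd_of_mem_fullBlocks hc)
  have h2 : trace (cycProd (p.fullBlocks n) * esymm n r) =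
      sg s * trace (of (p.rep n)⁻¹ * esymm n r) := by
    rw [fullBlocks, cycProd_append, cycProd_singletons, of_rep_inv h, List.length_range', ← hs,
      mul_smul_comm, mul_one, smul_mul_assoc, trace_units_smul]
  have h3 : ((p.fullBlocks n).map cycleCoeff).prod = sg s * p.coeff := by
    have h4 : ∀ l : List ℕ, ((l.map fun i => [i]).map cycleCoeff).prod = sg l.length := by
      intro l
      induction l with
      | nil => rfl
      | cons a l ih =>
        rw [List.map_cons, List.map_cons, List.prod_cons, ih, List.length_cons, sg, sg, pow_succ']
        simp [cycleCoeff]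
    rw [fullBlocks, List.map_append, List.prod_append, map_cycleCoeff_blocks, h4,
      List.length_range', ← hs, mul_comm]
  have h5 : ((sg s : ℤˣ) : ℤ) ≠ 0 := Units.ne_zero _
  rw [h2, h3, hlen] at h1
  exact ⟨fun hm => mul_left_cancel₀ h5 (h1.1 (by omega)), fun hm =>
    (mul_eq_zero.1 (h1.2 (by omega))).resolve_left h5⟩

theorem exists_mem_sub_of_cycProd {n : ℕ} {C : List (List ℕ)} (hC : C.flatten.Nodup)
    (hn : ∀ x ∈ C.flatten, x < n) : ∃ g ∈ sub n, cycProd C = of g := by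
  induction C with
  | nil => exact ⟨1, one_mem _, by simp⟩
  | cons c C ih =>
    rw [List.flatten_cons] at hC hn
    obtain ⟨g, hg, h1⟩ := ih (List.Nodup.of_append_right hC) (fun x hx => hn x (by simp_all))
    obtain ⟨h, hh, h2⟩ : ∃ h ∈ sub n, cyc c = of h := by
      cases c with
      | nil => exact ⟨1, one_mem _, by simp [cyc]⟩
      | cons a l =>
        have ha : a ∉ l := (List.nodup_cons.1 (List.Nodup.of_append_left hC)).1
        have ha' : a < n := hn a (by simp)
        have hl : ∀ x ∈ l, x < n := fun x hx => hn x (by simp [hx])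
        clear hC hn ih h1
        induction l with
        | nil => exact ⟨1, one_mem _, by simp [cyc]⟩
        | cons b l ih =>
          simp only [List.mem_cons, forall_eq_or_imp, not_or] at ha hl
          obtain ⟨h, hh, h2⟩ := ih ha.2 hl.2
          refine ⟨transp a b * h, mul_mem (transp_mem_sub ha' hl.1 ha.1) hh, ?_⟩
          rw [map_mul, ← h2]
          exact arm_cons a b l
    refine ⟨z * (h * g), mul_mem (z_mem_sub n) (mul_mem hh hg), ?_⟩
    rw [cycProd_cons, h1, h2, of_z_mul, map_mul, neg_mul]

theorem rep_mem_sub {n : ℕ} {p : EvenPartition m} (h : m + p.length ≤ n) : p.rep n ∈ sub n := by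
  obtain ⟨g, hg, h1⟩ := exists_mem_sub_of_cycProd (n := n) (blocks_nodup 0 p.partList) (by
    intro x hx
    rw [flatten_blocks, List.mem_range'_1, sum_partList, length_partList] at hx
    omega)
  rw [← of_rep_inv h] at h1
  rw [← inv_mem_iff, of_injective h1]
  exact hg

/-- An element on `n` letters is invisible to central elements, or conjugate up to sign to a
distinguished element. -/
theorem central_trace_eq_zero_or_exists_rep {n : ℕ} {g : SpinCover} (hg : g ∈ sub n) :
    (∀ y, Central n y → trace (of g⁻¹ * y) = 0) ∨
    ∃ (k : ℕ) (p : EvenPartition k), k + p.length ≤ n ∧ ∃ w ∈ sub n, ∃ ε : ℤˣ,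
      of g⁻¹ = ε • (of w * of (p.rep n)⁻¹ * of w⁻¹) := by
  obtain ⟨C, hC, hne, ε, hε⟩ := exists_cycProd (inv_mem hg)
  have hnd := flatten_nodup_of_perm hC
  by_cases hodd : ∀ c ∈ C, Odd c.length
  swap
  · left
    intro y hy
    push Not at hodd
    obtain ⟨c, hc, hc'⟩ := hodd
    rw [hε, smul_mul_assoc, trace_units_smul, trace_cycProd_mul_eq_zero hnd
      (flatten_lt_of_perm hC) hc (hne c hc) (by simpa using hc') hy, mul_zero]
  right
  -- The non-trivial cycles, by decreasing length so that they match the sorted list of parts; the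
  -- cycles of length one in `S` only contribute a sign.
  set D := (C.filter fun c => 1 < c.length).insertionSort (fun c d => d.length ≤ c.length) with hD
  set S := C.filter fun c => !decide (1 < c.length) with hS
  have hCDS : C.Perm (D ++ S) :=
    (List.filter_append_perm (fun c => decide (1 < c.length)) C).symm.trans
      ((List.perm_insertionSort _ _).symm.append_right _)
  have hDmem : ∀ c ∈ D, c ∈ C ∧ 1 < c.length := by
    intro c hc
    have := (List.perm_insertionSort _ _).mem_iff.1 hc
    simpa using this
  have hDodd : ∀ c ∈ D, Odd c.length := fun c hc => hodd c (hDmem c hc).1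
  have hfl : (D.flatten ++ S.flatten).Perm (List.range n) := by
    rw [← List.flatten_append]
    exact hCDS.symm.flatten.trans hC
  have hDnd : D.flatten.Nodup :=
    List.Nodup.of_append_left (hfl.nodup_iff.2 List.nodup_range)
  have hDn : ∀ x ∈ D.flatten, x < n := fun x hx =>
    List.mem_range.1 (hfl.mem_iff.1 (List.mem_append_left _ hx))
  have hDlen : D.flatten.length ≤ n := by
    have := hfl.length_eq
    rw [List.length_append, List.length_range] at this
    omega
  obtain ⟨δ, hδ⟩ : ∃ δ : ℤˣ, cycProd C = δ • cycProd D := by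
    have h1 : ∃ l : List ℕ, S = l.map fun i => [i] := by
      have h2 : ∀ c ∈ S, c.length = 1 := by
        intro c hc
        have h3 := List.mem_filter.1 hc
        have h4 := (hodd c h3.1).pos
        simp at h3
        omega
      clear_value S
      clear hS hCDS hfl
      induction S with
      | nil => exact ⟨[], rfl⟩
      | cons c S ih =>
        obtain ⟨l, rfl⟩ := ih (fun d hd => h2 d (by simp [hd]))
        obtain ⟨a, rfl⟩ := List.length_eq_one_iff.1 (h2 c (by simp))
        exact ⟨a :: l, rfl⟩
    obtain ⟨l, hl⟩ := h1
    refine ⟨sg l.length, ?_⟩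
    rw [cycProd_perm_of_odd hCDS hnd hodd, cycProd_append, hl, cycProd_singletons, mul_smul_comm,
      mul_one]
  set ps := D.map fun c => c.length - 1 with hps
  have hsum : ps.sum + ps.length = D.flatten.length := by
    rw [hps]
    have : ∀ E : List (List ℕ), (∀ c ∈ E, 1 < c.length) →
        (E.map fun c => c.length - 1).sum + (E.map fun c => c.length - 1).length =
          E.flatten.length := by
      intro E hE
      induction E with
      | nil => rfl
      | cons c E ih =>
        have h1 := ih (fun d hd => hE d (by simp [hd]))
        have h2 := hE c (by simp)
        simp only [List.map_cons, List.sum_cons, List.length_cons, List.flatten_cons,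
          List.length_append] at h1 ⊢
        omega
    exact this D fun c hc => (hDmem c hc).2
  let p : EvenPartition ps.sum := ⟨⟨(ps : Multiset ℕ), by
      intro i hi
      obtain ⟨c, hc, rfl⟩ := List.mem_map.1 (Multiset.mem_coe.1 hi)
      have := (hDmem c hc).2
      omega, by simp⟩, by
      intro i hi
      obtain ⟨c, hc, rfl⟩ := List.mem_map.1 (Multiset.mem_coe.1 hi)
      exact Nat.Odd.sub_odd (hDodd c hc) odd_one⟩
  have hpl : p.partList = ps := by
    refine List.Perm.eq_of_pairwise' (r := (· ≥ ·)) (Multiset.pairwise_sort _ _) ?_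
      (Multiset.coe_eq_coe.1 p.coe_partList)
    rw [hps, List.pairwise_map]
    have h1 : D.Pairwise (fun c d => d.length ≤ c.length) :=
      haveI : Std.Total (fun c d : List ℕ => d.length ≤ c.length) := ⟨fun a b => Nat.le_total _ _⟩
      haveI : IsTrans (List ℕ) (fun c d : List ℕ => d.length ≤ c.length) :=
        ⟨fun a b c h1 h2 => le_trans h2 h1⟩
      List.pairwise_insertionSort _ _
    exact h1.imp fun h => Nat.sub_le_sub_right h 1
  have hplen : ps.sum + p.length ≤ n := by
    rw [← p.length_partList, hpl, hsum]
    exact hDlen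
  -- Renaming the letters consecutively turns these cycles into the standard blocks.
  obtain ⟨w, hw, hwl⟩ := exists_map_eq_range D.flatten hDnd hDn
  have hblocks : D.map (List.map (perm w)) = blocks 0 ps := by
    have h1 := eq_blocks (D := D.map (List.map (perm w))) (a := 0) ?_ ?_
    · rw [List.map_map] at h1
      rw [h1, hps]
      congr 1
      exact List.map_congr_left fun c _ => by simp
    · intro c hc
      obtain ⟨d, hd, rfl⟩ := List.mem_map.1 hc
      have := (hDmem d hd).2
      intro h
      rw [List.map_eq_nil_iff] at h
      simp [h] at this
    · rw [← List.map_flatten, hwl, List.length_range, List.range_eq_range']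
  have hconj := of_mul_cycProd w (C := D) (List.nodup_flatten.1 hDnd).1 hDodd
  rw [hblocks, ← hpl, ← of_rep_inv hplen] at hconj
  refine ⟨_, p, hplen, w⁻¹, inv_mem hw, ε * δ, ?_⟩
  rw [hε, hδ, smul_smul, inv_inv]
  congr 1
  rw [mul_assoc, ← hconj, ← mul_assoc, of_inv_mul, one_mul]

end EvenPartition

/-! ### Cycle types -/

namespace SpinRing
open SpinCover

theorem formPerm_cons_cons_eq {a b : ℕ} {l : List ℕ} (h : (a :: b :: l).Nodup) :
    (a :: b :: l).formPerm = (a :: l).formPerm * Equiv.swap a b := by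
  have h1 : (a :: b :: l).IsRotated (l ++ [a, b]) := by
    refine List.IsRotated.symm ?_
    exact List.isRotated_append (l := l) (l' := [a, b])
  have h2 : (a :: l).IsRotated (l ++ [a]) :=
    (List.isRotated_append (l := l) (l' := [a])).symm
  rw [List.formPerm_eq_of_isRotated h h1, List.formPerm_append_pair,
    List.formPerm_eq_of_isRotated _ h2]
  simp_all

/-- The inverse appears because `cyc` sends the first letter to the last, while `List.formPerm`
sends each letter to the next. -/
theorem lifts_cyc_formPerm {c : List ℕ} (hc : c.Nodup) : Lifts (cyc c) c.formPerm⁻¹ := by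
  cases c with
  | nil => simpa [cyc] using lifts_one
  | cons a l =>
    change Lifts (arm a l) _
    induction l with
    | nil => simpa using lifts_one
    | cons b l ih =>
      have h1 : (a :: l).Nodup := by simp_all
      have hab : a ≠ b := by simp_all
      rw [formPerm_cons_cons_eq hc, mul_inv_rev, Equiv.swap_inv, arm_cons]
      exact (lifts_tau hab).mul (ih h1)

/-- The permutation under a product of cycles. -/
def cycPerm (C : List (List ℕ)) : Equiv.Perm ℕ := (C.map fun c => c.formPerm⁻¹).prod

theorem lifts_cycProd_cycPerm {C : List (List ℕ)} (hC : ∀ c ∈ C, c.Nodup) :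
    Lifts (cycProd C) (cycPerm C) := by
  induction C with
  | nil => exact lifts_one
  | cons c C ih =>
    rw [cycProd_cons, cycPerm, List.map_cons, List.prod_cons]
    exact (lifts_cyc_formPerm (hC c (by simp))).neg.mul (ih fun d hd => hC d (by simp [hd]))

theorem Lifts.perm_eq {g : SpinCover} {σ : Equiv.Perm ℕ} (h : Lifts (of g) σ) : perm g = σ := by
  obtain ⟨k, rfl, h | h⟩ := h
  · rw [of_injective h]
  · rw [← of_z_mul] at h
    rw [of_injective h, map_mul, perm_z, one_mul]

theorem formPerm_inv_apply_of_notMem {c : List ℕ} {x : ℕ} (h : x ∉ c) : c.formPerm⁻¹ x = x := by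
  rw [Equiv.Perm.inv_eq_iff_eq, List.formPerm_apply_of_notMem h]

theorem formPerm_inv_mem {c : List ℕ} {x : ℕ} (h : x ∈ c) : c.formPerm⁻¹ x ∈ c := by
  rw [← List.formPerm_mem_iff_mem]
  simpa using h

theorem cycPerm_apply {C : List (List ℕ)} (hC : C.flatten.Nodup) {c : List ℕ} (hc : c ∈ C) {x : ℕ}
    (hx : x ∈ c) : cycPerm C x = c.formPerm⁻¹ x := by
  induction C with
  | nil => simp at hc
  | cons d C ih =>
    rw [List.flatten_cons] at hC
    have hdis := (List.nodup_append.1 hC).2.2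
    rw [cycPerm, List.map_cons, List.prod_cons, Equiv.Perm.mul_apply]
    change d.formPerm⁻¹ (cycPerm C x) = _
    rcases List.mem_cons.1 hc with rfl | hc
    · have h1 : ∀ E : List (List ℕ), x ∉ E.flatten → cycPerm E x = x := by
        intro E hE
        induction E with
        | nil => rfl
        | cons e E ihE =>
          simp only [List.flatten_cons, List.mem_append, not_or] at hE
          rw [cycPerm, List.map_cons, List.prod_cons, Equiv.Perm.mul_apply]
          change e.formPerm⁻¹ (cycPerm E x) = _
          rw [ihE hE.2, formPerm_inv_apply_of_notMem hE.1]
      rw [h1 C fun h => hdis x hx x h rfl]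
    · rw [ih (List.Nodup.of_append_right hC) hc, formPerm_inv_apply_of_notMem]
      intro h
      exact hdis _ h _ (List.mem_flatten.2 ⟨c, hc, formPerm_inv_mem hx⟩) rfl

/-- Cycle lengths become periods of letters, which are visibly invariant under conjugation. -/
theorem minimalPeriod_cycPerm {C : List (List ℕ)} (hC : C.flatten.Nodup) {c : List ℕ} (hc : c ∈ C)
    {x : ℕ} (hx : x ∈ c) : Function.minimalPeriod (cycPerm C) x = c.length := by
  have hcn := (List.nodup_flatten.1 hC).1 c hc
  have h1 : ∀ k, (cycPerm C ^ k) x = (c.formPerm⁻¹ ^ k) x ∧ (c.formPerm⁻¹ ^ k) x ∈ c := by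
    intro k
    induction k with
    | zero => exact ⟨rfl, hx⟩
    | succ k ih =>
      rw [pow_succ', pow_succ', Equiv.Perm.mul_apply, Equiv.Perm.mul_apply, ih.1]
      exact ⟨cycPerm_apply hC hc ih.2, formPerm_inv_mem ih.2⟩
  have h2 : ∀ k, Function.IsPeriodicPt (cycPerm C) k x ↔ c.length ∣ k := by
    intro k
    rw [Function.IsPeriodicPt, Function.IsFixedPt, Equiv.Perm.iterate_eq_pow, (h1 k).1, inv_pow,
      Equiv.Perm.inv_eq_iff_eq, eq_comm]
    obtain ⟨i, hi, rfl⟩ := List.getElem_of_mem hx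
    rw [List.formPerm_pow_apply_getElem c hcn, hcn.getElem_inj_iff]
    constructor
    · intro h
      have h3 : (i + k) ≡ (i + 0) [MOD c.length] := by
        rw [Nat.ModEq, h, add_zero, Nat.mod_eq_of_lt hi]
      exact (Nat.modEq_zero_iff_dvd).1 (Nat.ModEq.add_left_cancel' i h3)
    · rintro ⟨q, rfl⟩
      rw [Nat.add_mul_mod_self_left, Nat.mod_eq_of_lt hi]
  refine Nat.dvd_antisymm ?_ ?_
  · exact Function.IsPeriodicPt.minimalPeriod_dvd ((h2 _).2 dvd_rfl)
  · exact (h2 _).1 (Function.isPeriodicPt_minimalPeriod _ _)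

theorem minimalPeriod_conj (σ w : Equiv.Perm ℕ) (x : ℕ) :
    Function.minimalPeriod (w * σ * w⁻¹) (w x) = Function.minimalPeriod σ x := by
  rw [Function.minimalPeriod_eq_minimalPeriod_iff]
  intro k
  rw [Function.IsPeriodicPt, Function.IsFixedPt, Function.IsPeriodicPt, Function.IsFixedPt,
    Equiv.Perm.iterate_eq_pow, Equiv.Perm.iterate_eq_pow, conj_pow]
  simp

theorem count_map_flatten {C : List (List ℕ)} {f : ℕ → ℕ} (hf : ∀ c ∈ C, ∀ x ∈ c, f x = c.length)
    (j : ℕ) : (C.flatten.map f).count j = j * (C.map List.length).count j := by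
  induction C with
  | nil => simp
  | cons c C ih =>
    rw [List.flatten_cons, List.map_append, List.count_append,
      ih (fun d hd => hf d (by simp [hd])), List.map_cons, List.count_cons,
      List.map_congr_left (hf c (by simp)), List.map_const', List.count_replicate]
    split_ifs with h
    · rw [beq_iff_eq] at h
      rw [h]; ring
    · simp

/-- There are `j` letters of period `j` for each cycle of length `j`, and a conjugating element
merely permutes the letters. -/
theorem count_length_eq_of_conj {n : ℕ} {C D : List (List ℕ)} (hC : C.flatten.Perm (List.range n))
    (hD : D.flatten.Perm (List.range n)) {w : SpinCover} (hw : w ∈ sub n)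
    (h : cycPerm C = perm w * cycPerm D * (perm w)⁻¹) {j : ℕ} (hj : 0 < j) :
    (C.map List.length).count j = (D.map List.length).count j := by
  have h1 := count_map_flatten (f := Function.minimalPeriod (cycPerm C))
    (fun c hc x hx => minimalPeriod_cycPerm (flatten_nodup_of_perm hC) hc hx) j
  have h2 := count_map_flatten (f := Function.minimalPeriod (cycPerm D))
    (fun c hc x hx => minimalPeriod_cycPerm (flatten_nodup_of_perm hD) hc hx) j
  have h3 : (List.range n).Perm ((List.range n).map (perm w)) := by
    refine (List.Perm.symm ?_)
    refine (List.subperm_of_subset ?_ ?_).perm_of_length_le (by simp)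
    · exact List.nodup_range.map (perm w).injective
    · intro x hx
      obtain ⟨y, hy, rfl⟩ := List.mem_map.1 hx
      exact List.mem_range.2 (perm_lt_of_mem_sub hw (List.mem_range.1 hy))
  have h4 : (C.flatten.map (Function.minimalPeriod (cycPerm C))).Perm
      (D.flatten.map (Function.minimalPeriod (cycPerm D))) := by
    refine ((hC.trans h3).map _).trans ?_
    rw [List.map_map]
    refine List.Perm.trans ?_ (hD.symm.map _)
    rw [h]
    refine List.Perm.of_eq (List.map_congr_left fun x _ => ?_)
    exact minimalPeriod_conj _ _ _
  rw [h4.count_eq, h2] at h1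
  exact (Nat.eq_of_mul_eq_mul_left hj h1).symm

end SpinRing

namespace EvenPartition
open SpinCover SpinRing

variable {m m' : ℕ}

theorem perm_rep_inv {n : ℕ} {p : EvenPartition m} (h : m + p.length ≤ n) :
    perm (p.rep n)⁻¹ = cycPerm (p.fullBlocks n) := by
  apply Lifts.perm_eq
  have h1 : cycPerm (p.fullBlocks n) = cycPerm (blocks 0 p.partList) := by
    have h2 : ∀ l : List ℕ, cycPerm (l.map fun i => [i]) = 1 := by
      intro l
      induction l with
      | nil => rfl
      | cons a l ih =>
        rw [cycPerm, List.map_cons, List.map_cons, List.prod_cons]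
        change _ * cycPerm _ = 1
        rw [ih]; simp
    rw [fullBlocks, cycPerm, List.map_append, List.prod_append]
    change cycPerm _ * cycPerm _ = _
    rw [h2, mul_one]
  rw [of_rep_inv h, h1]
  exact lifts_cycProd_cycPerm (List.nodup_flatten.1 (blocks_nodup 0 _)).1

theorem count_length_fullBlocks {n : ℕ} (p : EvenPartition m) {i : ℕ} (hi : 0 < i) :
    ((p.fullBlocks n).map List.length).count (i + 1) = p.1.parts.count i := by
  rw [fullBlocks, List.map_append, List.count_append, map_length_blocks, List.map_map,
    List.count_eq_zero_of_not_mem (l := List.map _ (List.range' _ _)), add_zero,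
    List.count_map_of_injective _ _ (add_left_injective 1), ← coe_partList, Multiset.coe_count]
  intro h
  obtain ⟨x, -, h⟩ := List.mem_map.1 h
  simp at h
  omega

/-- Distinguished elements of different types are not conjugate, even up to sign. -/
theorem parts_eq_of_conj {n : ℕ} {p : EvenPartition m} {q : EvenPartition m'}
    (hp : m + p.length ≤ n) (hq : m' + q.length ≤ n) {w : SpinCover} (hw : w ∈ sub n)
    (h : perm (p.rep n) = perm (w * q.rep n * w⁻¹)) : p.1.parts = q.1.parts := by
  have h1 : cycPerm (p.fullBlocks n) = perm w * cycPerm (q.fullBlocks n) * (perm w)⁻¹ := by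
    rw [← perm_rep_inv hp, ← perm_rep_inv hq, map_inv, h]
    simp [mul_assoc]
  ext i
  rcases Nat.eq_zero_or_pos i with rfl | hi
  · rw [Multiset.count_eq_zero_of_notMem, Multiset.count_eq_zero_of_notMem]
    · intro h0; exact lt_irrefl _ (q.1.parts_pos h0)
    · intro h0; exact lt_irrefl _ (p.1.parts_pos h0)
  · rw [← count_length_fullBlocks (n := n) p hi, ← count_length_fullBlocks (n := n) q hi]
    exact count_length_eq_of_conj (by rw [flatten_fullBlocks hp]) (by rw [flatten_fullBlocks hq])
      hw h1 (Nat.succ_pos i)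

end EvenPartition

/-! ### Class sums -/

namespace EvenPartition
open SpinCover SpinRing

variable {m m' : ℕ}

theorem splitClass_subset (n : ℕ) (p : EvenPartition m) :
    p.splitClass n ⊆ (sub n : Set SpinCover) := by
  rintro g ⟨h, s, hs, rfl⟩
  exact mul_mem (mul_mem hs (rep_mem_sub h)) (inv_mem hs)

theorem finite_splitClass (n : ℕ) (p : EvenPartition m) : (p.splitClass n).Finite :=
  (finite_sub n).subset (p.splitClass_subset n)

/-- The class sum. -/
noncomputable def csum (n : ℕ) (p : EvenPartition m) : SpinRing :=
  ∑ g ∈ (p.finite_splitClass n).toFinset, of g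

theorem classSum_eq (n : ℕ) (p : EvenPartition m) : SpinAlgebra.classSum n p = p.csum n :=
  finsum_mem_eq_finite_toFinset_sum (M := SpinRing) of (p.finite_splitClass n)

theorem csum_eq_zero {n : ℕ} {p : EvenPartition m} (h : n < m + p.length) : p.csum n = 0 := by
  refine Finset.sum_eq_zero fun g hg => ?_
  have := ((Set.Finite.mem_toFinset _).1 hg).1
  omega

theorem csum_mem_subSpan (n : ℕ) (p : EvenPartition m) : p.csum n ∈ subSpan n :=
  Submodule.sum_mem _ fun _ hg =>
    of_mem_subSpan (p.splitClass_subset n ((Set.Finite.mem_toFinset _).1 hg))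

/-- Evenness of the distinguished elements makes the class sums commute with transpositions of
outside letters. -/
theorem sgn_rep (n : ℕ) (p : EvenPartition m) : sgn (p.rep n) = 1 := by
  have hx : ∀ i, sgn (x n i) = -1 := fun i => sgn_nest _ _
  have hc : ∀ (a k : ℕ), Even k → sgn (cycle n (List.range' a (k + 1))) = 1 := by
    intro a k hk
    have h1 : ∀ l : List ℕ, sgn (l.map (x n)).prod = (-1) ^ l.length := by
      intro l
      induction l with
      | nil => simp
      | cons b l ih => rw [List.map_cons, List.prod_cons, map_mul, ih, hx, List.length_cons, pow_succ']
    cases k with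
    | zero => exact sgn_z
    | succ k =>
      change sgn (x n a * ((List.range' (a + 1) (k + 1)).reverse.map (x n)).prod * x n a) = 1
      rw [map_mul, map_mul, h1, hx, List.length_reverse, List.length_range', hk.neg_one_pow]
      simp
  rw [rep_eq]
  have hps : ∀ i ∈ p.partList, Even i := fun i hi => p.even_of_mem_partList hi
  generalize p.partList = ps at hps
  suffices ∀ a, sgn (cycles n a ps) = 1 from this 0
  induction ps with
  | nil => intro a; exact map_one _
  | cons k ps ih =>
    intro a
    rw [cycles, map_mul, hc a k (hps k (by simp)), ih (fun i hi => hps i (by simp [hi])), one_mul]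

theorem central_csum (n : ℕ) (p : EvenPartition m) : Central n (p.csum n) := by
  constructor
  · intro g hg
    rw [Commute, SemiconjBy, csum, Finset.mul_sum, Finset.sum_mul]
    refine Finset.sum_bij (fun h _ => g * h * g⁻¹) ?_ ?_ ?_ ?_
    · intro h hh
      rw [Set.Finite.mem_toFinset] at hh ⊢
      obtain ⟨h1, s, hs, rfl⟩ := hh
      exact ⟨h1, g * s, mul_mem hg hs, by group⟩
    · intro a _ b _ hab
      simpa using hab
    · intro h hh
      rw [Set.Finite.mem_toFinset] at hh
      obtain ⟨h1, s, hs, rfl⟩ := hh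
      refine ⟨g⁻¹ * (s * p.rep n * s⁻¹) * g, ?_, by group⟩
      rw [Set.Finite.mem_toFinset]
      exact ⟨h1, g⁻¹ * s, mul_mem (inv_mem hg) hs, by group⟩
    · intro h _
      rw [← map_mul, ← map_mul]
      group
  · intro i j hi hj hij
    refine Commute.sum_right _ _ _ fun h hh => ?_
    rw [Set.Finite.mem_toFinset] at hh
    have hsub := p.splitClass_subset n hh
    obtain ⟨h1, s, hs, rfl⟩ := hh
    have h2 := of_mul_tau' (s * p.rep n * s⁻¹) hij
    rw [perm_apply_of_mem_sub hsub hi, perm_apply_of_mem_sub hsub hj, map_mul sgn, map_mul sgn,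
      map_inv, sgn_rep n p, mul_one, mul_inv_cancel, one_smul] at h2
    exact h2.symm

theorem eq_or_eq_of_delta_ne_zero {g h : SpinCover} (hd : delta (g⁻¹ * h) ≠ 0) :
    h = g ∨ h = z * g := by
  unfold delta at hd
  split_ifs at hd with h1 h2
  · exact Or.inl (inv_mul_eq_one.1 h1).symm
  · right; rw [z_mul_comm, ← h2, mul_inv_cancel_left]
  · exact absurd rfl hd

theorem trace_inv_mul_csum (g : SpinCover) (n : ℕ) (p : EvenPartition m) :
    trace (of g⁻¹ * p.csum n) = ∑ h ∈ (p.finite_splitClass n).toFinset, delta (g⁻¹ * h) := by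
  rw [csum, Finset.mul_sum, map_sum]
  refine Finset.sum_congr rfl fun h _ => ?_
  rw [← map_mul, trace_of]

theorem trace_rep_inv_mul_csum_of_ne {n : ℕ} {q : EvenPartition m'} (hq : m' + q.length ≤ n)
    (p : EvenPartition m) (hpq : p.1.parts ≠ q.1.parts) :
    trace (of (q.rep n)⁻¹ * p.csum n) = 0 := by
  rw [trace_inv_mul_csum]
  refine Finset.sum_eq_zero fun h hh => ?_
  by_contra hd
  rw [Set.Finite.mem_toFinset] at hh
  obtain ⟨h1, s, hs, rfl⟩ := hh
  refine hpq (parts_eq_of_conj hq h1 hs ?_).symm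
  rcases eq_or_eq_of_delta_ne_zero hd with h2 | h2 <;> rw [h2]
  rw [map_mul, perm_z, one_mul]

/-- The only danger is a term `z * p.rep n` of the same class, which would cancel the term `1`. -/
theorem trace_rep_inv_mul_csum {n : ℕ} {p : EvenPartition m} (hp : m + p.length ≤ n) :
    trace (of (p.rep n)⁻¹ * p.csum n) = 1 := by
  obtain ⟨r, hr⟩ : ∃ r, m = 2 * r := by
    have h1 : Even m := by
      rw [← p.sum_partList]
      have h2 : ∀ l : List ℕ, (∀ i ∈ l, Even i) → Even l.sum := by
        intro l hl
        induction l with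
        | nil => exact ⟨0, rfl⟩
        | cons a l ih =>
          rw [List.sum_cons]
          exact (hl a (by simp)).add (ih fun i hi => hl i (by simp [hi]))
      exact h2 _ fun i hi => p.even_of_mem_partList hi
    obtain ⟨r, hr⟩ := h1
    exact ⟨r, by omega⟩
  rw [trace_inv_mul_csum, Finset.sum_eq_single (p.rep n), inv_mul_cancel, delta_one]
  · intro h hh hne
    by_contra hd
    rw [Set.Finite.mem_toFinset] at hh
    obtain ⟨-, s, hs, rfl⟩ := hh
    rcases eq_or_eq_of_delta_ne_zero hd with h2 | h2
    · exact hne h2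
    -- If `p.rep n` were conjugate to its `z`-multiple, centrality of `esymm n r` would force its
    -- non-zero coefficient to equal its own negative.
    · have h3 := (trace_rep_inv_mul_esymm hp r).1 hr
      have h4 : trace (of (s * p.rep n * s⁻¹)⁻¹ * esymm n r) =
          trace (of (p.rep n)⁻¹ * esymm n r) := by
        rw [show (s * p.rep n * s⁻¹)⁻¹ = s * (p.rep n)⁻¹ * s⁻¹ by group, map_mul of, mul_assoc,
          ((central_esymm n r).1 _ (inv_mem hs)).eq, ← mul_assoc, trace_mul_comm, map_mul of,
          ← mul_assoc, ← mul_assoc, of_inv_mul, one_mul]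
      rw [h2, mul_inv_rev, z_inv, ← z_mul_comm, of_z_mul, neg_mul, map_neg, h3] at h4
      have := p.coeff_ne_zero
      omega
  · intro h
    exact absurd ((p.finite_splitClass n).mem_toFinset.2 ⟨hp, 1, one_mem _, by simp⟩) h

theorem parts_ne_of_ne {p : EvenPartition m} {q : EvenPartition m'} (h : m ≠ m') :
    p.1.parts ≠ q.1.parts := by
  intro hpq
  exact h (by rw [← p.1.parts_sum, ← q.1.parts_sum, hpq])

/-- Expansion of a central element in class sums. -/
theorem eq_sum_csum {n d : ℕ} {y : SpinRing} (hy : Central n y) (hmem : y ∈ subSpan n)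
    (hd : ∀ (k : ℕ) (p : EvenPartition k), k + p.length ≤ n → d ≤ k →
      trace (of (p.rep n)⁻¹ * y) = 0) :
    y = ∑ k ∈ Finset.range d, ∑ p : EvenPartition k, trace (of (p.rep n)⁻¹ * y) • p.csum n := by
  rw [← sub_eq_zero]
  set u := ∑ k ∈ Finset.range d, ∑ p : EvenPartition k, trace (of (p.rep n)⁻¹ * y) • p.csum n
    with hu
  have hum : u ∈ subSpan n := Submodule.sum_mem _ fun k _ => Submodule.sum_mem _ fun p _ =>
    Submodule.smul_mem _ _ (p.csum_mem_subSpan n)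
  have huc : Central n u := by
    refine ⟨fun g hg => ?_, fun i j hi hj hij => ?_⟩
    · exact Commute.sum_right _ _ _ fun k _ => Commute.sum_right _ _ _ fun p _ =>
        ((p.central_csum n).1 g hg).smul_right _
    · exact Commute.sum_right _ _ _ fun k _ => Commute.sum_right _ _ _ fun p _ =>
        ((p.central_csum n).2 i j hi hj hij).smul_right _
  have hc : Central n (y - u) :=
    ⟨fun g hg => (hy.1 g hg).sub_right (huc.1 g hg),
      fun i j hi hj hij => (hy.2 i j hi hj hij).sub_right (huc.2 i j hi hj hij)⟩
  refine eq_zero_of_trace fun g => ?_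
  -- Outside `sub n` the trace vanishes by support. Inside, either `g⁻¹` is invisible to central
  -- elements or the trace reduces to that of a distinguished element, where the class sums are
  -- dual.
  by_cases hg : g ∈ sub n
  swap
  · exact trace_of_mul_eq_zero_of_not_mem (Submodule.sub_mem _ hmem hum)
      fun h => hg (inv_mem_iff.1 h)
  rcases central_trace_eq_zero_or_exists_rep hg with h | ⟨k, q, hq, w, hw, ε, hε⟩
  · exact h _ hc
  have h1 : trace (of (q.rep n)⁻¹ * (y - u)) = 0 := by
    rw [mul_sub, map_sub, sub_eq_zero]
    have h2 : ∀ (k' : ℕ) (p : EvenPartition k'),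
        trace (of (q.rep n)⁻¹ * (trace (of (p.rep n)⁻¹ * y) • p.csum n)) =
          trace (of (p.rep n)⁻¹ * y) * trace (of (q.rep n)⁻¹ * p.csum n) := by
      intro k' p
      rw [mul_smul_comm, map_zsmul, smul_eq_mul]
    rw [hu, Finset.mul_sum, map_sum]
    simp only [Finset.mul_sum, map_sum, h2]
    by_cases hk : k < d
    · rw [Finset.sum_eq_single k, Finset.sum_eq_single q, trace_rep_inv_mul_csum hq, mul_one]
      · intro p _ hpq
        rw [trace_rep_inv_mul_csum_of_ne hq, mul_zero]
        intro h
        exact hpq (Subtype.ext (Nat.Partition.ext h))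
      · intro h; exact absurd (Finset.mem_univ _) h
      · intro k' _ hk'
        refine Finset.sum_eq_zero fun p _ => ?_
        rw [trace_rep_inv_mul_csum_of_ne hq p (parts_ne_of_ne hk'), mul_zero]
      · intro h; exact absurd (Finset.mem_range.2 hk) h
    · rw [hd k q hq (by omega), eq_comm]
      refine Finset.sum_eq_zero fun k' hk' => Finset.sum_eq_zero fun p _ => ?_
      have := Finset.mem_range.1 hk'
      rw [trace_rep_inv_mul_csum_of_ne hq p (parts_ne_of_ne (by omega)), mul_zero]
  rw [hε, smul_mul_assoc, trace_units_smul, mul_assoc, (hc.1 _ (inv_mem hw)).eq, ← mul_assoc,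
    trace_mul_comm, ← mul_assoc, ← mul_assoc, of_inv_mul, one_mul, h1, mul_zero]

theorem esymm_eq_sum (n r : ℕ) : esymm n r =
    ∑ k ∈ Finset.range (2 * r), ∑ p : EvenPartition k,
      trace (of (p.rep n)⁻¹ * esymm n r) • p.csum n +
    ∑ p : EvenPartition (2 * r), p.coeff • p.csum n := by
  have h := eq_sum_csum (d := 2 * r + 1) (central_esymm n r) (esymm_mem_subSpan n r)
    fun k p hp hk => (trace_rep_inv_mul_esymm hp r).2 (by omega)
  rw [Finset.sum_range_succ] at h
  refine h.trans ?_
  congr 1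
  refine Finset.sum_congr rfl fun p _ => ?_
  by_cases hp : 2 * r + p.length ≤ n
  · rw [(trace_rep_inv_mul_esymm hp r).1 rfl]
  · rw [csum_eq_zero (by omega), smul_zero, smul_zero]

end EvenPartition

/-! ### Existence and uniqueness of the top coefficients -/

namespace SpinRing
open SpinCover EvenPartition

theorem isTopCoefficients_coeff (r : ℕ) :
    SpinAlgebra.IsTopCoefficients r EvenPartition.coeff := by
  intro n
  have h : SpinAlgebra.elemSymm n r - ∑ p : EvenPartition (2 * r), p.coeff • SpinAlgebra.classSum n p
      = ∑ k ∈ Finset.range (2 * r), ∑ p : EvenPartition k,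
        trace (of (p.rep n)⁻¹ * esymm n r) • SpinAlgebra.classSum n p := by
    simp only [classSum_eq, elemSymm_eq]
    exact sub_eq_of_eq_add (esymm_eq_sum n r)
  rw [h]
  refine Submodule.sum_mem _ fun k hk => Submodule.sum_mem _ fun p _ =>
    Submodule.smul_mem _ _ (Submodule.subset_span ⟨k, Finset.mem_range.1 hk, p, rfl⟩)

theorem isTopCoefficients_unique {r : ℕ} {A B : EvenPartition (2 * r) → ℤ}
    (hA : SpinAlgebra.IsTopCoefficients r A) (hB : SpinAlgebra.IsTopCoefficients r B) : B = A := by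
  funext q
  -- The least `n` for which the class of type `q` is not empty. The trace against the inverse of
  -- its distinguished element kills every other type, in particular the lower span.
  obtain ⟨n, hn⟩ : ∃ n, n = 2 * r + q.length := ⟨_, rfl⟩
  have hlow : ∀ y ∈ SpinAlgebra.lowerSpan n (2 * r),
      trace (of (q.rep n)⁻¹ * (show SpinRing from y)) = 0 := by
    intro y hy
    induction hy using Submodule.span_induction with
    | mem x hx =>
      obtain ⟨k, hk, p, rfl⟩ := hx
      rw [classSum_eq]
      exact trace_rep_inv_mul_csum_of_ne hn.ge p (parts_ne_of_ne hk.ne)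
    | zero => exact (congrArg trace (mul_zero (M₀ := SpinRing) _)).trans (map_zero _)
    | add a b _ _ ha hb =>
      refine (congrArg trace (mul_add (R := SpinRing) _ a b)).trans ?_
      rw [map_add]
      exact (congrArg₂ (· + ·) ha hb).trans (add_zero 0)
    | smul c a _ ha =>
      refine (congrArg trace (mul_smul_comm (β := SpinRing) c _ a)).trans ?_
      rw [map_zsmul]
      exact (congrArg (c • ·) ha).trans (smul_zero c)
  have key : ∀ A : EvenPartition (2 * r) → ℤ, SpinAlgebra.IsTopCoefficients r A →
      A q = trace (of (q.rep n)⁻¹ * esymm n r) := by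
    intro A hA
    have h1 := hlow _ (hA n)
    rw [elemSymm_eq] at h1
    simp only [classSum_eq] at h1
    change trace (of (q.rep n)⁻¹ * (esymm n r - ∑ p : EvenPartition (2 * r), A p • p.csum n)) = 0
      at h1
    rw [mul_sub, map_sub, sub_eq_zero, Finset.mul_sum, map_sum, Finset.sum_eq_single q,
      mul_smul_comm, map_zsmul, trace_rep_inv_mul_csum hn.ge] at h1
    · rw [h1]; simp
    · intro p _ hpq
      rw [mul_smul_comm, map_zsmul, trace_rep_inv_mul_csum_of_ne hn.ge, smul_zero]
      intro h
      exact hpq (Subtype.ext (Nat.Partition.ext h))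
    · intro h; exact absurd (Finset.mem_univ _) h
  rw [key A hA, key B hB]

end SpinRing

/-! ### The evaluation of the coefficients -/

namespace CatalanWeight
open PowerSeries

/-- The Catalan weight of a part. -/
def weight (i : ℕ) : ℚ := if Even i then (catalan (i / 2) : ℚ) else 0

theorem weight_zero : weight 0 = 1 := by simp [weight]

/-- The weight of a multiset of parts, divided by the factorials of the multiplicities. -/
noncomputable def multWeight (s : Multiset ℕ) : ℚ :=
  (s.map weight).prod / ∏ i ∈ s.toFinset, ((s.count i).factorial : ℚ)

/-- Adding a part `j` raises one multiplicity, and the new factor of its factorial is the count on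
the left. -/
theorem multWeight_cons (j : ℕ) (s : Multiset ℕ) :
    ((j ::ₘ s).count j : ℚ) * multWeight (j ::ₘ s) = weight j * multWeight s := by
  have h1 : ∏ i ∈ s.toFinset, ((s.count i).factorial : ℚ) =
      ∏ i ∈ (j ::ₘ s).toFinset, ((s.count i).factorial : ℚ) := by
    refine Finset.prod_subset (fun i hi => ?_) fun i _ hi => ?_
    · rw [Multiset.mem_toFinset] at hi ⊢
      exact Multiset.mem_cons_of_mem hi
    · rw [Multiset.mem_toFinset] at hi
      rw [Multiset.count_eq_zero_of_notMem hi]; simp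
  have hj : j ∈ (j ::ₘ s).toFinset := by simp
  have h2 : ∏ i ∈ (j ::ₘ s).toFinset, (((j ::ₘ s).count i).factorial : ℚ) =
      ((j ::ₘ s).count j : ℚ) * ∏ i ∈ (j ::ₘ s).toFinset, ((s.count i).factorial : ℚ) := by
    rw [← Finset.mul_prod_erase _ _ hj, ← Finset.mul_prod_erase _ _ hj, ← mul_assoc,
      Multiset.count_cons_self, Nat.factorial_succ]
    push_cast
    congr 1
    refine Finset.prod_congr rfl fun i hi => ?_
    rw [Multiset.count_cons_of_ne (Finset.ne_of_mem_erase hi)]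
  have h3 : ((j ::ₘ s).count j : ℚ) ≠ 0 := by
    rw [Multiset.count_cons_self]; positivity
  have h4 : ∏ i ∈ (j ::ₘ s).toFinset, ((s.count i).factorial : ℚ) ≠ 0 :=
    Finset.prod_ne_zero_iff.2 fun i _ => by positivity
  rw [multWeight, multWeight, h1, h2, Multiset.map_cons, Multiset.prod_cons]
  field_simp

/-- The multisets of parts of the partitions of `m`. -/
noncomputable def partsFinset (m : ℕ) : Finset (Multiset ℕ) :=
  (Finset.univ : Finset (Nat.Partition m)).image Nat.Partition.parts

theorem mem_partsFinset {m : ℕ} {s : Multiset ℕ} :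
    s ∈ partsFinset m ↔ s.sum = m ∧ ∀ i ∈ s, 0 < i := by
  rw [partsFinset, Finset.mem_image]
  constructor
  · rintro ⟨p, -, rfl⟩
    exact ⟨p.parts_sum, fun i hi => p.parts_pos hi⟩
  · rintro ⟨h1, h2⟩
    exact ⟨⟨s, fun {i} hi => h2 i hi, h1⟩, Finset.mem_univ _, rfl⟩

/-- The coefficients of the powers of the generating function of the weights. -/
noncomputable def powCoeff (x : ℚ) (m : ℕ) : ℚ :=
  ∑ s ∈ partsFinset m, multWeight s * (descPochhammer ℚ s.card).eval x

theorem descPochhammer_eval_add_one (n : ℕ) (x : ℚ) :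
    (descPochhammer ℚ n).eval (x + 1) =
      (descPochhammer ℚ n).eval x + n * (descPochhammer ℚ (n - 1)).eval x := by
  cases n with
  | zero => simp
  | succ n =>
    have h := congrArg (Polynomial.eval (x + 1)) (descPochhammer_succ_comp_X_sub_one ℚ n)
    simp only [Polynomial.eval_comp, Polynomial.eval_sub, Polynomial.eval_X, Polynomial.eval_one,
      add_sub_cancel_right, smul_eq_mul, Polynomial.eval_mul, Polynomial.eval_add,
      Polynomial.eval_natCast] at h
    rw [h, Nat.add_sub_cancel]
    push_cast
    ring

/-- Double counting of partitions with a marked distinct part: removing the part is a bijection, and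
the multiplicity of the part is absorbed by `multWeight_cons`. -/
theorem sum_remove_part (m : ℕ) (x : ℚ) :
    ∑ s ∈ partsFinset m, multWeight s * (s.card * (descPochhammer ℚ (s.card - 1)).eval x) =
      ∑ j ∈ Finset.Icc 1 m, weight j * powCoeff x (m - j) := by
  have h1 : ∀ s : Multiset ℕ,
      multWeight s * (s.card * (descPochhammer ℚ (s.card - 1)).eval x) =
      ∑ i ∈ s.toFinset, (s.count i : ℚ) * multWeight s *
        (descPochhammer ℚ (s.card - 1)).eval x := by
    intro s
    rw [← Finset.sum_mul, ← Finset.sum_mul, ← Nat.cast_sum, Multiset.toFinset_sum_count_eq]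
    ring
  simp only [h1, powCoeff, Finset.mul_sum]
  rw [Finset.sum_sigma', Finset.sum_sigma']
  refine Finset.sum_bij' (fun a _ => ⟨a.2, a.1.erase a.2⟩) (fun b _ => ⟨b.1 ::ₘ b.2, b.1⟩)
    ?_ ?_ ?_ ?_ ?_
  · rintro ⟨s, i⟩ h
    simp only [Finset.mem_sigma, Multiset.mem_toFinset, mem_partsFinset, Finset.mem_Icc] at h ⊢
    obtain ⟨⟨h2, h3⟩, h4⟩ := h
    have h5 := Multiset.sum_erase h4
    exact ⟨⟨h3 i h4, by omega⟩, by omega, fun k hk => h3 k (Multiset.mem_of_mem_erase hk)⟩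
  · rintro ⟨j, s⟩ h
    simp only [Finset.mem_sigma, Multiset.mem_toFinset, mem_partsFinset, Finset.mem_Icc] at h ⊢
    obtain ⟨⟨h2, h3⟩, h4, h5⟩ := h
    refine ⟨⟨by rw [Multiset.sum_cons]; omega, fun k hk => ?_⟩, Multiset.mem_cons_self _ _⟩
    rcases Multiset.mem_cons.1 hk with rfl | hk
    · omega
    · exact h5 k hk
  · rintro ⟨s, i⟩ h
    simp only [Finset.mem_sigma, Multiset.mem_toFinset] at h
    simp [Multiset.cons_erase h.2]
  · rintro ⟨j, s⟩ h
    simp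
  · rintro ⟨s, i⟩ h
    simp only [Finset.mem_sigma, Multiset.mem_toFinset] at h
    obtain ⟨t, rfl⟩ := Multiset.exists_cons_of_mem h.2
    simp only [multWeight_cons, Multiset.card_cons, Nat.add_sub_cancel, Multiset.erase_cons_head]
    ring

/-- The difference rule for falling factorials, summed over partitions. The unchanged term supplies
the summand of weight `weight 0 = 1`, the other one the removal of a part. In terms of series,
raising the exponent by one multiplies by the series of weights. -/
theorem powCoeff_add_one (x : ℚ) (m : ℕ) : powCoeff (x + 1) m =
    ∑ ij ∈ Finset.HasAntidiagonal.antidiagonal m, powCoeff x ij.1 * weight ij.2 := by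
  rw [Finset.Nat.sum_antidiagonal_eq_sum_range_succ_mk, ← Finset.sum_range_reflect,
    Finset.sum_range_succ', powCoeff]
  simp only [descPochhammer_eval_add_one, mul_add, Finset.sum_add_distrib, sum_remove_part]
  rw [add_comm]
  congr 1
  · rw [Finset.range_eq_Ico, Finset.sum_Ico_add' (fun j => powCoeff x (m + 1 - 1 - j) *
      weight (m - (m + 1 - 1 - j))) 0 m 1]
    refine Finset.sum_congr ?_ fun j hj => ?_
    · ext j; simp
    · have := Finset.mem_Icc.1 hj
      rw [mul_comm, show m + 1 - 1 - j = m - j by omega, show m - (m - j) = j by omega]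
  · simp [weight_zero, powCoeff]

/-- The generating function of the weights. -/
noncomputable def weightSeries : PowerSeries ℚ := PowerSeries.mk weight

/-- The Catalan functional equation with `X` replaced by `X ^ 2`. -/
theorem weightSeries_eq : weightSeries = 1 + X ^ 2 * weightSeries ^ 2 := by
  have h1 : weightSeries = PowerSeries.expand 2 two_ne_zero
      (PowerSeries.map (Nat.castRingHom ℚ) catalanSeries) := by
    ext n
    rw [weightSeries, coeff_mk, weight]
    split_ifs with h
    · obtain ⟨k, rfl⟩ := h
      rw [← two_mul, PowerSeries.coeff_expand_mul]
      simp
    · rw [PowerSeries.coeff_expand_of_not_dvd]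
      rwa [even_iff_two_dvd] at h
  have h2 := congrArg (fun f => PowerSeries.expand 2 two_ne_zero
    (PowerSeries.map (Nat.castRingHom ℚ) f)) catalanSeries_sq_mul_X_add_one
  simp only [map_add, map_mul, map_pow, map_one, PowerSeries.map_X, PowerSeries.expand_X,
    ← h1] at h2
  rw [add_comm, mul_comm, h2]

/-- The generating function of `powCoeff`. -/
noncomputable def powSeries (x : ℚ) : PowerSeries ℚ := PowerSeries.mk (powCoeff x)

theorem powSeries_add_one (x : ℚ) : powSeries (x + 1) = powSeries x * weightSeries := by
  ext m
  rw [powSeries, coeff_mk, powCoeff_add_one, coeff_mul]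
  simp [powSeries, weightSeries]

theorem powSeries_zero : powSeries 0 = 1 := by
  ext m
  rw [powSeries, coeff_mk, powCoeff, coeff_one]
  split_ifs with hm
  · subst hm
    have : partsFinset 0 = {0} := by
      ext s
      rw [mem_partsFinset, Finset.mem_singleton]
      constructor
      · rintro ⟨h1, h2⟩
        rw [Multiset.sum_eq_zero_iff] at h1
        by_contra h3
        obtain ⟨i, hi⟩ := Multiset.exists_mem_of_ne_zero h3
        exact (h2 i hi).ne' (h1 i hi)
      · rintro rfl; simp
    rw [this, Finset.sum_singleton]
    simp [multWeight]
  · refine Finset.sum_eq_zero fun s hs => ?_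
    rw [descPochhammer_ne_zero_eval_zero, mul_zero]
    intro h
    rw [Multiset.card_eq_zero] at h
    subst h
    exact hm (mem_partsFinset.1 hs).1.symm

/-- With the value `1` at exponent `0`, the step rule identifies the series at `-k` as the inverse
of the `k`-th power, so no theory of general powers is needed. -/
theorem powSeries_neg_mul (k : ℕ) : powSeries (-k) * weightSeries ^ k = 1 := by
  induction k with
  | zero => simpa using powSeries_zero
  | succ k ih =>
    rw [pow_succ', ← mul_assoc, ← powSeries_add_one]
    push_cast
    rw [neg_add, neg_add_cancel_right, ih]

/-- Power sums of two power series with sum `1` and product `X ^ 2`. -/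
theorem coeff_pow_add_pow {G H : PowerSeries ℚ} (h1 : G + H = 1) (h2 : G * H = X ^ 2) :
    (∀ k j, k < j → coeff j (G ^ k + H ^ k) = 0) ∧
      ∀ r, coeff (2 * r) (G ^ (2 * r) + H ^ (2 * r)) = 2 * (-1) ^ r := by
  -- Newton's recursion for two quantities with sum `1` and product `X ^ 2`. It bounds the degree of
  -- the `k`-th power sum by `k`, so at degree `2 * r` only the second term matters and the
  -- coefficient changes sign at each step.
  have hrec : ∀ k, G ^ (k + 2) + H ^ (k + 2) =
      (G ^ (k + 1) + H ^ (k + 1)) - (G ^ k + H ^ k) * X ^ 2 := by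
    intro k
    rw [← h2]
    linear_combination (G ^ (k + 1) + H ^ (k + 1)) * h1
  have hdeg : ∀ k, (∀ j, k < j → coeff j (G ^ k + H ^ k) = 0) ∧
      ∀ j, k + 1 < j → coeff j (G ^ (k + 1) + H ^ (k + 1)) = 0 := by
    intro k
    induction k with
    | zero =>
      constructor
      · intro j hj
        rw [pow_zero, pow_zero, map_add, coeff_one, if_neg (by omega), add_zero]
      · intro j hj
        rw [zero_add, pow_one, pow_one, h1, coeff_one, if_neg (by omega)]
    | succ k ih =>
      refine ⟨ih.2, fun j hj => ?_⟩
      obtain ⟨i, rfl⟩ : ∃ i, j = i + 2 := ⟨j - 2, by omega⟩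
      rw [add_assoc k 1 1, hrec, map_sub, coeff_mul_X_pow, ih.2 _ (by omega), ih.1 _ (by omega),
        sub_zero]
  refine ⟨fun k => (hdeg k).1, fun r => ?_⟩
  induction r with
  | zero => simp; norm_num
  | succ r ih =>
    rw [mul_add, mul_one, hrec, map_sub, coeff_mul_X_pow, ih, (hdeg _).2 _ (by omega), pow_succ]
    ring

theorem powCoeff_neg {r : ℕ} (hr : 0 < r) :
    powCoeff (-((2 * r : ℕ) : ℚ)) (2 * r) = 2 * (-1) ^ r := by
  set G := powSeries (-((1 : ℕ) : ℚ)) with hG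
  have h1 : G * weightSeries = 1 := (by
    have h := powSeries_neg_mul 1
    rwa [pow_one] at h)
  -- The functional equation divided by `weightSeries`.
  have h2 : G + X ^ 2 * weightSeries = 1 := by
    linear_combination G * weightSeries_eq.symm + (1 - X ^ 2 * weightSeries) * h1
  have h3 : G * (X ^ 2 * weightSeries) = X ^ 2 := by
    linear_combination X ^ 2 * h1
  have h4 : powSeries (-((2 * r : ℕ) : ℚ)) = G ^ (2 * r) := by
    have h5 : G ^ (2 * r) * weightSeries ^ (2 * r) = 1 := by rw [← mul_pow, h1, one_pow]
    linear_combination G ^ (2 * r) * powSeries_neg_mul (2 * r) -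
      powSeries (-((2 * r : ℕ) : ℚ)) * h5
  -- The power of `X ^ 2 * weightSeries` starts in degree `4 * r`, beyond `2 * r` since `r` is
  -- positive, and drops out.
  have h6 := (coeff_pow_add_pow h2 h3).2 r
  rw [map_add, ← h4, powSeries, coeff_mk, mul_pow, ← pow_mul, coeff_X_pow_mul',
    if_neg (by omega), add_zero] at h6
  exact h6

end CatalanWeight

namespace EvenPartition
open CatalanWeight

/-- The factor `(-1) ^ ℓ` in `poly` cancels the signs of the Catalan factors. -/
theorem coeff_mul_poly_eval {m : ℕ} (p : EvenPartition m) (x : ℚ) :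
    (p.coeff : ℚ) * p.poly.eval x =
      multWeight p.1.parts * (descPochhammer ℚ p.1.parts.card).eval x := by
  have h1 : (p.coeff : ℚ) * (-1) ^ p.length = (p.1.parts.map weight).prod := by
    have h2 : ∀ s : Multiset ℕ, (∀ i ∈ s, Even i) →
        (((s.map fun i => -(catalan (i / 2) : ℤ)).prod : ℤ) : ℚ) * (-1) ^ s.card =
          (s.map weight).prod := by
      intro s hs
      induction s using Multiset.induction_on with
      | empty => simp
      | cons a s ih =>
        rw [Multiset.map_cons, Multiset.map_cons, Multiset.prod_cons, Multiset.prod_cons,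
          ← ih fun i hi => hs i (Multiset.mem_cons_of_mem hi), Multiset.card_cons, pow_succ, weight,
          if_pos (hs a (Multiset.mem_cons_self a s))]
        push_cast
        ring
    exact h2 _ p.2
  rw [poly, Polynomial.eval_mul, Polynomial.eval_C, multWeight, ← h1, length]
  ring

theorem sum_coeff_mul_poly_eval {r : ℕ} (hr : 0 < r) :
    ∑ p : EvenPartition (2 * r), (p.coeff : ℚ) * p.poly.eval (-((2 * r : ℕ) : ℚ)) =
      2 * (-1 : ℚ) ^ r := by
  rw [← powCoeff_neg hr, powCoeff, partsFinset, Finset.sum_image]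
  · simp only [coeff_mul_poly_eval]
    -- A partition with an odd part has weight zero, so the sum over all partitions reduces to the
    -- even ones.
    rw [← Finset.sum_filter_of_ne (p := fun p : Nat.Partition (2 * r) => ∀ i ∈ p.parts, Even i),
      Finset.sum_subtype (p := fun p : Nat.Partition (2 * r) => ∀ i ∈ p.parts, Even i) _
        (fun p => by simp)]
    intro p _ hp i hi
    by_contra h
    apply hp
    rw [multWeight, Multiset.prod_eq_zero (Multiset.mem_map.2 ⟨i, hi, if_neg h⟩), zero_div,
      zero_mul]
  · intro p _ q _ h
    exact Nat.Partition.ext h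

end EvenPartition

theorem mainTheorem4 (r : ℕ) (hr : 0 < r) :
    ∃ A : EvenPartition (2 * r) → ℤ,
      SpinAlgebra.IsTopCoefficients r A ∧
      (∀ B : EvenPartition (2 * r) → ℤ, SpinAlgebra.IsTopCoefficients r B → B = A) ∧
      ∑ p : EvenPartition (2 * r), (A p : ℚ) * p.poly.eval (-((2 * r : ℕ) : ℚ)) =
        2 * (-1 : ℚ) ^ r :=
  ⟨EvenPartition.coeff, SpinRing.isTopCoefficients_coeff r,
    fun _ hB => SpinRing.isTopCoefficients_unique (SpinRing.isTopCoefficients_coeff r) hB,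
    EvenPartition.sum_coeff_mul_poly_eval hr⟩
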